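/- **Setting.** Let $(G,I,O)$ be a finite open graph: $G=(V,E)$ is a finite simple graph and $I,O\subseteq V$. A qubit sits on each vertex. Write $N(v)$ for the neighbourhood of $v$, $\mathrm{Odd}_G(S)$ for the set of vertices with an odd number of neighbours in $S$, and $\oplus$ for symmetric difference. Put $\mathrm{CZ}_{v;S}=\prod_{u\in S}\mathrm{CZ}_{v;u}$ and $\mathrm{CX}_{v;S}=\prod_{u\in S}\mathrm{CX}_{v;u}$ (control $v$), $J(\alpha)=\frac1{\sqrt2}\begin{pmatrix}1&e^{-i\alpha}\\1&-e^{-i\alpha}\end{pmatrix}$, and let $|G\rangle_\phi=\prod_{\{u,v\}\in E}\mathrm{CZ}_{u;v}\,|\phi\rangle_I|+\rangle_{V\setminus I}$ be the open graph state. *Gflow.* A gflow is a pair $(g,\prec)$ with $g:V\setminus O\to 2^{V\setminus I}$ and $\prec$ a strict partial order on $V$ such that for all $u\in V\setminus O$: $u\prec v$ for every $v\in g(u)$; $u\in\mathrm{Odd}_G(g(u))$; and $u=v$ or $u\prec v$ for every $v\in \mathrm{Odd}_G(g(u))$. Its layers are $V_k=\max_\prec\big(V\setminus\bigcup_{i<k}V_i\big)$.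 It is more delayed than $(g',\prec')$ if $|\bigcup_{i\le k}V_i|\ge|\bigcup_{i\le k}V'_i|$ for all $k$, strictly for some $k$; it is maximally delayed if no gflow is more delayed. *Matching gflow.* Let $(g,\prec)$ be a maximally delayed gflow and $V_1=\{v_1,\dots,v_n\}$ an enumeration of its layer $V_1$. Choose inductively $U_i\subseteq\{v_1,\dots,v_{i-1}\}$ such that $g(v_i)$ and $\bigoplus_{v\in U_i}g(v)$ have the same intersection with $\{h(v_1),\dots,h(v_{i-1})\}$, set $g_V(v_i)=g(v_i)\oplus\bigoplus_{v\in U_i}g(v)$, and choose $h(v_i)\in g_V(v_i)\cap N(v_i)$. Put $R_V=\{h(v_1),\dots,h(v_n)\}$. Let $G'=G_0$ be $G$ without the edges inside $O$, and let $G_i$ arise from $G_{i-1}$ by removing all edges at $h(v_i)$ and joining $h(v_i)$ to every vertex of $\mathrm{Odd}_{G'}(g_V(v_i))$. All $G_i$ keep the input set $I$ and the output set $O$. *Reduced open graph and iteration.* The reduced open graph is $(G_n\setminus R_V,\ I\setminus R_V,\ V_1\cup(O\setminus R_V))$. A *layerwise choice* consists of a matching gflow of $(G,I,O)$ with its $h$,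 then one of the reduced open graph, and so on until every vertex is an output. Together the functions $h$ form one function $h$ on $V\setminus O$. *Acausal SPT circuit.* A path cover with successor function $h$ on $V\setminus O$ is a cover of $V$ by vertex-disjoint directed paths along the edges $v\to h(v)$ of the graph, each meeting $I$ at most in its initial vertex and $O$ exactly in its final vertex. The circuit $C^G_{spt}$ has one wire for each path; wires starting in $I$ carry the input, and the other wires start in $|+\rangle$. Each $v\notin O$ gives a gate $J(\alpha_v)$ on its wire, in path order. The position $v!$ on the wire of $v$ lies just before $J(\alpha_v)$ and after $J(\alpha_{h^{-1}(v)})$ (for an output $v$ it lies at the end of the wire). For each edge $\{u,v\}$ that is not a path edge there is an acausal gate $$\mathrm{ACCZ}_{u!;v!}=\langle+|_{u'}\langle+|_{v'}\,\mathrm{CZ}_{u!;u'}\mathrm{CZ}_{u';v'}\mathrm{CZ}_{v';v!}\,|+\rangle_{u'}|+\rangle_{v'}$$ with two fresh ancillas $u',v'$. The circuit is read as a linear map from the input qubits to the wires. The gates on different wires may be interleaved in any way that respects the path order. Gates below labelled by vertices act on the wires of these vertices. **Statement.** In (2) and (3), "$\propto$" is equality up to a positive real factor that does not depend on the angles $\alpha$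 or on the interleavings. 1. Every finite open graph that has a gflow admits a layerwise choice. 2. Let $(g_V,h)$ be a matching gflow of $(G,I,O)$ with its successor function, and let $h$ be extended in any way to the successor function on $V\setminus O$ of a path cover of $(G,I,O)$. An admissible interleaving exists, $h$ gives a path cover of every $(G_i,I,O)$, $0\le i\le n$, and for $1\le i\le n$ and every input $\phi$ $$|G_{i-1}\rangle_\phi=\mathrm{CX}_{h(v_i);\,g_V(v_i)\oplus h(v_i)}|G_i\rangle_\phi ,\qquad \mathrm{CX}_{h(v_i);\,g_V(v_i)\oplus h(v_i)}\,C^{G_{i-1}}_{spt}\ \propto\ C^{G_i}_{spt}.$$ Moreover $C^{G}_{spt}\propto U_O\,C^{G_n}_{spt}$, where $$U_O=\prod_{\{u,v\}\in E,\ u,v\in O}\mathrm{CZ}_{u;v}\ \mathrm{CX}_{h(v_1);\,g_V(v_1)\oplus h(v_1)}\cdots\mathrm{CX}_{h(v_n);\,g_V(v_n)\oplus h(v_n)}$$ (rightmost factor first). The last layer of $G_n$ needs no acausal gate: $C^{G_n}_{spt}\propto U_{spt}\,C^{red}_{spt}$, where $C^{red}_{spt}$ is the acausal circuit of the reduced open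 graph on the same wires (started in the same way) and $U_{spt}$ is the ordinary circuit that performs, in order of time, $J(\alpha_{v_n})$, $\mathrm{CZ}_{v_n;\mathrm{Odd}_{G'}(g_V(v_n))\setminus v_n}$, $J(\alpha_{v_{n-1}})$, $\mathrm{CZ}_{v_{n-1};\mathrm{Odd}_{G'}(g_V(v_{n-1}))\setminus v_{n-1}}$, $\dots$, $J(\alpha_{v_1})$. 3. For every layerwise choice, the resulting function $h$ on $V\setminus O$ is the successor function of a path cover of $(G,I,O)$, and $C^G_{spt}\propto C$. Here $C$ is the ordinary circuit, without acausal gates, ancillas or post-selection, of the layer-by-layer translation: the circuit of the reduced open graph (defined recursively; if all vertices are outputs, the $\mathrm{CZ}$-gates of all edges), followed by $U_{spt}$ and then by $U_O$. The map implemented by $C$ preserves the norm, so $C$ is deterministic. -/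

import Mathlib

open scoped Classical

noncomputable section

namespace MBQC

universe u

/-! ## Qubit registers and ordinary circuits -/

/-- State vectors of a register of qubits labelled by `Q`, as amplitude functions in the
computational basis. -/
abbrev State (Q : Type*) := (Q → Fin 2) → ℂ

/-- The amplitude `1 / √2` of each basis vector in `|+⟩`. -/
def plusAmp : ℂ := ((Real.sqrt 2 : ℝ) : ℂ)⁻¹

/-- The matrix of `J(α)`. -/
def Jmat (a : ℝ) : Matrix (Fin 2) (Fin 2) ℂ :=
  plusAmp • !![1, Complex.exp (-(Complex.I * a)); 1, -Complex.exp (-(Complex.I * a))]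

/-- Elementary gates on a register `Q`. In `CX p q` the control is `p` and the target is `q`. -/
inductive Gate (Q : Type*)
  | J (a : ℝ) (q : Q)
  | CZ (p q : Q)
  | CX (p q : Q)

/-- Relabelling the qubits of a gate. -/
def Gate.map {Q Q' : Type*} (f : Q → Q') : Gate Q → Gate Q'
  | .J a q => .J a (f q)
  | .CZ p q => .CZ (f p) (f q)
  | .CX p q => .CX (f p) (f q)

/-- The linear operator of a gate. -/
def Gate.op {Q : Type*} : Gate Q → (State Q →ₗ[ℂ] State Q)
  | .J a q =>
    { toFun := fun ψ x => ∑ b : Fin 2, Jmat a (x q) b * ψ (Function.update x q b)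
      map_add' := by
        intro ψ φ; funext x; simp [mul_add, Finset.sum_add_distrib]
      map_smul' := by
        intro c ψ; funext x
        simp only [Pi.smul_apply, smul_eq_mul, RingHom.id_apply, Finset.mul_sum]
        exact Finset.sum_congr rfl fun b _ => by ring }
  | .CZ p q =>
    { toFun := fun ψ x => (if x p = 1 ∧ x q = 1 then -1 else 1) * ψ x
      map_add' := by intro ψ φ; funext x; simp [mul_add]
      map_smul' := by
        intro c ψ; funext x
        simp only [Pi.smul_apply, smul_eq_mul, RingHom.id_apply]; ring }
  | .CX p q =>
    { toFun := fun ψ x => ψ (Function.update x q (x q + x p))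
      map_add' := by intro ψ φ; rfl
      map_smul' := by intro c ψ; rfl }

/-- Running an ordinary circuit: the head of the list acts first. -/
def run {Q : Type*} : List (Gate Q) → (State Q →ₗ[ℂ] State Q)
  | [] => LinearMap.id
  | g :: gs => run gs ∘ₗ g.op

/-- `CZ_{v;S}`, the product of the gates `CZ_{v;u}`, `u ∈ S`. -/
def czStar {Q : Type*} (v : Q) (S : Finset Q) : List (Gate Q) := S.toList.map (Gate.CZ v)

/-- `CX_{v;S}`, the product of the gates `CX_{v;u}`, `u ∈ S`. -/
def cxStar {Q : Type*} (v : Q) (S : Finset Q) : List (Gate Q) := S.toList.map (Gate.CX v)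

/-- The product of the gates `CZ_{u;v}` over a set of unordered pairs `{u, v}`. -/
def czEdges {Q : Type*} (E : Finset (Sym2 Q)) : List (Gate Q) :=
  E.toList.map fun e => Gate.CZ (Quot.out e).1 (Quot.out e).2

/-- Adjoining ancilla qubits `A`, each prepared in `|+⟩`. -/
def preparePlus (W A : Type*) [Fintype A] : State W →ₗ[ℂ] State (W ⊕ A) where
  toFun ψ := fun x => plusAmp ^ Fintype.card A * ψ (fun w => x (Sum.inl w))
  map_add' := by intro ψ φ; funext x; simp [mul_add]
  map_smul' := by
    intro c ψ; funext x
    simp only [Pi.smul_apply, smul_eq_mul, RingHom.id_apply]; ring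

/-- Applying `⟨+|` to each of the ancilla qubits `A` (post-selection, not renormalized). -/
def postselectPlus (W A : Type*) [Fintype A] : State (W ⊕ A) →ₗ[ℂ] State W where
  toFun Ψ := fun y => ∑ a : A → Fin 2, plusAmp ^ Fintype.card A * Ψ (Sum.elim y a)
  map_add' := by intro ψ φ; funext x; simp [mul_add, Finset.sum_add_distrib]
  map_smul' := by
    intro c ψ; funext x
    simp only [Pi.smul_apply, smul_eq_mul, RingHom.id_apply, Finset.mul_sum]
    exact Finset.sum_congr rfl fun b _ => by ring

/-- Initialization of the wires `W` of a circuit: the wires of the input vertices (`wire` maps a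
vertex to its wire) carry the joint input state, every other wire is prepared in `|+⟩`. -/
def prepareInput {V W : Type*} [Fintype W] (I : Finset V) (wire : V → W) :
    State I →ₗ[ℂ] State W where
  toFun ψ := fun x =>
    plusAmp ^ (Finset.univ.filter fun w : W => ∀ i ∈ I, wire i ≠ w).card
      * ψ (fun i => x (wire i))
  map_add' := by intro ψ φ; funext x; simp [mul_add]
  map_smul' := by
    intro c ψ; funext x
    simp only [Pi.smul_apply, smul_eq_mul, RingHom.id_apply]; ring

/-! ## Acausal circuits -/

/-- An entry of the timeline of an acausal circuit with wires `W`: an ordinary gate, or a marker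
that gives the name `p` to the present position on the wire `w`. -/
inductive Item (W P : Type*)
  | gate (g : Gate W)
  | pos (p : P) (w : W)

/-- An acausal circuit: time-ordered gates and named positions, together with the pairs of
positions on which an acausal `CZ`-gate `ACCZ` acts. -/
structure AcausalCircuit (W P : Type*) where
  timeline : List (Item W P)
  acausal : SimpleGraph P

/-- Two ancillas for every acausal gate `ACCZ_{p;q}`: `p'` is the dart `(p, q)`, and `q'` is the
dart `(q, p)`. The gate is replaced by `CZ_{p;p'}` at position `p`, `CZ_{p';q'}`, and `CZ_{q';q}`
at position `q`. -/
def AcausalCircuit.expand {W P : Type*} [Fintype P] (C : AcausalCircuit W P) :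
    List (Gate (W ⊕ C.acausal.Dart)) :=
  czEdges (Finset.univ.image fun d : C.acausal.Dart =>
      s((Sum.inr d : W ⊕ C.acausal.Dart), Sum.inr d.symm))
    ++ C.timeline.flatMap fun
      | .gate g => [g.map Sum.inl]
      | .pos p w => (Finset.univ.filter fun d : C.acausal.Dart => d.fst = p).toList.map
          fun d => Gate.CZ (Sum.inl w) (Sum.inr d)

/-- The operator of an acausal circuit on its wires: the ancillas are prepared in `|+⟩`, and
post-selected on `|+⟩` at the end. -/
def AcausalCircuit.op {W P : Type*} [Fintype P] (C : AcausalCircuit W P) :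
    State W →ₗ[ℂ] State W :=
  postselectPlus W C.acausal.Dart ∘ₗ run C.expand ∘ₗ preparePlus W C.acausal.Dart

/-! ## Open graphs, gflow, layers -/

/-- An open graph `(G, I, O)` whose vertices form a subset `verts` of a type `V`. -/
structure OpenGraph (V : Type u) where
  verts : Finset V
  graph : SimpleGraph V
  inputs : Finset V
  outputs : Finset V
  adj_mem : ∀ a b, graph.Adj a b → a ∈ verts
  inputs_subset : inputs ⊆ verts
  outputs_subset : outputs ⊆ verts

/-- `⨁_{k ∈ s} f k`, the iterated symmetric difference. -/
def bigSymmDiff {V : Type u} [Fintype V] {ι : Type*} (s : Finset ι) (f : ι → Finset V) :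
    Finset V :=
  Finset.univ.filter fun w => Odd (s.filter fun k => w ∈ f k).card

/-- The open graph state as a map of the input state:
`|φ⟩ ↦ (∏_{{u,v} ∈ E} CZ_{u;v}) |φ⟩_I |+⟩_{I^C}`. -/
def graphState {V : Type u} [Fintype V] (G : SimpleGraph V) (I : Finset V) :
    State I →ₗ[ℂ] State V :=
  run (czEdges G.edgeFinset) ∘ₗ prepareInput I id

/-- The graph obtained by removing all edges at `r` and joining `r` to all vertices of `S`. -/
def rewire {V : Type u} (G : SimpleGraph V) (r : V) (S : Finset V) : SimpleGraph V where
  Adj a b := a ≠ b ∧ ((a ≠ r ∧ b ≠ r ∧ G.Adj a b) ∨ (a = r ∧ b ∈ S) ∨ (b = r ∧ a ∈ S))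
  symm := ⟨by
    rintro a b ⟨hab, h⟩
    refine ⟨hab.symm, ?_⟩
    rcases h with ⟨h1, h2, h3⟩ | h | h
    · exact Or.inl ⟨h2, h1, h3.symm⟩
    · exact Or.inr (Or.inr h)
    · exact Or.inr (Or.inl h)⟩
  loopless := ⟨fun _ h => h.1 rfl⟩

namespace OpenGraph

variable {V : Type u} [Fintype V]

/-- The odd neighbourhood of `S`. -/
def odd (Γ : OpenGraph V) (S : Finset V) : Finset V :=
  Γ.verts.filter fun v => Odd (S.filter fun w => Γ.graph.Adj v w).card

/-- `(g, ≺)` is a gflow. Only the values of `g` at non-output vertices matter. -/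
structure IsGFlow (Γ : OpenGraph V) (g : V → Finset V) (lt : V → V → Prop) : Prop where
  irrefl : ∀ a ∈ Γ.verts, ¬ lt a a
  trans : ∀ a ∈ Γ.verts, ∀ b ∈ Γ.verts, ∀ c ∈ Γ.verts, lt a b → lt b c → lt a c
  g_subset : ∀ a ∈ Γ.verts, a ∉ Γ.outputs → g a ⊆ Γ.verts \ Γ.inputs
  g1 : ∀ a ∈ Γ.verts, a ∉ Γ.outputs → ∀ b ∈ g a, lt a b
  g2 : ∀ a ∈ Γ.verts, a ∉ Γ.outputs → a ∈ Γ.odd (g a)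
  g3 : ∀ a ∈ Γ.verts, a ∉ Γ.outputs → ∀ b ∈ Γ.odd (g a), a = b ∨ lt a b

/-- `max_≺ X`. -/
def maxSet (lt : V → V → Prop) (X : Finset V) : Finset V :=
  X.filter fun a => ∀ b ∈ X, ¬ lt a b

/-- The union of the layers `V_i` with `i < k`. -/
def layersBelow (Γ : OpenGraph V) (lt : V → V → Prop) : ℕ → Finset V
  | 0 => ∅
  | k + 1 => Γ.layersBelow lt k ∪ maxSet lt (Γ.verts \ Γ.layersBelow lt k)

/-- The layer `V_k`. -/
def layer (Γ : OpenGraph V) (lt : V → V → Prop) (k : ℕ) : Finset V :=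
  maxSet lt (Γ.verts \ Γ.layersBelow lt k)

/-- A gflow with order `lt` is more delayed than a gflow with order `lt'`. -/
def MoreDelayed (Γ : OpenGraph V) (lt lt' : V → V → Prop) : Prop :=
  (∀ k, (Γ.layersBelow lt' (k + 1)).card ≤ (Γ.layersBelow lt (k + 1)).card) ∧
    ∃ k, (Γ.layersBelow lt' (k + 1)).card < (Γ.layersBelow lt (k + 1)).card

/-- A maximally delayed gflow: no gflow is more delayed. -/
def IsMaximallyDelayed (Γ : OpenGraph V) (g : V → Finset V) (lt : V → V → Prop) : Prop :=
  Γ.IsGFlow g lt ∧ ∀ g' lt', Γ.IsGFlow g' lt' → ¬ Γ.MoreDelayed lt' lt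

/-- The edges that join two output vertices. -/
def outputEdges (Γ : OpenGraph V) : Finset (Sym2 V) :=
  Γ.graph.edgeFinset.filter fun e => ∀ a ∈ e, a ∈ Γ.outputs

/-- The open graph `(G', I, O)`: the edges inside `O` are removed. -/
def removeOutputEdges (Γ : OpenGraph V) : OpenGraph V where
  verts := Γ.verts
  graph :=
    { Adj := fun a b => Γ.graph.Adj a b ∧ ¬ (a ∈ Γ.outputs ∧ b ∈ Γ.outputs)
      symm := ⟨fun _ _ h => ⟨h.1.symm, fun h' => h.2 ⟨h'.2, h'.1⟩⟩⟩
      loopless := ⟨fun a h => Γ.graph.loopless.irrefl a h.1⟩ }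
  inputs := Γ.inputs
  outputs := Γ.outputs
  adj_mem := fun a b h => Γ.adj_mem a b h.1
  inputs_subset := Γ.inputs_subset
  outputs_subset := Γ.outputs_subset

/-! ## Path covers and the star pattern transformation -/

/-- The function `h` is the successor function of a path cover of `(G, I, O)`: the maximal
sequences `a, h a, h (h a), …` are vertex-disjoint directed paths in `G` that cover all vertices,
meet `I` at most in their initial vertex, and meet `O` exactly in their final vertex. Only the
values of `h` at non-output vertices matter. -/
structure IsPathCover (Γ : OpenGraph V) (h : V → V) : Prop where
  adj : ∀ a ∈ Γ.verts, a ∉ Γ.outputs → Γ.graph.Adj a (h a)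
  not_input : ∀ a ∈ Γ.verts, a ∉ Γ.outputs → h a ∉ Γ.inputs
  inj : ∀ a ∈ Γ.verts, a ∉ Γ.outputs → ∀ b ∈ Γ.verts, b ∉ Γ.outputs → h a = h b → a = b
  reaches : ∀ a ∈ Γ.verts, ∃ k : ℕ, h^[k] a ∈ Γ.outputs

/-- The non-path edges. -/
def nonPath (Γ : OpenGraph V) (h : V → V) : SimpleGraph V where
  Adj a b := Γ.graph.Adj a b ∧ ¬ (a ∉ Γ.outputs ∧ h a = b) ∧ ¬ (b ∉ Γ.outputs ∧ h b = a)
  symm := ⟨fun _ _ h => ⟨h.1.symm, h.2.2, h.2.1⟩⟩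
  loopless := ⟨fun a h => Γ.graph.loopless.irrefl a h.1⟩

/-- A list of the vertices in which every vertex precedes its successor on its path: an order in
which the vertices may be processed so that the gates of each wire appear in their right order. -/
structure IsSchedule (Γ : OpenGraph V) (h : V → V) (L : List V) : Prop where
  nodup : L.Nodup
  mem_iff : ∀ a, a ∈ L ↔ a ∈ Γ.verts
  order : L.Pairwise fun a b => ¬ (b ∉ Γ.outputs ∧ h b = a)

/-- The acausal circuit given by the star pattern transformation with angles `α`. For each vertex
`a` the position `a!` is marked on the wire of `a`, and it is followed by `J(α_a)` if `a` is not an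
output. An acausal `CZ`-gate `ACCZ_{a!;b!}` is placed for each non-path edge `{a, b}`. -/
def spt (Γ : OpenGraph V) {W : Type u} (h : V → V) (wire : V → W) (α : V → ℝ) (L : List V) :
    AcausalCircuit W V where
  timeline := L.flatMap fun a =>
    Item.pos a (wire a) :: if a ∈ Γ.outputs then [] else [Item.gate (Gate.J (α a) (wire a))]
  acausal := Γ.nonPath h

end OpenGraph

/-- The wires of the path cover with outputs `O` and successor function `h`: vertices `a` and `h a`
are on the same wire. -/
def Wire {V : Type u} (O : Finset V) (h : V → V) : Type u :=
  Quot fun a b : V => a ∉ O ∧ h a = b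

instance {V : Type u} [Fintype V] (O : Finset V) (h : V → V) : Fintype (Wire O h) :=
  haveI : Finite (Wire O h) := inferInstanceAs (Finite (Quot _))
  Fintype.ofFinite _

/-- The wire of a vertex. -/
def Wire.of {V : Type u} (O : Finset V) (h : V → V) (a : V) : Wire O h := Quot.mk _ a

/-! ## Matching gflow of the penultimate layer -/

/-- The set `g_V(v_i) = g(v_i) ⊕ ⨁_{k ∈ U_i} g(v_k)`. -/
def matchingG {V : Type u} [Fintype V] {n : ℕ} (g : V → Finset V) (v : Fin n → V)
    (U : Fin n → Finset (Fin n)) (i : Fin n) : Finset V :=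
  symmDiff (g (v i)) (bigSymmDiff (U i) fun k => g (v k))

/-- The data of the inductive construction of a matching gflow of `(G, I, O)`, from a maximally
delayed gflow `(g, ≺)` and an enumeration `v_1, …, v_n` of the layer `V_1`: index sets `U_i` of
earlier vertices for which `g(v_i)` and `⨁_{k ∈ U_i} g(v_k)` agree on
`{h(v_1), …, h(v_{i-1})}`, and the value `h(v_i)` of the successor function, chosen in `g_V(v_i)`
among the neighbours of `v_i`. Indices start from `0` here. -/
structure MatchingGFlow {V : Type u} [Fintype V] (Γ : OpenGraph V) where
  g : V → Finset V
  lt : V → V → Prop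
  maximallyDelayed : Γ.IsMaximallyDelayed g lt
  n : ℕ
  v : Fin n → V
  v_injective : Function.Injective v
  mem_layer_iff : ∀ a, a ∈ Γ.layer lt 1 ↔ ∃ i, v i = a
  U : Fin n → Finset (Fin n)
  U_lt : ∀ i, ∀ k ∈ U i, k < i
  h : Fin n → V
  U_spec : ∀ i, (Finset.univ.filter (· < i)).image h ∩ g (v i)
    = (Finset.univ.filter (· < i)).image h ∩ bigSymmDiff (U i) fun k => g (v k)
  h_mem : ∀ i, h i ∈ matchingG g v U i
  h_adj : ∀ i, Γ.graph.Adj (v i) (h i)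

namespace MatchingGFlow

variable {V : Type u} [Fintype V] {Γ : OpenGraph V}

/-- `g_V(v_i)`. -/
def gV (M : MatchingGFlow Γ) (i : Fin M.n) : Finset V := matchingG M.g M.v M.U i

/-- `R_V = {h(v_1), …, h(v_n)}`. -/
def R (M : MatchingGFlow Γ) : Finset V := Finset.univ.image M.h

/-- `Odd_{G'}(g_V(v_i))`. -/
def oddGV (M : MatchingGFlow Γ) (i : Fin M.n) : Finset V := Γ.removeOutputEdges.odd (M.gV i)

/-- One step of the controlled-stabilizer rewriting, on open graphs with the same vertices as `Γ`:
all edges at `h(v_i)` are removed and `h(v_i)` is joined to `Odd_{G'}(g_V(v_i))`. -/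
def rewrite (M : MatchingGFlow Γ) (i : Fin M.n) (Δ : OpenGraph V) (hΔ : Δ.verts = Γ.verts) :
    OpenGraph V where
  verts := Δ.verts
  graph := rewire Δ.graph (M.h i) (M.oddGV i)
  inputs := Δ.inputs
  outputs := Δ.outputs
  adj_mem := by
    have hr : M.h i ∈ Γ.verts := Γ.adj_mem _ _ (M.h_adj i).symm
    have hS : ∀ c ∈ M.oddGV i, c ∈ Γ.verts := fun c hc => (Finset.mem_filter.mp hc).1
    rintro a b ⟨-, ⟨-, -, h⟩ | ⟨h, -⟩ | ⟨-, h⟩⟩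
    · exact Δ.adj_mem _ _ h
    · rw [hΔ, h]; exact hr
    · rw [hΔ]; exact hS a h
  inputs_subset := Δ.inputs_subset
  outputs_subset := Δ.outputs_subset

/-- The sequence `G_0 = G', G_1, …, G_n` (constant from `n` on). -/
def seqAux (M : MatchingGFlow Γ) : ℕ → {Δ : OpenGraph V // Δ.verts = Γ.verts}
  | 0 => ⟨Γ.removeOutputEdges, rfl⟩
  | k + 1 =>
    if hk : k < M.n then ⟨M.rewrite ⟨k, hk⟩ (M.seqAux k).1 (M.seqAux k).2, (M.seqAux k).2⟩
    else M.seqAux k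

/-- The open graph `(G_k, I, O)`. -/
def seq (M : MatchingGFlow Γ) (k : ℕ) : OpenGraph V := (M.seqAux k).1

/-- `CX_{h(v_i); g_V(v_i) ⊕ h(v_i)}`, with qubits labelled by vertices. -/
def cx (M : MatchingGFlow Γ) (i : Fin M.n) : List (Gate V) :=
  cxStar (M.h i) (symmDiff (M.gV i) {M.h i})

/-- The operator `CX_{h(v_1); …} ⋯ CX_{h(v_n); …}`; the gates for `v_n` act first. -/
def cxAll (M : MatchingGFlow Γ) : List (Gate V) := (List.finRange M.n).reverse.flatMap M.cx

/-- The circuit `U_spt` from `V_1` to `R_V`: in order of time `J(α_{v_n})`,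
`CZ_{v_n; Odd_{G'}(g_V(v_n)) \ v_n}`, `J(α_{v_{n-1}})`, …, `J(α_{v_1})`. -/
def uspt (M : MatchingGFlow Γ) (α : V → ℝ) : List (Gate V) :=
  (List.finRange M.n).reverse.flatMap fun i =>
    Gate.J (α (M.v i)) (M.v i) :: czStar (M.v i) ((M.oddGV i).erase (M.v i))

/-- The circuit `U_O`: the `CX`-gates, followed by the `CZ`-gates for the edges inside `O`. -/
def uO (M : MatchingGFlow Γ) : List (Gate V) := M.cxAll ++ czEdges Γ.outputEdges

/-- The reduced open graph: `R_V` is deleted from `G_n`, and the outputs are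
`V_1 ∪ (O \ R_V)`. -/
def reduced (M : MatchingGFlow Γ) : OpenGraph V where
  verts := Γ.verts \ M.R
  graph :=
    { Adj := fun a b => (M.seq M.n).graph.Adj a b ∧ a ∉ M.R ∧ b ∉ M.R
      symm := ⟨fun _ _ h => ⟨h.1.symm, h.2.2, h.2.1⟩⟩
      loopless := ⟨fun a h => (M.seq M.n).graph.loopless.irrefl a h.1⟩ }
  inputs := Γ.inputs \ M.R
  outputs := (Γ.layer M.lt 1 ∪ Γ.outputs) \ M.R
  adj_mem := fun a b h => Finset.mem_sdiff.mpr
    ⟨(M.seqAux M.n).2 ▸ (M.seq M.n).adj_mem a b h.1, h.2.1⟩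
  inputs_subset := Finset.sdiff_subset_sdiff Γ.inputs_subset (Finset.Subset.refl _)
  outputs_subset := by
    refine Finset.sdiff_subset_sdiff (Finset.union_subset ?_ Γ.outputs_subset)
      (Finset.Subset.refl _)
    exact (Finset.filter_subset _ _).trans Finset.sdiff_subset

end MatchingGFlow

/-! ## The layer-by-layer translation -/

/-- The choices made in the layer-by-layer (first) translation: a matching gflow of the open graph,
then one of the reduced open graph, and so on until all vertices are outputs. -/
inductive Translation {V : Type u} [Fintype V] : OpenGraph V → Type u
  | done (Γ : OpenGraph V) (hΓ : Γ.verts = Γ.outputs) : Translation Γ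
  | step {Γ : OpenGraph V} (M : MatchingGFlow Γ) (T : Translation M.reduced) : Translation Γ

namespace Translation

variable {V : Type u} [Fintype V]

/-- The successor function `h` on all non-output vertices (extended by the identity). -/
def succ : {Γ : OpenGraph V} → Translation Γ → V → V
  | _, .done _ _ => id
  | _, .step M T => fun a => if hi : ∃ i, M.v i = a then M.h hi.choose else T.succ a

/-- The ordinary circuit of the first translation method, with gates on the wires labelled by
vertices: the circuit of the reduced graph, then `U_spt`, then `U_O`. -/
def circuit (α : V → ℝ) : {Γ : OpenGraph V} → Translation Γ → List (Gate V)
  | Γ, .done _ _ => czEdges Γ.outputEdges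
  | _, .step M T => T.circuit α ++ M.uspt α ++ M.uO

end Translation

end MBQC

end

namespace MBQC

universe u

/-! ## Signs, phases and diagonal circuits -/

/-! Every circuit in the statement, acausal or ordinary, is compared with one normal form,
`OpenGraph.pathSum`: a sum over bit assignments `z` of the vertices, with the output bits fixed by
the final basis state. Each term is the input amplitude times the sign `(-1)^{z_u z_v}` of every
edge times a phase for every measured vertex. Two operators that are positive multiples of the same
path sum are proportional, which gives all the relations `∝`.

For an acausal circuit (`spt_eq_pathSum`), each `J` gate on the wire of `a` sums over the bit before
the gate, which becomes `z a`. Its matrix entry supplies the sign of the path edge from `a` to `h a`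
and the phase of `a`. Summing out the two ancillas of an acausal gate leaves the sign of a non-path
edge (`sum_sgn_pair`). No causal order enters.

The rewriting of the last layers is linear algebra over the field with two elements. Maximal delay
forces the last layer to be `O`, and then `g(v) ⊆ O` and `Odd_{G'}(g(v)) = {v}` for every `v` in the
next layer. Recombining the `g(v_i)` is Gaussian elimination with pivots `h(v_i)`: later sets avoid
earlier pivots. Adding the bit of `h(v_i)` to the other bits of `g_V(v_i)` is a change of variables
`shift`. It changes the edge signs exactly as the replacement of the edges at `h(v_i)` does
(`graphSign_seq`). On wires it is the family of `CX` gates.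

In `G_n` the vertex `h(v_i)` is adjacent only to `v_k` with `k ≤ i`, among them `v_i`. Summing over
the bit of `v_i` is therefore a `J` gate followed by `CZ` gates to wires whose current vertices are
earlier `v_k` (`run_step_pathSum`). Peeling these off for all `i` leads to the reduced open graph
(`run_uspt_pathSum`). That graph has a gflow again, since every `g(a)` can be cleared of pivots by
adding sets `g(v_k)` (`reduced_isGFlow`), and it has fewer non-outputs. Induction gives existence,
the path cover and the translated circuit. The norm is preserved because all gates are unitary, the
`CX` gates acting between distinct wires. -/

/-- The character `b ↦ (-1)^b`. -/
noncomputable def sgn (b : Fin 2) : ℂ := if b = 1 then -1 else 1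

/-- The sign contributed by an edge to an assignment of its endpoints. -/
noncomputable def edgeSign {Q : Type*} (z : Q → Fin 2) (e : Sym2 Q) : ℂ :=
  if ∀ q ∈ e, z q = 1 then -1 else 1

/-- The diagonal phase `b ↦ e^{-iab}`. -/
noncomputable def phase (a : ℝ) (b : Fin 2) : ℂ :=
  if b = 1 then Complex.exp (-(Complex.I * a)) else 1

@[simp] theorem sgn_zero : sgn 0 = 1 := by simp [sgn]

theorem sgn_add (a b : Fin 2) : sgn (a + b) = sgn a * sgn b := by
  fin_cases a <;> fin_cases b <;> simp [sgn]

theorem sgn_mul_self (b : Fin 2) : sgn b * sgn b = 1 := by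
  fin_cases b <;> simp [sgn]

theorem edgeSign_mk {Q : Type*} (z : Q → Fin 2) (p q : Q) :
    edgeSign z s(p, q) = sgn (z p * z q) := by
  have key : ∀ a b : Fin 2, (a * b = 1) ↔ (a = 1 ∧ b = 1) := by decide
  simp [edgeSign, sgn, key]

theorem Jmat_apply (a : ℝ) (x b : Fin 2) : Jmat a x b = plusAmp * sgn (x * b) * phase a b := by
  fin_cases x <;> fin_cases b <;> simp [Jmat, sgn, phase]

theorem run_nil {Q : Type*} (ψ : State Q) : run ([] : List (Gate Q)) ψ = ψ := rfl

theorem run_cons {Q : Type*} (g : Gate Q) (l : List (Gate Q)) (ψ : State Q) :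
    run (g :: l) ψ = run l (g.op ψ) := rfl

theorem run_append {Q : Type*} (l l' : List (Gate Q)) (ψ : State Q) :
    run (l ++ l') ψ = run l' (run l ψ) := by
  induction l generalizing ψ with
  | nil => rfl
  | cons g l ih => exact ih _

theorem CZ_op_apply {Q : Type*} (p q : Q) (ψ : State Q) (x : Q → Fin 2) :
    (Gate.CZ p q).op ψ x = sgn (x p * x q) * ψ x := by
  rw [← edgeSign_mk]
  simp [Gate.op, edgeSign]

theorem J_op_apply {Q : Type*} (a : ℝ) (q : Q) (ψ : State Q) (x : Q → Fin 2) :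
    (Gate.J a q).op ψ x
      = ∑ b : Fin 2, plusAmp * sgn (x q * b) * phase a b * ψ (Function.update x q b) := by
  simp only [← Jmat_apply]; rfl

theorem run_map_CZ {Q ι : Type*} (l : List ι) (p q : ι → Q) (ψ : State Q) (x : Q → Fin 2) :
    run (l.map fun i => Gate.CZ (p i) (q i)) ψ x
      = (l.map fun i => sgn (x (p i) * x (q i))).prod * ψ x := by
  induction l generalizing ψ with
  | nil => simp [run_nil]
  | cons i l ih =>
    rw [List.map_cons, run_cons, ih, CZ_op_apply, List.map_cons, List.prod_cons]; ring

theorem mk_quot_out {Q : Type*} (e : Sym2 Q) : s((Quot.out e : Q × Q).1, (Quot.out e : Q × Q).2) = e :=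
  Quot.out_eq e

theorem run_czEdges {Q : Type*} (E : Finset (Sym2 Q)) (ψ : State Q) (x : Q → Fin 2) :
    run (czEdges E) ψ x = (∏ e ∈ E, edgeSign x e) * ψ x := by
  rw [czEdges, run_map_CZ, ← Finset.prod_map_toList]
  simp only [← edgeSign_mk, mk_quot_out]

theorem run_czEdges_map {Q W : Type*} (f : Q → W) (E : Finset (Sym2 Q)) (ψ : State W)
    (x : W → Fin 2) :
    run ((czEdges E).map (Gate.map f)) ψ x = (∏ e ∈ E, edgeSign (x ∘ f) e) * ψ x := by
  rw [czEdges, List.map_map]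
  refine (run_map_CZ _ (fun e : Sym2 Q => f (Quot.out e).1)
    (fun e : Sym2 Q => f (Quot.out e).2) ψ x).trans ?_
  rw [← Finset.prod_map_toList]
  congr 3
  funext e
  rw [← mk_quot_out e, edgeSign_mk, mk_quot_out]; rfl

theorem run_czStar_map {Q W : Type*} (f : Q → W) (v : Q) (S : Finset Q) (ψ : State W)
    (x : W → Fin 2) :
    run ((czStar v S).map (Gate.map f)) ψ x = (∏ b ∈ S, sgn (x (f v) * x (f b))) * ψ x := by
  rw [czStar, List.map_map]
  refine (run_map_CZ _ (fun _ => f v) f ψ x).trans ?_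
  rw [← Finset.prod_map_toList]

/-- The control bit is never a target, so it stays constant and each target is flipped by the same
bit. A repeated target would cancel, hence `Nodup`. -/
theorem run_map_CX {Q : Type*} (p : Q) (l : List Q) (hl : l.Nodup) (hp : p ∉ l) (ψ : State Q)
    (x : Q → Fin 2) :
    run (l.map (Gate.CX p)) ψ x = ψ fun q => if q ∈ l then x q + x p else x q := by
  induction l generalizing ψ with
  | nil => simp [run_nil]
  | cons i l ih =>
    rw [List.nodup_cons] at hl
    rw [List.mem_cons, not_or] at hp
    rw [List.map_cons, run_cons, ih hl.2 hp.2]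
    change ψ _ = _
    congr 1
    funext q
    by_cases hq : q = i
    · subst hq
      simp [hl.1, hp.2]
    · simp [hq]

theorem run_cxStar_map {Q W : Type*} (f : Q → W) (r : Q) (S : Finset Q)
    (hf : ∀ a ∈ S, ∀ b ∈ S, f a = f b → a = b) (hr : ∀ a ∈ S, f a ≠ f r) (ψ : State W)
    (x : W → Fin 2) :
    run ((cxStar r S).map (Gate.map f)) ψ x
      = ψ fun w => if ∃ a ∈ S, f a = w then x w + x (f r) else x w := by
  have h1 : (cxStar r S).map (Gate.map f) = (S.toList.map f).map (Gate.CX (f r)) := by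
    simp [cxStar, List.map_map, Function.comp_def, Gate.map]
  rw [h1, run_map_CX]
  · simp
  · refine (List.nodup_map_iff_inj_on S.nodup_toList).2 ?_
    simpa using hf
  · simpa using hr

theorem run_cxStar {Q : Type*} (r : Q) (S : Finset Q) (hr : r ∉ S) (ψ : State Q)
    (x : Q → Fin 2) :
    run (cxStar r S) ψ x = ψ fun w => if w ∈ S then x w + x r else x w := by
  rw [cxStar, run_map_CX _ _ S.nodup_toList (by simpa using hr)]
  simp

/-! ## The sign of a graph -/

/-- The diagonal amplitude `∏_{{u,v} ∈ E} (-1)^{z_u z_v}` of `∏ CZ` over the edges of a graph. -/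
noncomputable def graphSign {V : Type*} [Fintype V] (G : SimpleGraph V) (z : V → Fin 2) : ℂ :=
  ∏ e ∈ G.edgeFinset, edgeSign z e

/-- The edges at an independent set `X` may be split off. -/
theorem graphSign_split {V : Type*} [Fintype V] (G : SimpleGraph V) (X : Finset V)
    (hX : ∀ a ∈ X, ∀ b ∈ X, ¬ G.Adj a b) (z : V → Fin 2) :
    graphSign G z = (∏ e ∈ G.edgeFinset.filter (fun e => ∀ a ∈ e, a ∉ X), edgeSign z e)
      * ∏ a ∈ X, ∏ b ∈ Finset.univ.filter (G.Adj a), sgn (z a * z b) := by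
  rw [graphSign, ← Finset.prod_filter_mul_prod_filter_not _ (fun e => ∀ a ∈ e, a ∉ X)]
  congr 1
  -- An edge meeting `X` has exactly one endpoint there, by independence, so these edges correspond
  -- to pairs of an endpoint in `X` and a neighbour.
  rw [Finset.prod_sigma']
  symm
  refine Finset.prod_nbij (fun p => s(p.1, p.2)) ?_ ?_ ?_ ?_
  · rintro ⟨a, b⟩ h
    simp only [Finset.mem_sigma, Finset.mem_filter, Finset.mem_univ, true_and] at h
    simp [h.2, h.1]
  · rintro ⟨a, b⟩ h ⟨a', b'⟩ h' he
    simp only [Finset.mem_coe, Finset.mem_sigma, Finset.mem_filter, Finset.mem_univ,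
      true_and] at h h'
    rw [Sym2.eq_iff] at he
    rcases he with ⟨h1, h2⟩ | ⟨h1, h2⟩
    · simp only at h1 h2
      subst h1; subst h2; rfl
    · simp only at h1 h2
      subst h1; subst h2
      exact absurd h.2 (hX _ h.1 _ h'.1)
  · intro e he
    induction e with
    | _ a b =>
    simp only [Finset.mem_coe, Finset.mem_filter, SimpleGraph.mem_edgeFinset,
      SimpleGraph.mem_edgeSet, Sym2.mem_iff, not_forall, not_not] at he
    obtain ⟨hab, c, hc, hcX⟩ := he
    rcases hc with rfl | rfl
    · exact ⟨⟨c, b⟩, by simp [hcX, hab], rfl⟩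
    · exact ⟨⟨c, a⟩, by simp [hcX, hab.symm], Sym2.eq_swap⟩
  · rintro ⟨a, b⟩ _
    exact (edgeSign_mk z a b).symm

theorem plusAmp_eq : plusAmp = (((Real.sqrt 2)⁻¹ : ℝ) : ℂ) := by simp [plusAmp]

/-! ## Path sums -/

section PathSum

variable {V W : Type*} (O : Finset V) (wire : V → W) (out : W → V)

/-- The current vertex of each wire when the vertices of the list remain to be processed. -/
noncomputable def front : List V → W → V
  | [] => out
  | a :: S => if a ∈ O then front S else Function.update (front S) (wire a) a

/-- At every step the wire of the processed vertex `a` proceeds to `h a`. -/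
def FollowsPaths (h : V → V) : List V → Prop
  | [] => True
  | a :: S => front O wire out S (wire a) = (if a ∈ O then a else h a) ∧ a ∉ S ∧
      FollowsPaths h S

/-- The product of the step amplitudes `κ` along a list of vertices. -/
noncomputable def pathWeight (κ : V → (W → Fin 2) → Fin 2 → ℂ) : List V → (V → Fin 2) → ℂ
  | [], _ => 1
  | a :: S, z => κ a (z ∘ front O wire out S) (z a) * pathWeight κ S z

/-- Assignments with prescribed values at `O` that vanish outside `O` and `X`. -/
noncomputable def assignments [Fintype V] (X : V → Prop) (x : W → Fin 2) :
    Finset (V → Fin 2) :=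
  Finset.univ.filter fun z => (∀ o ∈ O, z o = x (wire o)) ∧ ∀ a, a ∉ O → ¬ X a → z a = 0

theorem mem_assignments [Fintype V] {X : V → Prop} {x : W → Fin 2} {z : V → Fin 2} :
    z ∈ assignments O wire X x
      ↔ (∀ o ∈ O, z o = x (wire o)) ∧ ∀ a, a ∉ O → ¬ X a → z a = 0 := by
  simp [assignments]

theorem front_mem (hO : ∀ w, out w ∈ O) (S : List V) (w : W) :
    front O wire out S w ∈ O ∨ front O wire out S w ∈ S := by
  induction S with
  | nil => exact Or.inl (hO w)
  | cons a S ih =>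
    rw [front]
    split_ifs with ha
    · exact ih.imp id (List.mem_cons_of_mem _)
    · by_cases hw : w = wire a
      · subst hw; simp
      · rw [Function.update_of_ne hw]
        exact ih.imp id (List.mem_cons_of_mem _)

theorem comp_front_congr (hO : ∀ w, out w ∈ O) (S : List V) {z z' : V → Fin 2}
    (hz : ∀ a, a ∈ O ∨ a ∈ S → z a = z' a) :
    z ∘ front O wire out S = z' ∘ front O wire out S :=
  funext fun w => hz _ (front_mem O wire out hO S w)

theorem pathWeight_congr (hO : ∀ w, out w ∈ O) (κ : V → (W → Fin 2) → Fin 2 → ℂ) (S : List V)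
    {z z' : V → Fin 2} (hz : ∀ a, a ∈ O ∨ a ∈ S → z a = z' a) :
    pathWeight O wire out κ S z = pathWeight O wire out κ S z' := by
  induction S with
  | nil => rfl
  | cons a S ih =>
    have hz' : ∀ b, b ∈ O ∨ b ∈ S → z b = z' b := fun b hb =>
      hz b (hb.imp id (List.mem_cons_of_mem _))
    rw [pathWeight, pathWeight, ih hz', comp_front_congr O wire out hO S hz',
      hz a (Or.inr List.mem_cons_self)]

/-- Sum over histories. The function `front S` names the vertex whose bit a wire carries just before
`S` is processed. Processing a non-output `a` introduces the bit `z a` as a new summation variable,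
while the step amplitude sees the bit after the step as a value of `z ∘ front S`. Bits outside `O`
and `S` are pinned to `0` so that each history is counted once. -/
theorem foldl_eq_pathSum [Fintype V] (hO : ∀ w, out w ∈ O) (hw : ∀ w, wire (out w) = w) (h : V → V)
    (A : V → State W → State W) (κ : V → (W → Fin 2) → Fin 2 → ℂ) (S : List V)
    (hS : FollowsPaths O wire out h S)
    (hA : ∀ a ∈ S, a ∈ O → ∀ ψ y, A a ψ y = κ a y (y (wire a)) * ψ y)
    (hA' : ∀ a ∈ S, a ∉ O → ∀ ψ y,
      A a ψ y = ∑ b, κ a y b * ψ (Function.update y (wire a) b))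
    (ψ : State W) (x : W → Fin 2) :
    S.foldl (fun ψ a => A a ψ) ψ x = ∑ z ∈ assignments O wire (· ∈ S) x,
      pathWeight O wire out κ S z * ψ (z ∘ front O wire out S) := by
  induction S generalizing ψ with
  | nil =>
    have h1 : assignments O wire (· ∈ ([] : List V)) x
        = {fun a => if a ∈ O then x (wire a) else 0} := by
      ext z
      simp only [assignments, Finset.mem_filter, Finset.mem_univ, true_and, List.not_mem_nil,
        not_false_eq_true, forall_true_left, Finset.mem_singleton]
      constructor
      · rintro ⟨h1, h2⟩
        funext a
        split_ifs with ha
        · exact h1 a ha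
        · exact h2 a ha
      · rintro rfl
        exact ⟨fun o ho => by simp [ho], fun a ha => by simp [ha]⟩
    rw [h1, Finset.sum_singleton]
    simp only [List.foldl_nil, pathWeight, one_mul, front]
    congr 1
    funext w
    simp [hO w, hw w]
  | cons a S ih =>
    obtain ⟨hS1, hS2, hS3⟩ := hS
    rw [List.foldl_cons, ih hS3 (fun b hb => hA b (List.mem_cons_of_mem _ hb))
      (fun b hb => hA' b (List.mem_cons_of_mem _ hb))]
    by_cases ha : a ∈ O
    · have h1 : assignments O wire (· ∈ a :: S) x = assignments O wire (· ∈ S) x := by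
        ext z
        simp only [assignments, Finset.mem_filter, Finset.mem_univ, true_and, List.mem_cons,
          not_or]
        refine and_congr_right fun _ => forall_congr' fun b => ?_
        constructor
        · intro H hb hbS
          exact H hb ⟨fun hba => hb (hba ▸ ha), hbS⟩
        · intro H hb hbS
          exact H hb hbS.2
      rw [h1]
      refine Finset.sum_congr rfl fun z _ => ?_
      rw [if_pos ha] at hS1
      rw [hA a List.mem_cons_self ha, pathWeight, front, if_pos ha, Function.comp_apply, hS1]
      ring
    · simp only [hA' a List.mem_cons_self ha, Finset.mul_sum]
      rw [Finset.sum_sigma']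
      -- The bit `b` of the new step is stored at `a`, where `z` was `0` because `a` lies neither in
      -- `O` nor in `S`.
      refine Finset.sum_nbij' (fun p => Function.update p.1 a p.2)
        (fun z => ⟨Function.update z a 0, z a⟩) ?_ ?_ ?_ ?_ ?_
      · rintro ⟨z, b⟩ hz
        simp only [assignments, Finset.mem_sigma, Finset.mem_filter, Finset.mem_univ, true_and,
          and_true, List.mem_cons, not_or] at hz ⊢
        refine ⟨fun o ho => ?_, fun c hc hcS => ?_⟩
        · rw [Function.update_of_ne (by rintro rfl; exact ha ho)]
          exact hz.1 o ho
        · rw [Function.update_of_ne hcS.1]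
          exact hz.2 c hc hcS.2
      · intro z hz
        simp only [assignments, Finset.mem_sigma, Finset.mem_filter, Finset.mem_univ, true_and,
          and_true, List.mem_cons, not_or] at hz ⊢
        refine ⟨fun o ho => ?_, fun c hc hcS => ?_⟩
        · rw [Function.update_of_ne (by rintro rfl; exact ha ho)]
          exact hz.1 o ho
        · by_cases hca : c = a
          · subst hca; simp
          · rw [Function.update_of_ne hca]
            exact hz.2 c hc ⟨hca, hcS⟩
      · rintro ⟨z, b⟩ hz
        simp only [assignments, Finset.mem_sigma, Finset.mem_filter, Finset.mem_univ, true_and,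
          and_true] at hz
        have : z a = 0 := hz.2 a ha hS2
        simp [← this]
      · intro z _
        simp
      · rintro ⟨z, b⟩ _
        have hz : ∀ c, c ∈ O ∨ c ∈ S → z c = Function.update z a b c := by
          intro c hc
          rw [Function.update_of_ne]
          rintro rfl
          exact hc.elim ha hS2
        simp only
        rw [pathWeight, ← comp_front_congr O wire out hO S hz,
          ← pathWeight_congr O wire out hO κ S hz, front, if_neg ha, Function.update_self]
        have h2 : Function.update (z ∘ front O wire out S) (wire a) b
            = Function.update z a b ∘ Function.update (front O wire out S) (wire a) a := by
          funext w
          by_cases hwa : w = wire a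
          · subst hwa; simp
          · rw [Function.update_of_ne hwa]
            simp only [Function.comp_apply]
            rw [Function.update_of_ne hwa, ← hz _ (front_mem O wire out hO S w)]
        rw [h2]
        ring

/-- A pending vertex is at the front of its wire as soon as no predecessor of it is pending. This
applies to `h a` once `a` has been processed, since injectivity of `h` excludes a second
predecessor, and so processing `a` moves its wire to `h a`. -/
theorem front_wire {h : V → V} (hout : ∀ o ∈ O, out (wire o) = o) (X : Finset V)
    (hX : ∀ a ∈ X, a ∉ O → h a ∈ X) (hne : ∀ a ∈ X, a ∉ O → h a ≠ a)
    (hwire : ∀ a ∈ X, a ∉ O → wire (h a) = wire a)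
    (hinj : ∀ a ∈ X, a ∉ O → ∀ b ∈ X, b ∉ O → h a = h b → a = b)
    (S : List V) (hSX : ∀ a ∈ S, a ∈ X) (hnd : S.Nodup)
    (hord : S.Pairwise fun a b => ¬ (b ∉ O ∧ h b = a))
    (hsucc : ∀ a ∈ S, a ∉ O → h a ∈ O ∨ h a ∈ S) :
    FollowsPaths O wire out h S ∧ ∀ v ∈ X, v ∈ O ∨ v ∈ S → (∀ b ∈ S, b ∉ O → h b ≠ v) →
      front O wire out S (wire v) = v := by
  induction S with
  | nil =>
    refine ⟨trivial, fun v _ hv _ => ?_⟩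
    simp only [List.not_mem_nil, or_false] at hv
    exact hout v hv
  | cons a S ih =>
    rw [List.nodup_cons] at hnd
    rw [List.pairwise_cons] at hord
    have hs' : ∀ b ∈ S, b ∉ O → h b ∈ O ∨ h b ∈ S := by
      intro b hb hbO
      rcases hsucc b (List.mem_cons_of_mem _ hb) hbO with h1 | h1
      · exact Or.inl h1
      · rcases List.mem_cons.1 h1 with h2 | h2
        · exact absurd ⟨hbO, h2⟩ (hord.1 b hb)
        · exact Or.inr h2
    obtain ⟨ih1, ih2⟩ := ih (fun b hb => hSX b (List.mem_cons_of_mem _ hb)) hnd.2 hord.2 hs'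
    have haX := hSX a List.mem_cons_self
    have hstep : front O wire out S (wire a) = if a ∈ O then a else h a := by
      split_ifs with ha
      · exact ih2 a haX (Or.inl ha) fun b hb hbO hba => hord.1 b hb ⟨hbO, hba⟩
      · rw [← hwire a haX ha]
        refine ih2 _ (hX a haX ha) ?_ ?_
        · rcases hsucc a List.mem_cons_self ha with h1 | h1
          · exact Or.inl h1
          · rcases List.mem_cons.1 h1 with h2 | h2
            · exact absurd h2 (hne a haX ha)
            · exact Or.inr h2
        · intro b hb hbO hba
          have := hinj b (hSX b (List.mem_cons_of_mem _ hb)) hbO a haX ha hba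
          exact hnd.1 (this ▸ hb)
    refine ⟨⟨hstep, hnd.1, ih1⟩, fun v hvX hv hpred => ?_⟩
    have hpred' : ∀ b ∈ S, b ∉ O → h b ≠ v := fun b hb => hpred b (List.mem_cons_of_mem _ hb)
    rw [front]
    split_ifs with ha
    · refine ih2 v hvX ?_ hpred'
      rcases hv with hv | hv
      · exact Or.inl hv
      · rcases List.mem_cons.1 hv with rfl | hv
        · exact Or.inl ha
        · exact Or.inr hv
    · by_cases hva : v = a
      · subst hva; simp
      · have hv' : v ∈ O ∨ v ∈ S := hv.imp id fun h => (List.mem_cons.1 h).resolve_left hva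
        have h1 := ih2 v hvX hv' hpred'
        rw [Function.update_of_ne, h1]
        -- If `v` shared the wire of `a`, the front of that wire would be both `v` and `h a`, so `a`
        -- would be a pending predecessor of `v`.
        intro hwv
        rw [hwv, hstep, if_neg ha] at h1
        exact hpred a List.mem_cons_self ha h1

end PathSum

/-! ## Elimination of the ancillas -/

/-- The acausal gate identity: with the four amplitudes `1/√2` of preparation and post-selection,
the gate is one half of an ordinary `CZ` between the two positions. -/
theorem sum_sgn_pair (c c' : Fin 2) :
    ∑ f : Fin 2 → Fin 2, sgn (f 0 * f 1) * (sgn (c * f 0) * sgn (c' * f 1)) = 2 * sgn (c * c') := by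
  rw [← (finTwoArrowEquiv (Fin 2)).symm.sum_comp, Fintype.sum_prod_type]
  fin_cases c <;> fin_cases c' <;> simp [sgn, Fin.sum_univ_two] <;> norm_num

/-- Summation over pairs of ancillas `d, σ d`, one pair for each `d` with `P d`. -/
theorem sum_ancillas {D : Type*} [Fintype D] (σ : D → D) (hσ : ∀ d, σ (σ d) = d) (P : D → Prop)
    (hP : ∀ d, P (σ d) ↔ ¬ P d) (c : D → Fin 2) :
    ∑ y : D → Fin 2, (∏ d ∈ Finset.univ.filter P, sgn (y d * y (σ d))) * ∏ d, sgn (c d * y d)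
      = 2 ^ (Finset.univ.filter P).card
        * ∏ d ∈ Finset.univ.filter P, sgn (c d * c (σ d)) := by
  -- The predicate `P` selects one element of each orbit of `σ`, so `D` splits into pairs.
  let e : {d // P d} × Fin 2 ≃ D :=
    { toFun := fun p => if p.2 = 0 then p.1.1 else σ p.1.1
      invFun := fun d => if h : P d then (⟨d, h⟩, 0) else (⟨σ d, (hP d).2 h⟩, 1)
      left_inv := by
        rintro ⟨⟨d, hd⟩, b⟩
        have h1 : ¬ P (σ d) := fun h => (hP d).1 h hd
        fin_cases b
        · simp [hd]
        · simp [h1, hσ]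
      right_inv := by
        intro d
        by_cases h : P d <;> simp [h, hσ] }
  have e0 : ∀ p, e (p, 0) = p.1 := fun p => rfl
  have e1 : ∀ p, e (p, 1) = σ p.1 := fun p => rfl
  have hsub : ∀ f : D → ℂ, ∏ d ∈ Finset.univ.filter P, f d = ∏ p : {d // P d}, f p.1 := by
    intro f
    rw [Finset.prod_subtype (Finset.univ.filter P) (p := P) (by simp)]
  have hcard : (Finset.univ.filter P).card = Fintype.card {d // P d} := by
    rw [Fintype.card_subtype]
  simp only [hsub, hcard]
  let E : ({d // P d} → Fin 2 → Fin 2) ≃ (D → Fin 2) :=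
    (Equiv.curry _ _ _).symm.trans (e.arrowCongr (Equiv.refl _))
  have hE : ∀ F p b, E F (e (p, b)) = F p b := by
    intro F p b
    simp [E, Equiv.arrowCongr, Equiv.curry]
  rw [← E.sum_comp]
  have hterm : ∀ F : {d // P d} → Fin 2 → Fin 2,
      (∏ p : {d // P d}, sgn (E F p.1 * E F (σ p.1))) * ∏ d, sgn (c d * E F d)
        = ∏ p : {d // P d}, sgn (F p 0 * F p 1)
            * (sgn (c p.1 * F p 0) * sgn (c (σ p.1) * F p 1)) := by
    intro F
    rw [← e.prod_comp, Fintype.prod_prod_type, ← Finset.prod_mul_distrib]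
    refine Finset.prod_congr rfl fun p _ => ?_
    rw [Fin.prod_univ_two, hE, hE, e0, e1]
    have h0 := hE F p 0
    have h1 := hE F p 1
    rw [e0] at h0
    rw [e1] at h1
    rw [h0, h1]
  simp only [hterm]
  -- The pairs are independent: the sum of products factors into a product of sums over one pair.
  rw [← Fintype.piFinset_univ, ← Finset.prod_univ_sum (fun _ => Finset.univ)
    (fun (p : {d // P d}) (f : Fin 2 → Fin 2) => sgn (f 0 * f 1) * (sgn (c p.1 * f 0) * sgn (c (σ p.1) * f 1)))]
  simp only [sum_sgn_pair, Finset.prod_mul_distrib, Finset.prod_const, Finset.card_univ]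

theorem prod_dart_eq_graphSign {V : Type*} [Fintype V] (N : SimpleGraph V) (P : N.Dart → Prop)
    (hP : ∀ d, P d.symm ↔ ¬ P d) (z : V → Fin 2) :
    ∏ d ∈ Finset.univ.filter P, sgn (z d.fst * z d.snd) = graphSign N z := by
  refine Finset.prod_nbij (fun d => d.edge) ?_ ?_ ?_ ?_
  · intro d _
    rw [SimpleGraph.mem_edgeFinset]
    exact d.edge_mem
  · intro d hd d' hd' he
    simp only [Finset.mem_coe, Finset.mem_filter, Finset.mem_univ, true_and] at hd hd'
    rcases (SimpleGraph.dart_edge_eq_iff d d').1 he with h | h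
    · exact h
    · rw [h] at hd
      exact absurd hd' ((hP d').1 hd)
  · intro e he
    rw [Finset.mem_coe, SimpleGraph.mem_edgeFinset] at he
    induction e with
    | _ a b =>
    let d : N.Dart := ⟨(a, b), he⟩
    by_cases hd : P d
    · exact ⟨d, by simp [hd], rfl⟩
    · exact ⟨d.symm, by simp [hP, hd], d.edge_symm⟩
  · intro d _
    exact (edgeSign_mk z d.fst d.snd).symm

/-- A dart and its reverse give the same unordered pair of ancillas, so the image counts each
acausal gate once, just as an orientation `P` does. -/
theorem prod_ancilla_edges {V W : Type*} [Fintype V] (N : SimpleGraph V) (P : N.Dart → Prop)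
    (hP : ∀ d, P d.symm ↔ ¬ P d) (x : W → Fin 2) (y : N.Dart → Fin 2) :
    ∏ e ∈ Finset.univ.image (fun d : N.Dart => s((Sum.inr d : W ⊕ N.Dart), Sum.inr d.symm)),
        edgeSign (Sum.elim x y) e
      = ∏ d ∈ Finset.univ.filter P, sgn (y d * y d.symm) := by
  symm
  refine Finset.prod_nbij (fun d => s(Sum.inr d, Sum.inr d.symm)) ?_ ?_ ?_ ?_
  · intro d _
    exact Finset.mem_image_of_mem _ (Finset.mem_univ d)
  · intro d hd d' hd' he
    simp only [Finset.mem_coe, Finset.mem_filter, Finset.mem_univ, true_and] at hd hd'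
    rw [Sym2.eq_iff] at he
    rcases he with ⟨h, -⟩ | ⟨h, -⟩
    · exact Sum.inr_injective h
    · rw [Sum.inr_injective h] at hd
      exact absurd hd' ((hP d').1 hd)
  · intro e he
    obtain ⟨d, -, rfl⟩ := Finset.mem_image.1 (Finset.mem_coe.1 he)
    by_cases hd : P d
    · exact ⟨d, by simp [hd], rfl⟩
    · refine ⟨d.symm, by simp [hP, hd], ?_⟩
      simp only [SimpleGraph.Dart.symm_symm]
      exact Sym2.eq_swap
  · intro d _
    rw [edgeSign_mk]; rfl

/-- Every acausal gate acts as an ordinary `CZ`, up to the positive factor of its ancillas. -/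
theorem sum_dart_ancillas {V : Type*} [Fintype V] (N : SimpleGraph V) :
    ∃ k : ℕ, ∀ (W : Type u) (x : W → Fin 2) (z : V → Fin 2), ∑ y : N.Dart → Fin 2,
      (∏ e ∈ Finset.univ.image (fun d : N.Dart => s((Sum.inr d : W ⊕ N.Dart), Sum.inr d.symm)),
        edgeSign (Sum.elim x y) e) * ∏ d : N.Dart, sgn (z d.fst * y d) = 2 ^ k * graphSign N z := by
  -- An arbitrary enumeration of the vertices orients every edge. The exponent is the number of
  -- edges, the same for all wires and assignments.
  let P : N.Dart → Prop := fun d => Fintype.equivFin V d.fst < Fintype.equivFin V d.snd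
  have hP : ∀ d, P d.symm ↔ ¬ P d := by
    intro d
    have hne : Fintype.equivFin V d.fst ≠ Fintype.equivFin V d.snd := fun h =>
      d.adj.ne ((Fintype.equivFin V).injective h)
    simp only [P, SimpleGraph.Dart.symm_toProd, Prod.fst_swap, Prod.snd_swap]
    constructor
    · exact fun h => not_lt.2 h.le
    · exact fun h => lt_of_le_of_ne (not_lt.1 h) hne.symm
  refine ⟨(Finset.univ.filter P).card, fun W x z => ?_⟩
  simp only [prod_ancilla_edges N P hP]
  rw [← prod_dart_eq_graphSign N P hP]
  convert sum_ancillas SimpleGraph.Dart.symm SimpleGraph.Dart.symm_symm P hP (fun d => z d.fst)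
  rfl

/-- The number of wires that are prepared in `|+⟩`. -/
noncomputable def freshWires {V W : Type*} [Fintype W] (I : Finset V) (wire : V → W) : ℕ :=
  (Finset.univ.filter fun w : W => ∀ i ∈ I, wire i ≠ w).card

theorem prepareInput_apply {V W : Type*} [Fintype W] (I : Finset V) (wire : V → W) (ψ : State I)
    (x : W → Fin 2) :
    prepareInput I wire ψ x = plusAmp ^ freshWires I wire * ψ fun i => x (wire i) := rfl

theorem sum_univ_congr_instance {A : Type*} (i j : Fintype A) (f : A → ℂ) :
    ∑ a ∈ @Finset.univ A i, f a = ∑ a ∈ @Finset.univ A j, f a := by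
  rw [Subsingleton.elim i j]

/-! ### Path covers and the operator of the acausal circuit -/

namespace OpenGraph

set_option linter.unusedSectionVars false

variable {V : Type u} [Fintype V]

theorem IsPathCover.succ_mem {Γ : OpenGraph V} {h : V → V} (hp : Γ.IsPathCover h) {a : V}
    (ha : a ∈ Γ.verts) (ha' : a ∉ Γ.outputs) : h a ∈ Γ.verts :=
  Γ.adj_mem _ _ (hp.adj a ha ha').symm

/-- Iterating `h` must reach an output. Consequently distinct non-outputs give distinct unordered
path edges. -/
theorem IsPathCover.no_two_cycle {Γ : OpenGraph V} {h : V → V} (hp : Γ.IsPathCover h) {a b : V}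
    (ha : a ∈ Γ.verts) (ha' : a ∉ Γ.outputs) (hb' : b ∉ Γ.outputs) (hab : h a = b)
    (hba : h b = a) : False := by
  obtain ⟨k, hk⟩ := hp.reaches a ha
  have : ∀ k : ℕ, h^[k] a = a ∨ h^[k] a = b := by
    intro k
    induction k with
    | zero => exact Or.inl rfl
    | succ k ih =>
      rw [Function.iterate_succ_apply']
      rcases ih with ih | ih <;> rw [ih]
      · exact Or.inr hab
      · exact Or.inl hba
  rcases this k with h1 | h1 <;> rw [h1] at hk
  · exact ha' hk
  · exact hb' hk

/-- The non-path edges are realised by acausal gates; the remaining factors are the signs occurring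
in the entries of the `J` matrices. -/
theorem graphSign_nonPath {Γ : OpenGraph V} {h : V → V} (hp : Γ.IsPathCover h)
    (z : V → Fin 2) :
    graphSign Γ.graph z = graphSign (Γ.nonPath h) z
      * ∏ a ∈ Γ.verts \ Γ.outputs, sgn (z (h a) * z a) := by
  rw [graphSign, ← Finset.prod_filter_mul_prod_filter_not _ (fun e => e ∈ (Γ.nonPath h).edgeSet)]
  congr 1
  · refine Finset.prod_congr ?_ fun _ _ => rfl
    ext e
    simp only [Finset.mem_filter, SimpleGraph.mem_edgeFinset, and_iff_right_iff_imp]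
    induction e with
    | _ a b => exact fun he => he.1
  · symm
    refine Finset.prod_nbij (fun a => s(a, h a)) ?_ ?_ ?_ ?_
    · intro a ha
      rw [Finset.mem_sdiff] at ha
      simp only [Finset.mem_filter, SimpleGraph.mem_edgeFinset, SimpleGraph.mem_edgeSet]
      exact ⟨hp.adj a ha.1 ha.2, fun hn => hn.2.1 ⟨ha.2, rfl⟩⟩
    · intro a ha b hb he
      simp only [Finset.mem_coe, Finset.mem_sdiff] at ha hb
      rw [Sym2.eq_iff] at he
      rcases he with ⟨h1, -⟩ | ⟨h1, h2⟩
      · exact h1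
      · exact (hp.no_two_cycle ha.1 ha.2 hb.2 h2 h1.symm).elim
    · intro e he
      induction e with
      | _ a b =>
      simp only [Finset.mem_coe, Finset.mem_filter, SimpleGraph.mem_edgeFinset,
        SimpleGraph.mem_edgeSet] at he
      obtain ⟨hab, hn⟩ := he
      by_cases h1 : a ∉ Γ.outputs ∧ h a = b
      · exact ⟨a, by simp [h1.1, Γ.adj_mem _ _ hab], by simp [h1.2]⟩
      by_cases h2 : b ∉ Γ.outputs ∧ h b = a
      · exact ⟨b, by simp [h2.1, Γ.adj_mem _ _ hab.symm], by simp [h2.2, Sym2.eq_swap]⟩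
      exact absurd ⟨hab, h1, h2⟩ hn
    · intro a _
      rw [edgeSign_mk, mul_comm]

/-- `wire` assigns to each vertex its wire in the path cover given by `h`, and `out` is the output
vertex of a wire. -/
structure IsWiring {W : Type u} (Γ : OpenGraph V) (h : V → V) (wire : V → W) (out : W → V) :
    Prop where
  out_mem : ∀ w, out w ∈ Γ.outputs
  wire_out : ∀ w, wire (out w) = w
  out_wire : ∀ o ∈ Γ.outputs, out (wire o) = o
  wire_succ : ∀ a ∈ Γ.verts, a ∉ Γ.outputs → wire (h a) = wire a

/-- The amplitude of an assignment of basis values to all vertices. -/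
noncomputable def amplitude (Γ : OpenGraph V) (I : Finset V) (α : V → ℝ) (ψ : State I)
    (z : V → Fin 2) : ℂ :=
  ψ (fun i => z i) * graphSign Γ.graph z * ∏ a ∈ Γ.verts \ Γ.outputs, phase (α a) (z a)

/-- The post-selected open graph state, as a sum over assignments. -/
noncomputable def pathSum {W : Type u} (Γ : OpenGraph V) (I : Finset V) (wire : V → W)
    (α : V → ℝ) (ψ : State I) : State W :=
  fun x => ∑ z ∈ assignments Γ.outputs wire (· ∈ Γ.verts) x, Γ.amplitude I α ψ z

/-- An input has no predecessor on its path, so at the start of the schedule its wire carries the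
bit of the input itself. -/
theorem front_of_schedule {W : Type u} {Γ : OpenGraph V} {h : V → V} (hp : Γ.IsPathCover h)
    {wire : V → W} {out : W → V} (hw : Γ.IsWiring h wire out) {L : List V}
    (hL : Γ.IsSchedule h L) :
    FollowsPaths Γ.outputs wire out h L ∧
      ∀ i ∈ Γ.inputs, front Γ.outputs wire out L (wire i) = i := by
  obtain ⟨h1, h2⟩ := front_wire Γ.outputs wire out hw.out_wire Γ.verts
    (fun a ha ha' => hp.succ_mem ha ha') (fun a ha ha' => (hp.adj a ha ha').ne')
    hw.wire_succ hp.inj L (fun a ha => (hL.mem_iff a).1 ha) hL.nodup hL.order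
    (fun a ha ha' => Or.inr ((hL.mem_iff _).2 (hp.succ_mem ((hL.mem_iff a).1 ha) ha')))
  refine ⟨h1, fun i hi => h2 i (Γ.inputs_subset hi)
    (Or.inr ((hL.mem_iff _).2 (Γ.inputs_subset hi))) fun b hb hb' hbi => ?_⟩
  exact hp.not_input b ((hL.mem_iff b).1 hb) hb' (hbi ▸ hi)

theorem pathWeight_eq_prod {W : Type u} (O : Finset V) (wire : V → W) (out : W → V) (h : V → V)
    (κ : V → (W → Fin 2) → Fin 2 → ℂ) (f : V → (V → Fin 2) → ℂ) (z : V → Fin 2) (L : List V)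
    (hf : ∀ a y, y (wire a) = z (if a ∈ O then a else h a) → κ a y (z a) = f a z)
    (hL : FollowsPaths O wire out h L) :
    pathWeight O wire out κ L z = (L.map fun a => f a z).prod := by
  induction L with
  | nil => rfl
  | cons a S ih =>
    rw [pathWeight, List.map_cons, List.prod_cons, ih hL.2.2, hf]
    rw [Function.comp_apply, hL.1]

/-- The gates of the expanded acausal circuit for one vertex. -/
noncomputable def vertexGates {W : Type u} (O : Finset V) (N : SimpleGraph V) (wire : V → W)
    (α : V → ℝ) (a : V) : List (Gate (W ⊕ N.Dart)) :=
  ((Finset.univ.filter fun d : N.Dart => d.fst = a).toList.map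
      fun d => Gate.CZ (Sum.inl (wire a)) (Sum.inr d))
    ++ if a ∈ O then [] else [Gate.J (α a) (Sum.inl (wire a))]

theorem spt_expand {W : Type u} (Γ : OpenGraph V) (h : V → V) (wire : V → W) (α : V → ℝ)
    (L : List V) :
    (Γ.spt h wire α L).expand = czEdges (Finset.univ.image fun d : (Γ.nonPath h).Dart =>
      s((Sum.inr d : W ⊕ (Γ.nonPath h).Dart), Sum.inr d.symm))
    ++ L.flatMap (vertexGates Γ.outputs (Γ.nonPath h) wire α) := by
  rw [AcausalCircuit.expand]
  congr 1
  simp only [spt]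
  rw [List.flatMap_assoc]
  congr 1
  funext a
  rw [List.flatMap_cons, vertexGates]
  congr 1
  split_ifs <;> simp [Gate.map]

/-- The step of `vertexGates` for a fixed assignment of the ancillas. -/
noncomputable def vertexStep {W : Type u} (O : Finset V) {N : SimpleGraph V} (wire : V → W)
    (α : V → ℝ) (y : N.Dart → Fin 2) (a : V) (ψ : State W) : State W := fun x =>
  if a ∈ O then (∏ d ∈ Finset.univ.filter (fun d : N.Dart => d.fst = a), sgn (x (wire a) * y d))
      * ψ x
  else ∑ b : Fin 2, plusAmp * sgn (x (wire a) * b) * phase (α a) b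
      * ((∏ d ∈ Finset.univ.filter (fun d : N.Dart => d.fst = a), sgn (b * y d))
        * ψ (Function.update x (wire a) b))

/-- The gates act diagonally on the ancillas, so the ancilla bits `y` are a fixed parameter of an
evolution of the wires alone. -/
theorem run_vertexGates {W : Type u} (O : Finset V) (N : SimpleGraph V) (wire : V → W)
    (α : V → ℝ) (L : List V) (y : N.Dart → Fin 2) (Ψ : State (W ⊕ N.Dart)) (x : W → Fin 2) :
    run (L.flatMap (vertexGates O N wire α)) Ψ (Sum.elim x y)
      = L.foldl (fun ψ a => vertexStep O wire α y a ψ) (fun x => Ψ (Sum.elim x y)) x := by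
  induction L generalizing Ψ with
  | nil => rfl
  | cons a L ih =>
    rw [List.flatMap_cons, run_append, ih, List.foldl_cons]
    refine congrArg (fun φ => L.foldl (fun ψ a => vertexStep O wire α y a ψ) φ x) ?_
    funext x
    rw [vertexGates, run_append, vertexStep]
    split_ifs with ha
    · rw [run_nil]
      refine (run_map_CZ _ (fun _ => Sum.inl (wire a)) (fun d => Sum.inr d) Ψ _).trans ?_
      simp only [Sum.elim_inl, Sum.elim_inr, Finset.prod_map_toList]
    · rw [run_cons, run_nil, J_op_apply]
      refine Finset.sum_congr rfl fun b _ => ?_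
      rw [Sum.elim_inl]
      congr 1
      refine (run_map_CZ _ (fun _ => Sum.inl (wire a)) (fun d => Sum.inr d) Ψ _).trans ?_
      have hupd : ∀ inst : DecidableEq (W ⊕ N.Dart),
          @Function.update _ _ inst (Sum.elim x y) (Sum.inl (wire a)) b
            = Sum.elim (Function.update x (wire a) b) y := by
        intro inst
        funext q
        rcases q with q | q <;> simp [Function.update_apply]
      rw [hupd]
      simp only [Finset.prod_map_toList, Sum.elim_inl, Sum.elim_inr, Function.update_self]

/-- The operator of the star pattern transformation is the post-selected graph state. -/
theorem spt_eq_pathSum {V : Type u} [Fintype V] {W : Type u} [Fintype W] {Γ : OpenGraph V}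
    {h : V → V} (hp : Γ.IsPathCover h)
    {wire : V → W} {out : W → V} (hw : Γ.IsWiring h wire out) (I : Finset V)
    (hI : I ⊆ Γ.inputs) :
    ∃ c : ℝ, 0 < c ∧ ∀ (α : V → ℝ) (L : List V), Γ.IsSchedule h L → ∀ ψ : State I,
      (Γ.spt h wire α L).op (prepareInput I wire ψ) = (c : ℂ) • Γ.pathSum I wire α ψ := by
  obtain ⟨k, hk⟩ := sum_dart_ancillas.{u} (Γ.nonPath h)
  set D := Fintype.card (Γ.nonPath h).Dart
  set m := freshWires I wire
  -- One factor `1/√2` for each ancilla prepared, each ancilla post-selected, each fresh wire and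
  -- each `J` gate; `2 ^ k` comes from the ancilla sums.
  refine ⟨(Real.sqrt 2)⁻¹ ^ (D + D + m + (Γ.verts \ Γ.outputs).card) * 2 ^ k,
    by positivity, fun α L hL ψ => ?_⟩
  obtain ⟨hF, hin⟩ := front_of_schedule hp hw hL
  funext x
  have hverts : L.toFinset = Γ.verts := by
    ext a; simp [hL.mem_iff]
  have step : ∀ y : (Γ.nonPath h).Dart → Fin 2,
      run (Γ.spt h wire α L).expand (preparePlus W (Γ.nonPath h).Dart (prepareInput I wire ψ))
        (Sum.elim x y)
      = ∑ z ∈ assignments Γ.outputs wire (· ∈ Γ.verts) x,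
        (plusAmp ^ (D + m + (Γ.verts \ Γ.outputs).card) * ψ (fun i => z i)
          * (∏ a ∈ Γ.verts \ Γ.outputs, sgn (z (h a) * z a))
          * ∏ a ∈ Γ.verts \ Γ.outputs, phase (α a) (z a))
        * ((∏ e ∈ Finset.univ.image (fun d : (Γ.nonPath h).Dart =>
            s((Sum.inr d : W ⊕ (Γ.nonPath h).Dart), Sum.inr d.symm)),
            edgeSign (Sum.elim x y) e) * ∏ d : (Γ.nonPath h).Dart, sgn (z d.fst * y d)) := by
    intro y
    refine (congrArg (fun l => run l _ (Sum.elim x y)) (spt_expand Γ h wire α L)).trans ?_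
    rw [run_append, run_vertexGates, foldl_eq_pathSum Γ.outputs wire out hw.out_mem hw.wire_out h
      (vertexStep Γ.outputs wire α y) (fun a x b => (if a ∈ Γ.outputs then 1 else
        plusAmp * sgn (x (wire a) * b) * phase (α a) b) *
          ∏ d ∈ Finset.univ.filter (fun d : (Γ.nonPath h).Dart => d.fst = a), sgn (b * y d)) L hF]
    · simp only [hL.mem_iff]
      refine Finset.sum_congr rfl fun z _ => ?_
      rw [pathWeight_eq_prod Γ.outputs wire out h _ (fun a z => (if a ∈ Γ.outputs then 1 else
        plusAmp * sgn (z (h a) * z a) * phase (α a) (z a)) *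
          ∏ d ∈ Finset.univ.filter (fun d : (Γ.nonPath h).Dart => d.fst = a), sgn (z a * y d))
        z L _ hF, ← List.prod_toFinset _ hL.nodup, hverts, Finset.prod_mul_distrib]
      -- Every ancilla meets its wire exactly once, at the position of the initial vertex of its
      -- dart.
      · have hfib : ∏ a ∈ Γ.verts, ∏ d ∈ Finset.univ.filter
            (fun d : (Γ.nonPath h).Dart => d.fst = a), sgn (z a * y d)
            = ∏ d : (Γ.nonPath h).Dart, sgn (z d.fst * y d) := by
          rw [← Finset.prod_fiberwise_of_maps_to (t := Γ.verts)
            (g := fun d : (Γ.nonPath h).Dart => d.fst)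
            (fun d _ => Γ.adj_mem _ _ d.adj.1)]
          refine Finset.prod_congr rfl fun a _ => Finset.prod_congr rfl fun d hd => ?_
          rw [(Finset.mem_filter.1 hd).2]
        have hout : ∏ a ∈ Γ.verts, (if a ∈ Γ.outputs then 1 else
            plusAmp * sgn (z (h a) * z a) * phase (α a) (z a))
            = plusAmp ^ (Γ.verts \ Γ.outputs).card
              * (∏ a ∈ Γ.verts \ Γ.outputs, sgn (z (h a) * z a))
              * ∏ a ∈ Γ.verts \ Γ.outputs, phase (α a) (z a) := by
          rw [Finset.prod_ite, Finset.prod_const_one, one_mul, ← Finset.sdiff_eq_filter,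
            Finset.prod_mul_distrib, Finset.prod_mul_distrib, Finset.prod_const]
        rw [hfib, hout, run_czEdges]
        have hψ : preparePlus W (Γ.nonPath h).Dart (prepareInput I wire ψ)
            (Sum.elim (z ∘ front Γ.outputs wire out L) y)
            = plusAmp ^ D * (plusAmp ^ m * ψ (fun i => z i)) := by
          have hfr : (fun i : I => z (front Γ.outputs wire out L (wire i))) = fun i : I => z i := by
            funext i
            rw [hin i (hI i.2)]
          rw [← hfr]
          rfl
        rw [hψ, pow_add, pow_add]
        have hE : ∏ e ∈ Finset.univ.image (fun d : (Γ.nonPath h).Dart =>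
            s((Sum.inr d : W ⊕ (Γ.nonPath h).Dart), Sum.inr d.symm)),
            edgeSign (Sum.elim (z ∘ front Γ.outputs wire out L) y) e
            = ∏ e ∈ Finset.univ.image (fun d : (Γ.nonPath h).Dart =>
            s((Sum.inr d : W ⊕ (Γ.nonPath h).Dart), Sum.inr d.symm)),
            edgeSign (Sum.elim x y) e := by
          refine Finset.prod_congr rfl fun e he => ?_
          obtain ⟨d, -, rfl⟩ := Finset.mem_image.1 he
          rw [edgeSign_mk, edgeSign_mk]; rfl
        rw [hE]
        ring
      · intro a y' hy'
        by_cases ha : a ∈ Γ.outputs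
        · simp [ha]
        · rw [if_neg ha] at hy'
          simp [ha, hy']
    · intro a _ ha ψ y'
      simp [vertexStep, ha]
    · intro a _ ha ψ y'
      simp [vertexStep, ha, mul_assoc]
  have hop : (Γ.spt h wire α L).op (prepareInput I wire ψ) x
      = ∑ y : (Γ.nonPath h).Dart → Fin 2, plusAmp ^ D
    * run (Γ.spt h wire α L).expand (preparePlus W (Γ.nonPath h).Dart (prepareInput I wire ψ))
        (Sum.elim x y) := by
    refine Eq.trans (b := _) rfl ?_
    simp only [AcausalCircuit.op, LinearMap.comp_apply, postselectPlus, LinearMap.coe_mk,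
      AddHom.coe_mk]
    exact sum_univ_congr_instance _ _ _
  rw [hop]
  simp only [step]
  -- With the assignment `z` outside, the inner sum over ancilla bits is the one evaluated by `hk`.
  rw [← Finset.mul_sum, Finset.sum_comm]
  simp only [← Finset.mul_sum, hk]
  rw [Pi.smul_apply, pathSum, smul_eq_mul, Finset.mul_sum, Finset.mul_sum]
  refine Finset.sum_congr rfl fun z _ => ?_
  rw [amplitude, graphSign_nonPath hp, plusAmp_eq]
  push_cast
  ring

end OpenGraph

/-! ## Symmetric differences and odd neighbourhoods -/

section Parity

set_option linter.unusedSectionVars false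

variable {V : Type u} [Fintype V]

/-- The indicator function with values in `ZMod 2`. -/
noncomputable def ind (S : Finset V) (a : V) : ZMod 2 := if a ∈ S then 1 else 0

theorem ite_odd_eq_cast (n : ℕ) : (if Odd n then 1 else 0 : ZMod 2) = n := by
  split_ifs with h
  · exact (ZMod.natCast_eq_one_iff_odd.2 h).symm
  · exact ((ZMod.natCast_eq_zero_iff_even).2 (Nat.not_odd_iff_even.1 h)).symm

theorem ind_injective {S T : Finset V} (h : ∀ a, ind S a = ind T a) : S = T := by
  ext a
  have := h a
  unfold ind at this
  by_cases h1 : a ∈ S <;> by_cases h2 : a ∈ T <;> simp_all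

theorem ind_symmDiff (S T : Finset V) (a : V) : ind (symmDiff S T) a = ind S a + ind T a := by
  unfold ind
  simp only [Finset.mem_symmDiff]
  have : (1 : ZMod 2) + 1 = 0 := by decide
  by_cases h1 : a ∈ S <;> by_cases h2 : a ∈ T <;> simp [h1, h2, this]

theorem ind_bigSymmDiff {ι : Type*} (s : Finset ι) (f : ι → Finset V) (a : V) :
    ind (bigSymmDiff s f) a = ∑ k ∈ s, ind (f k) a := by
  unfold ind
  simp only [bigSymmDiff, Finset.mem_filter, Finset.mem_univ, true_and]
  rw [ite_odd_eq_cast, Finset.card_filter]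
  push_cast
  rfl

/-- Modulo two, the odd neighbourhood is multiplication by the adjacency matrix. Its additivity
follows from this formula. -/
theorem ind_odd (Γ : OpenGraph V) (S : Finset V) (a : V) :
    ind (Γ.odd S) a = ∑ b, (if Γ.graph.Adj a b then 1 else 0) * ind S b := by
  have h1 : ind (Γ.odd S) a
      = if Odd (S.filter fun w => Γ.graph.Adj a w).card then 1 else 0 := by
    unfold ind OpenGraph.odd
    simp only [Finset.mem_filter]
    by_cases ha : a ∈ Γ.verts
    · simp [ha]
    · have : S.filter (fun w => Γ.graph.Adj a w) = ∅ := by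
        ext w
        simp only [Finset.mem_filter, Finset.notMem_empty, iff_false, not_and]
        exact fun _ h => ha (Γ.adj_mem _ _ h)
      simp [ha, this]
  rw [h1, ite_odd_eq_cast, Finset.card_filter]
  push_cast
  refine (Finset.sum_subset_zero_on_sdiff (Finset.subset_univ S) (fun b hb => ?_)
    fun b hb => ?_)
  · rw [ind, if_neg (Finset.mem_sdiff.1 hb).2, mul_zero]
  · rw [ind, if_pos hb, mul_one]

theorem odd_symmDiff (Γ : OpenGraph V) (S T : Finset V) :
    Γ.odd (symmDiff S T) = symmDiff (Γ.odd S) (Γ.odd T) := by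
  refine ind_injective fun a => ?_
  simp only [ind_odd, ind_symmDiff, mul_add, Finset.sum_add_distrib]

theorem odd_bigSymmDiff {ι : Type*} (Γ : OpenGraph V) (s : Finset ι) (f : ι → Finset V) :
    Γ.odd (bigSymmDiff s f) = bigSymmDiff s fun k => Γ.odd (f k) := by
  refine ind_injective fun a => ?_
  simp only [ind_odd, ind_bigSymmDiff, Finset.mul_sum]
  rw [Finset.sum_comm]

theorem bigSymmDiff_symmDiff {ι : Type*} [Fintype ι] [DecidableEq ι] (s t : Finset ι) (f : ι → Finset V) :
    bigSymmDiff (symmDiff s t) f = symmDiff (bigSymmDiff s f) (bigSymmDiff t f) := by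
  refine ind_injective fun a => ?_
  have key : ∀ r : Finset ι, ∑ k ∈ r, ind (f k) a = ∑ k, (if k ∈ r then 1 else 0) * ind (f k) a := by
    intro r
    simp
  rw [ind_symmDiff, ind_bigSymmDiff, ind_bigSymmDiff, ind_bigSymmDiff, key, key s, key t,
    ← Finset.sum_add_distrib]
  refine Finset.sum_congr rfl fun k _ => ?_
  rw [← add_mul]
  simp only [Finset.mem_symmDiff]
  have : (1 : ZMod 2) + 1 = 0 := by decide
  by_cases h1 : k ∈ s <;> by_cases h2 : k ∈ t <;> simp [h1, h2, this]

theorem bigSymmDiff_singleton {ι : Type*} (i : ι) (f : ι → Finset V) :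
    bigSymmDiff {i} f = f i := by
  refine ind_injective fun a => ?_
  rw [ind_bigSymmDiff, Finset.sum_singleton]

theorem bigSymmDiff_singletons {ι : Type*} (s : Finset ι) (v : ι → V)
    (hv : Function.Injective v) : bigSymmDiff s (fun k => {v k}) = s.image v := by
  refine ind_injective fun a => ?_
  rw [ind_bigSymmDiff]
  simp only [ind, Finset.mem_singleton, Finset.mem_image]
  split_ifs with h
  · obtain ⟨k, hk, rfl⟩ := h
    rw [Finset.sum_eq_single_of_mem k hk]
    · simp
    · intro j _ hj
      rw [if_neg (fun h => hj (hv h).symm)]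
  · refine Finset.sum_eq_zero fun k hk => if_neg ?_
    rintro rfl
    exact h ⟨k, hk, rfl⟩

theorem mem_of_mem_bigSymmDiff {ι : Type*} {s : Finset ι} {f : ι → Finset V} {a : V}
    (h : a ∈ bigSymmDiff s f) : ∃ k ∈ s, a ∈ f k := by
  by_contra hn
  push Not at hn
  have : s.filter (fun k => a ∈ f k) = ∅ := by
    ext k
    simp only [Finset.mem_filter, Finset.notMem_empty, iff_false, not_and]
    exact hn k
  simp [bigSymmDiff, this] at h

/-- Presents `g_V(v_i)` as a single linear combination of the `g(v_k)`, the form used in the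
elimination argument. -/
theorem matchingG_eq {n : ℕ} (g : V → Finset V) (v : Fin n → V) (U : Fin n → Finset (Fin n))
    (i : Fin n) :
    matchingG g v U i = bigSymmDiff (symmDiff {i} (U i)) fun k => g (v k) := by
  rw [bigSymmDiff_symmDiff, bigSymmDiff_singleton, matchingG]

end Parity

/-! ### Layers of a maximally delayed gflow and existence of a matching gflow -/

namespace OpenGraph

variable {V : Type u} [Fintype V] {Γ : OpenGraph V}

set_option linter.unusedSectionVars false

theorem mem_maxSet {lt : V → V → Prop} {X : Finset V} {a : V} :
    a ∈ maxSet lt X ↔ a ∈ X ∧ ∀ b ∈ X, ¬ lt a b := Finset.mem_filter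

theorem maxSet_nonempty {lt : V → V → Prop} (X : Finset V) (hX : X.Nonempty)
    (hirr : ∀ a ∈ X, ¬ lt a a)
    (htr : ∀ a ∈ X, ∀ b ∈ X, ∀ c ∈ X, lt a b → lt b c → lt a c) : (maxSet lt X).Nonempty := by
  let r : X → X → Prop := fun a b => lt b.1 a.1
  have : IsTrans X r := ⟨fun a b c hab hbc => htr _ c.2 _ b.2 _ a.2 hbc hab⟩
  have : Std.Irrefl r := ⟨fun a => hirr _ a.2⟩
  have hwf : WellFounded r := Finite.wellFounded_of_trans_of_irrefl r
  obtain ⟨a, ha⟩ := hX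
  obtain ⟨m, -, hm⟩ := hwf.has_min Set.univ ⟨⟨a, ha⟩, trivial⟩
  exact ⟨m.1, Finset.mem_filter.2 ⟨m.2, fun b hb hlt => hm ⟨b, hb⟩ trivial hlt⟩⟩

/-- Being more delayed is transitive and irreflexive on a finite set of gflows, so a maximal one
exists. -/
theorem exists_maximallyDelayed (h : ∃ g lt, Γ.IsGFlow g lt) :
    ∃ g lt, Γ.IsMaximallyDelayed g lt := by
  let X := {p : (V → Finset V) × (V → V → Prop) // Γ.IsGFlow p.1 p.2}
  let r : X → X → Prop := fun p q => Γ.MoreDelayed p.1.2 q.1.2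
  have : IsTrans X r := ⟨fun p q s hpq hqs =>
    ⟨fun k => (hqs.1 k).trans (hpq.1 k), by
      obtain ⟨k, hk⟩ := hpq.2
      exact ⟨k, (hqs.1 k).trans_lt hk⟩⟩⟩
  have : Std.Irrefl r := ⟨fun p hp => by
    obtain ⟨k, hk⟩ := hp.2
    exact lt_irrefl _ hk⟩
  have hwf : WellFounded r := Finite.wellFounded_of_trans_of_irrefl r
  obtain ⟨g, lt, hg⟩ := h
  obtain ⟨m, -, hm⟩ := hwf.has_min Set.univ ⟨⟨(g, lt), hg⟩, trivial⟩
  exact ⟨m.1.1, m.1.2, m.2, fun g' lt' hg' hmd => hm ⟨(g', lt'), hg'⟩ trivial hmd⟩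

/-- Dropping relations from an order can only move vertices to layers of smaller index. -/
theorem layersBelow_mono {lt lt' : V → V → Prop} (hlt : ∀ a b, lt' a b → lt a b) (k : ℕ) :
    Γ.layersBelow lt k ⊆ Γ.layersBelow lt' k := by
  induction k with
  | zero => exact Finset.Subset.refl _
  | succ k ih =>
    intro a ha
    rw [layersBelow, Finset.mem_union] at ha ⊢
    rcases ha with ha | ha
    · exact Or.inl (ih ha)
    · by_cases ha' : a ∈ Γ.layersBelow lt' k
      · exact Or.inl ha'
      · right
        rw [maxSet, Finset.mem_filter, Finset.mem_sdiff] at ha ⊢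
        refine ⟨⟨ha.1.1, ha'⟩, fun b hb hab => ha.2 b ?_ (hlt _ _ hab)⟩
        rw [Finset.mem_sdiff] at hb ⊢
        exact ⟨hb.1, fun h => hb.2 (ih h)⟩

theorem IsGFlow.g_nonempty {g : V → Finset V} {lt : V → V → Prop} (hg : Γ.IsGFlow g lt) {a : V}
    (ha : a ∈ Γ.verts) (ha' : a ∉ Γ.outputs) : (g a).Nonempty := by
  have h := hg.g2 a ha ha'
  rw [odd, Finset.mem_filter] at h
  obtain ⟨b, hb⟩ := Finset.card_pos.1 h.2.pos
  exact ⟨b, (Finset.mem_filter.1 hb).1⟩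

/-- A non-output lies below some element of its nonempty `g`-set, so it is not maximal. If some
output were not maximal either, deleting all relations that start at outputs would give a more
delayed gflow. -/
theorem IsMaximallyDelayed.maxSet_verts {g : V → Finset V} {lt : V → V → Prop}
    (hg : Γ.IsMaximallyDelayed g lt) : maxSet lt Γ.verts = Γ.outputs := by
  have h1 : maxSet lt Γ.verts ⊆ Γ.outputs := by
    intro a ha
    rw [maxSet, Finset.mem_filter] at ha
    by_contra ha'
    obtain ⟨b, hb⟩ := hg.1.g_nonempty ha.1 ha'
    exact ha.2 b (Finset.mem_sdiff.1 (hg.1.g_subset a ha.1 ha' hb)).1 (hg.1.g1 a ha.1 ha' b hb)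
  by_contra hne
  -- The gflow conditions require only relations that start at non-outputs, so this smaller order
  -- still works.
  let lt' : V → V → Prop := fun a b => lt a b ∧ a ∉ Γ.outputs
  have hg' : Γ.IsGFlow g lt' :=
    { irrefl := fun a ha h => hg.1.irrefl a ha h.1
      trans := fun a ha b hb c hc hab hbc => ⟨hg.1.trans a ha b hb c hc hab.1 hbc.1, hab.2⟩
      g_subset := hg.1.g_subset
      g1 := fun a ha ha' b hb => ⟨hg.1.g1 a ha ha' b hb, ha'⟩
      g2 := hg.1.g2
      g3 := fun a ha ha' b hb => (hg.1.g3 a ha ha' b hb).imp id fun h => ⟨h, ha'⟩ }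
  refine hg.2 g lt' hg' ⟨fun k => Finset.card_le_card (layersBelow_mono (fun _ _ h => h.1) _),
    0, ?_⟩
  have e : ∀ l : V → V → Prop, Γ.layersBelow l (0 + 1) = maxSet l Γ.verts := by
    intro l
    simp [layersBelow]
  rw [e, e]
  refine (Finset.card_lt_card (h1.ssubset_of_ne hne)).trans_le (Finset.card_le_card ?_)
  intro a ha
  exact mem_maxSet.2 ⟨Γ.outputs_subset ha, fun b _ h => h.2 ha⟩

theorem IsMaximallyDelayed.layer_one {g : V → Finset V} {lt : V → V → Prop}
    (hg : Γ.IsMaximallyDelayed g lt) : Γ.layer lt 1 = maxSet lt (Γ.verts \ Γ.outputs) := by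
  simp [layer, layersBelow, hg.maxSet_verts]

theorem IsMaximallyDelayed.mem_layer_one {g : V → Finset V} {lt : V → V → Prop}
    (hg : Γ.IsMaximallyDelayed g lt) {a : V} (ha : a ∈ Γ.layer lt 1) :
    a ∈ Γ.verts ∧ a ∉ Γ.outputs ∧ ∀ b ∈ Γ.verts, lt a b → b ∈ Γ.outputs := by
  rw [hg.layer_one, maxSet, Finset.mem_filter, Finset.mem_sdiff] at ha
  refine ⟨ha.1.1, ha.1.2, fun b hb hab => ?_⟩
  by_contra hb'
  exact ha.2 b (Finset.mem_sdiff.2 ⟨hb, hb'⟩) hab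

theorem IsMaximallyDelayed.g_subset_outputs {g : V → Finset V} {lt : V → V → Prop}
    (hg : Γ.IsMaximallyDelayed g lt) {a : V} (ha : a ∈ Γ.layer lt 1) :
    g a ⊆ Γ.outputs \ Γ.inputs := by
  obtain ⟨h1, h2, h3⟩ := hg.mem_layer_one ha
  intro b hb
  have := Finset.mem_sdiff.1 (hg.1.g_subset a h1 h2 hb)
  exact Finset.mem_sdiff.2 ⟨h3 b this.1 (hg.1.g1 a h1 h2 b hb), this.2⟩

theorem mem_odd_removeOutputEdges {S : Finset V} {a : V} (ha : a ∉ Γ.outputs) :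
    a ∈ Γ.removeOutputEdges.odd S ↔ a ∈ Γ.odd S := by
  simp [odd, removeOutputEdges, ha]

theorem not_mem_odd_removeOutputEdges {S : Finset V} (hS : S ⊆ Γ.outputs) {a : V}
    (ha : a ∈ Γ.outputs) : a ∉ Γ.removeOutputEdges.odd S := by
  intro h
  rw [odd, Finset.mem_filter] at h
  obtain ⟨b, hb⟩ := Finset.card_pos.1 h.2.pos
  rw [Finset.mem_filter] at hb
  exact hb.2.2 ⟨ha, hS hb.1⟩

/-- Outputs see no outputs in `G'`, and any non-output in the odd neighbourhood other than `a` would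
lie above `a`, where there are only outputs. Thus the sets `g(v)` of the layer form a dual system to
its vertices, and combinations of them have prescribed odd neighbourhoods. -/
theorem IsMaximallyDelayed.odd_g {g : V → Finset V} {lt : V → V → Prop}
    (hg : Γ.IsMaximallyDelayed g lt) {a : V} (ha : a ∈ Γ.layer lt 1) :
    Γ.removeOutputEdges.odd (g a) = {a} := by
  obtain ⟨h1, h2, h3⟩ := hg.mem_layer_one ha
  ext b
  rw [Finset.mem_singleton]
  by_cases hb : b ∈ Γ.outputs
  · simp only [not_mem_odd_removeOutputEdges
      ((hg.g_subset_outputs ha).trans Finset.sdiff_subset) hb, false_iff]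
    rintro rfl
    exact h2 hb
  · rw [mem_odd_removeOutputEdges hb]
    constructor
    · intro hb'
      rcases hg.1.g3 a h1 h2 b hb' with h | h
      · exact h.symm
      · exact absurd (h3 b (Finset.mem_filter.1 hb').1 h) hb
    · rintro rfl
      exact hg.1.g2 b h1 h2

theorem IsMaximallyDelayed.odd_bigSymmDiff_g {g : V → Finset V} {lt : V → V → Prop}
    (hg : Γ.IsMaximallyDelayed g lt) {n : ℕ} {v : Fin n → V} (hv : Function.Injective v)
    (hv' : ∀ i, v i ∈ Γ.layer lt 1) (s : Finset (Fin n)) :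
    Γ.removeOutputEdges.odd (bigSymmDiff s fun k => g (v k)) = s.image v := by
  rw [odd_bigSymmDiff, ← bigSymmDiff_singletons s v hv]
  simp only [hg.odd_g (hv' _)]

/-- The sets `g_V(v_k)` are in echelon form with respect to the vertices `h(v_k)`. -/
theorem exists_agree {n : ℕ} (f : Fin n → Finset V) (U : Fin n → Finset (Fin n)) (h : Fin n → V)
    (m : ℕ) (hU : ∀ i, i.1 < m → ∀ k ∈ U i, k < i)
    (hh : ∀ i, i.1 < m → ∀ k < i, h k ∉ bigSymmDiff (symmDiff {i} (U i)) f)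
    (hmem : ∀ i, i.1 < m → h i ∈ bigSymmDiff (symmDiff {i} (U i)) f) (T : Finset V) :
    ∃ s : Finset (Fin n), (∀ k ∈ s, k.1 < m) ∧
      ∀ k, k.1 < m → (h k ∈ T ↔ h k ∈ bigSymmDiff s f) := by
  induction m with
  | zero => exact ⟨∅, by simp, by simp⟩
  | succ m ih =>
    obtain ⟨s, hs1, hs2⟩ := ih (fun i hi => hU i (by omega)) (fun i hi => hh i (by omega))
      (fun i hi => hmem i (by omega))
    by_cases hm : m < n
    · let i : Fin n := ⟨m, hm⟩
      by_cases hi : h i ∈ T ↔ h i ∈ bigSymmDiff s f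
      · refine ⟨s, fun k hk => (hs1 k hk).trans (Nat.lt_succ_self m), fun k hk => ?_⟩
        rcases Nat.lt_succ_iff_lt_or_eq.1 hk with hk | hk
        · exact hs2 k hk
        · have : k = i := Fin.ext hk
          rw [this]; exact hi
      -- Adding the combination for `v_i` corrects the mismatch at its pivot `h i` and leaves the
      -- earlier pivots alone, because it does not contain them.
      · refine ⟨symmDiff s (symmDiff {i} (U i)), fun k hk => ?_, fun k hk => ?_⟩
        · rw [Finset.mem_symmDiff, Finset.mem_symmDiff, Finset.mem_singleton] at hk
          rcases hk with ⟨hk, -⟩ | ⟨⟨rfl, -⟩ | ⟨hk, -⟩, -⟩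
          · exact (hs1 k hk).trans (Nat.lt_succ_self m)
          · exact Nat.lt_succ_self m
          · have := hU i (Nat.lt_succ_self m) k hk
            exact lt_trans this (Nat.lt_succ_self m)
        · rw [bigSymmDiff_symmDiff, Finset.mem_symmDiff]
          rcases Nat.lt_succ_iff_lt_or_eq.1 hk with hk | hk
          · have := hh i (Nat.lt_succ_self m) k hk
            rw [hs2 k hk]
            tauto
          · have hki : k = i := Fin.ext hk
            have := hmem i (Nat.lt_succ_self m)
            rw [hki]
            tauto
    · exact ⟨s, fun k hk => (hs1 k hk).trans (Nat.lt_succ_self m),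
        fun k _ => hs2 k (by omega)⟩

/-- The elimination never gets stuck: the earlier sets are in echelon form, so `U_i` exists, and
duality guarantees a neighbour of `v_i` in the recombined set. -/
theorem exists_matchingGFlow {g : V → Finset V} {lt : V → V → Prop}
    (hg : Γ.IsMaximallyDelayed g lt) :
    ∃ M : MatchingGFlow Γ, M.g = g ∧ M.lt = lt := by
  let n := (Γ.layer lt 1).card
  let v : Fin n → V := fun i => ((Γ.layer lt 1).equivFin.symm i).1
  have hv : Function.Injective v := fun i j h =>
    (Γ.layer lt 1).equivFin.symm.injective (Subtype.ext h)
  have hv' : ∀ i, v i ∈ Γ.layer lt 1 := fun i => ((Γ.layer lt 1).equivFin.symm i).2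
  have hvs : ∀ a, a ∈ Γ.layer lt 1 ↔ ∃ i, v i = a := by
    intro a
    constructor
    · intro ha
      exact ⟨(Γ.layer lt 1).equivFin ⟨a, ha⟩, by simp [v]⟩
    · rintro ⟨i, rfl⟩
      exact hv' i
  have key : ∀ m : ℕ, m ≤ n → ∃ (U : Fin n → Finset (Fin n)) (h : Fin n → V), ∀ i, i.1 < m →
      (∀ k ∈ U i, k < i) ∧
      (∀ k < i, (h k ∈ g (v i) ↔ h k ∈ bigSymmDiff (U i) fun k => g (v k))) ∧
      h i ∈ matchingG g v U i ∧ Γ.graph.Adj (v i) (h i) := by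
    intro m
    induction m with
    | zero => exact fun _ => ⟨fun _ => ∅, v, by simp⟩
    | succ m ih =>
      intro hm
      obtain ⟨U, h, hUh⟩ := ih (by omega)
      let i : Fin n := ⟨m, hm⟩
      obtain ⟨s, hs1, hs2⟩ := exists_agree (fun k => g (v k)) U h m (fun j hj => (hUh j hj).1)
        (fun j hj k hk => by
          have := (hUh j hj).2.1 k hk
          rw [← matchingG_eq, matchingG, Finset.mem_symmDiff]
          tauto)
        (fun j hj => by
          rw [← matchingG_eq]
          exact (hUh j hj).2.2.1) (g (v i))
      have hsi : i ∉ s := fun hi => lt_irrefl _ (hs1 i hi)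
      -- Since `i ∉ s`, the coefficient of `g (v i)` is one, so `v i` is in the odd neighbourhood
      -- and has a neighbour in the combination. That neighbour becomes the pivot.
      have hodd : v i ∈ Γ.removeOutputEdges.odd (bigSymmDiff (symmDiff {i} s) fun k => g (v k)) := by
        rw [hg.odd_bigSymmDiff_g hv hv']
        refine Finset.mem_image_of_mem _ ?_
        simp [Finset.mem_symmDiff, hsi]
      rw [odd, Finset.mem_filter] at hodd
      obtain ⟨b, hb⟩ := Finset.card_pos.1 hodd.2.pos
      rw [Finset.mem_filter] at hb
      refine ⟨Function.update U i s, Function.update h i b, fun j hj => ?_⟩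
      rcases Nat.lt_succ_iff_lt_or_eq.1 hj with hj | hj
      · have hne : ∀ k : Fin n, k.1 < m → k ≠ i := fun k hk hki => by
          rw [hki] at hk; exact lt_irrefl _ hk
        obtain ⟨h1, h2, h3, h4⟩ := hUh j hj
        unfold matchingG at h3 ⊢
        rw [Function.update_of_ne (hne j hj), Function.update_of_ne (hne j hj)]
        refine ⟨h1, fun k hk => ?_, h3, h4⟩
        rw [Function.update_of_ne (hne k (lt_trans hk hj))]
        exact h2 k hk
      · have hji : j = i := Fin.ext hj
        rw [hji, matchingG_eq, Function.update_self, Function.update_self]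
        refine ⟨fun k hk => hs1 k hk, fun k hk => ?_, hb.1, hb.2.1⟩
        rw [Function.update_of_ne (ne_of_lt hk)]
        exact hs2 k hk
  obtain ⟨U, h, hUh⟩ := key n le_rfl
  refine ⟨{ g := g, lt := lt, maximallyDelayed := hg, n := n, v := v, v_injective := hv,
            mem_layer_iff := hvs, U := U, U_lt := fun i => (hUh i i.2).1, h := h,
            U_spec := fun i => ?_, h_mem := fun i => (hUh i i.2).2.2.1,
            h_adj := fun i => (hUh i i.2).2.2.2 }, rfl, rfl⟩
  ext b
  simp only [Finset.mem_inter, Finset.mem_image, Finset.mem_filter, Finset.mem_univ, true_and]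
  refine and_congr_right ?_
  rintro ⟨k, hk, rfl⟩
  exact (hUh i i.2).2.1 k hk

end OpenGraph

/-! ### The rewritten graphs, the reduced open graph and its gflow -/

namespace MatchingGFlow

variable {V : Type u} [Fintype V] {Γ : OpenGraph V} (M : MatchingGFlow Γ)

theorem v_mem_layer (i : Fin M.n) : M.v i ∈ Γ.layer M.lt 1 := (M.mem_layer_iff _).2 ⟨i, rfl⟩

theorem v_mem (i : Fin M.n) : M.v i ∈ Γ.verts :=
  (M.maximallyDelayed.mem_layer_one (M.v_mem_layer i)).1

theorem v_not_output (i : Fin M.n) : M.v i ∉ Γ.outputs :=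
  (M.maximallyDelayed.mem_layer_one (M.v_mem_layer i)).2.1

theorem gV_subset (i : Fin M.n) : M.gV i ⊆ Γ.outputs \ Γ.inputs := by
  intro a ha
  rw [gV, matchingG_eq] at ha
  obtain ⟨k, -, hk⟩ := mem_of_mem_bigSymmDiff ha
  exact M.maximallyDelayed.g_subset_outputs (M.v_mem_layer k) hk

theorem h_mem_output (i : Fin M.n) : M.h i ∈ Γ.outputs :=
  (Finset.mem_sdiff.1 (M.gV_subset i (M.h_mem i))).1

theorem h_not_input (i : Fin M.n) : M.h i ∉ Γ.inputs :=
  (Finset.mem_sdiff.1 (M.gV_subset i (M.h_mem i))).2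

/-- Echelon form: `g(v_i)` and the correction agree on earlier pivots, so these cancel in the
symmetric difference. -/
theorem h_not_mem_gV {i k : Fin M.n} (hk : k < i) : M.h k ∉ M.gV i := by
  have h1 : M.h k ∈ (Finset.univ.filter (· < i)).image M.h :=
    Finset.mem_image_of_mem _ (by simp [hk])
  have h2 := Finset.ext_iff.1 (M.U_spec i) (M.h k)
  rw [Finset.mem_inter, Finset.mem_inter] at h2
  rw [gV, matchingG, Finset.mem_symmDiff]
  tauto

theorem h_injective : Function.Injective M.h := by
  intro i j hij
  rcases lt_trichotomy i j with h | h | h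
  · exact absurd (hij ▸ M.h_mem j) (M.h_not_mem_gV h)
  · exact h
  · exact absurd (hij ▸ M.h_mem i) (M.h_not_mem_gV h)

theorem mem_R {a : V} : a ∈ M.R ↔ ∃ i, M.h i = a := by simp [R]

theorem R_subset : M.R ⊆ Γ.outputs := by
  intro a ha
  obtain ⟨i, rfl⟩ := M.mem_R.1 ha
  exact M.h_mem_output i

theorem not_mem_R_of_input {a : V} (ha : a ∈ Γ.inputs) : a ∉ M.R := by
  intro h
  obtain ⟨i, rfl⟩ := M.mem_R.1 h
  exact M.h_not_input i ha

/-- By duality the odd neighbourhood is read off from the index set `{i} ⊕ U_i`, and `i ∉ U_i`. The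
new neighbours of `h(v_i)` are thus `v_i` and earlier vertices of the layer. -/
theorem mem_oddGV {i : Fin M.n} {a : V} :
    a ∈ M.oddGV i ↔ a = M.v i ∨ ∃ k ∈ M.U i, a = M.v k := by
  rw [oddGV, gV, matchingG_eq, M.maximallyDelayed.odd_bigSymmDiff_g M.v_injective M.v_mem_layer]
  have hi : i ∉ M.U i := fun h => lt_irrefl _ (M.U_lt i i h)
  simp only [Finset.mem_image, Finset.mem_symmDiff, Finset.mem_singleton]
  constructor
  · rintro ⟨k, ⟨rfl, -⟩ | ⟨hk, -⟩, rfl⟩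
    · exact Or.inl rfl
    · exact Or.inr ⟨k, hk, rfl⟩
  · rintro (rfl | ⟨k, hk, rfl⟩)
    · exact ⟨i, Or.inl ⟨rfl, hi⟩, rfl⟩
    · exact ⟨k, Or.inr ⟨hk, fun h => hi (h ▸ hk)⟩, rfl⟩

theorem exists_of_mem_oddGV {i : Fin M.n} {a : V} (ha : a ∈ M.oddGV i) :
    ∃ k ≤ i, a = M.v k := by
  rcases M.mem_oddGV.1 ha with h | ⟨k, hk, h⟩
  · exact ⟨i, le_rfl, h⟩
  · exact ⟨k, (M.U_lt i k hk).le, h⟩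

theorem oddGV_not_output {i : Fin M.n} {a : V} (ha : a ∈ M.oddGV i) : a ∉ Γ.outputs := by
  obtain ⟨k, -, rfl⟩ := M.exists_of_mem_oddGV ha
  exact M.v_not_output k

theorem seq_zero : M.seq 0 = Γ.removeOutputEdges := rfl

theorem seqAux_succ (i : Fin M.n) : (M.seqAux (i + 1)).1
    = M.rewrite i (M.seqAux i).1 (M.seqAux i).2 := by
  rw [seqAux, dif_pos i.2]

theorem seq_verts (k : ℕ) : (M.seq k).verts = Γ.verts := (M.seqAux k).2

theorem seqAux_inputs_outputs (k : ℕ) :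
    (M.seqAux k).1.inputs = Γ.inputs ∧ (M.seqAux k).1.outputs = Γ.outputs := by
  induction k with
  | zero => exact ⟨rfl, rfl⟩
  | succ k ih =>
    rw [seqAux]
    split_ifs
    · exact ih
    · exact ih

theorem seq_inputs (k : ℕ) : (M.seq k).inputs = Γ.inputs := (M.seqAux_inputs_outputs k).1

theorem seq_outputs (k : ℕ) : (M.seq k).outputs = Γ.outputs := (M.seqAux_inputs_outputs k).2

theorem seq_succ_adj (i : Fin M.n) (a b : V) : (M.seq (i + 1)).graph.Adj a b ↔
    a ≠ b ∧ ((a ≠ M.h i ∧ b ≠ M.h i ∧ (M.seq i).graph.Adj a b)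
      ∨ (a = M.h i ∧ b ∈ M.oddGV i) ∨ (b = M.h i ∧ a ∈ M.oddGV i)) := by
  rw [seq, seqAux_succ]
  rfl

theorem seq_adj_of_not_outputs {k : ℕ} (hk : k ≤ M.n) {a b : V} (ha : a ∉ Γ.outputs)
    (hb : b ∉ Γ.outputs) : (M.seq k).graph.Adj a b ↔ Γ.graph.Adj a b := by
  induction k with
  | zero => exact ⟨fun h => h.1, fun h => ⟨h, fun h' => ha h'.1⟩⟩
  | succ k ih =>
    have h1 := M.seq_succ_adj ⟨k, hk⟩ a b
    simp only at h1
    rw [h1, ← ih (by omega)]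
    have ha' : a ≠ M.h ⟨k, hk⟩ := fun h => ha (h ▸ M.h_mem_output _)
    have hb' : b ≠ M.h ⟨k, hk⟩ := fun h => hb (h ▸ M.h_mem_output _)
    simp only [ha', hb', ne_eq, not_false_eq_true, true_and, false_and, or_false]
    exact ⟨fun h => h.2, fun h => ⟨h.ne, h⟩⟩

theorem seq_not_adj_outputs {k : ℕ} (hk : k ≤ M.n) {a b : V} (ha : a ∈ Γ.outputs)
    (hb : b ∈ Γ.outputs) : ¬ (M.seq k).graph.Adj a b := by
  induction k with
  | zero => exact fun h => h.2 ⟨ha, hb⟩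
  | succ k ih =>
    have h1 := M.seq_succ_adj ⟨k, hk⟩ a b
    simp only at h1
    rw [h1]
    rintro ⟨-, ⟨-, -, h⟩ | ⟨-, h⟩ | ⟨-, h⟩⟩
    · exact ih (by omega) h
    · exact M.oddGV_not_output h hb
    · exact M.oddGV_not_output h ha

/-- The rewired vertex is an output without output neighbours, before and after the step, so other
outputs keep their neighbourhoods. -/
theorem seq_succ_adj_of_ne (i : Fin M.n) {a b : V} (ha : a ∈ Γ.outputs) (hne : a ≠ M.h i) :
    (M.seq (i + 1)).graph.Adj a b ↔ (M.seq i).graph.Adj a b := by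
  rw [M.seq_succ_adj]
  have ha' : a ∉ M.oddGV i := fun h => M.oddGV_not_output h ha
  have hb' : b = M.h i → ¬ (M.seq i).graph.Adj a b := by
    rintro rfl
    exact M.seq_not_adj_outputs i.2.le ha (M.h_mem_output i)
  simp only [hne, ha', ne_eq, not_false_eq_true, true_and, false_and, and_false, or_false]
  exact ⟨fun h => h.2.2, fun h => ⟨h.ne, fun hb => hb' hb h, h⟩⟩

theorem seq_succ_adj_h (i : Fin M.n) {b : V} :
    (M.seq (i + 1)).graph.Adj (M.h i) b ↔ b ∈ M.oddGV i := by
  rw [M.seq_succ_adj]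
  have h1 : M.h i ∉ M.oddGV i := fun h => M.oddGV_not_output h (M.h_mem_output i)
  simp only [ne_eq, not_true_eq_false, false_and, true_and, false_or, h1, and_false, or_false]
  exact ⟨fun h => h.2, fun h => ⟨by rintro rfl; exact h1 h, h⟩⟩

theorem seq_adj_of_forall_ne {k : ℕ} (hk : k ≤ M.n) {a b : V} (ha : a ∈ Γ.outputs)
    (hne : ∀ j : Fin M.n, j.1 < k → M.h j ≠ a) :
    (M.seq k).graph.Adj a b ↔ Γ.removeOutputEdges.graph.Adj a b := by
  induction k with
  | zero => rfl
  | succ k ih =>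
    have h1 := M.seq_succ_adj_of_ne ⟨k, hk⟩ (b := b) ha (hne ⟨k, hk⟩ (Nat.lt_succ_self k)).symm
    simp only at h1
    rw [h1, ih (by omega) fun j hj => hne j (by omega)]

/-- Pivots are distinct, so once `h(v_j)` has been rewired its neighbourhood is final. -/
theorem seq_adj_h {k : ℕ} (hk : k ≤ M.n) {j : Fin M.n} (hj : j.1 < k) {b : V} :
    (M.seq k).graph.Adj (M.h j) b ↔ b ∈ M.oddGV j := by
  induction k with
  | zero => omega
  | succ k ih =>
    rcases Nat.lt_succ_iff_lt_or_eq.1 hj with hj' | hj'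
    · have hne : M.h j ≠ M.h ⟨k, hk⟩ := fun h => by
        have := M.h_injective h
        rw [this] at hj'
        exact lt_irrefl _ hj'
      have h1 := M.seq_succ_adj_of_ne ⟨k, hk⟩ (b := b) (M.h_mem_output j) hne
      simp only at h1
      rw [h1, ih (by omega) hj']
    · subst hj'
      exact M.seq_succ_adj_h j

theorem seq_adj_of_not_mem_R {k : ℕ} (hk : k ≤ M.n) {a b : V} (ha : a ∉ M.R) (hb : b ∉ M.R) :
    (M.seq k).graph.Adj a b ↔ Γ.removeOutputEdges.graph.Adj a b := by
  have hR : ∀ {c : V}, c ∉ M.R → ∀ j : Fin M.n, j.1 < k → M.h j ≠ c :=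
    fun hc j _ h => hc (M.mem_R.2 ⟨j, h⟩)
  by_cases ha' : a ∈ Γ.outputs
  · exact M.seq_adj_of_forall_ne hk ha' (hR ha)
  · by_cases hb' : b ∈ Γ.outputs
    · rw [SimpleGraph.adj_comm, M.seq_adj_of_forall_ne hk hb' (hR hb), SimpleGraph.adj_comm]
    · rw [M.seq_adj_of_not_outputs hk ha' hb']
      exact ⟨fun h => ⟨h, fun h' => ha' h'.1⟩, fun h => h.1⟩

theorem reduced_adj {a b : V} : M.reduced.graph.Adj a b ↔
    Γ.removeOutputEdges.graph.Adj a b ∧ a ∉ M.R ∧ b ∉ M.R := by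
  change _ ∧ _ ∧ _ ↔ _
  constructor
  · rintro ⟨h, ha, hb⟩
    exact ⟨(M.seq_adj_of_not_mem_R le_rfl ha hb).1 h, ha, hb⟩
  · rintro ⟨h, ha, hb⟩
    exact ⟨(M.seq_adj_of_not_mem_R le_rfl ha hb).2 h, ha, hb⟩

theorem mem_reduced_outputs {a : V} : a ∈ M.reduced.outputs ↔
    (∃ i, M.v i = a) ∨ (a ∈ Γ.outputs ∧ a ∉ M.R) := by
  simp only [reduced, Finset.mem_sdiff, Finset.mem_union, M.mem_layer_iff]
  constructor
  · rintro ⟨h | h, h'⟩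
    · exact Or.inl h
    · exact Or.inr ⟨h, h'⟩
  · rintro (⟨i, rfl⟩ | h)
    · exact ⟨Or.inl ⟨i, rfl⟩, fun h => M.v_not_output i (M.R_subset h)⟩
    · exact ⟨Or.inr h.1, h.2⟩

theorem reduced_verts : M.reduced.verts = Γ.verts \ M.R := rfl

theorem reduced_inputs : M.reduced.inputs = Γ.inputs :=
  Finset.sdiff_eq_self_of_disjoint
    (Finset.disjoint_left.2 fun _ ha => M.not_mem_R_of_input ha)

theorem mem_reduced_nonoutput {a : V} : (a ∈ M.reduced.verts ∧ a ∉ M.reduced.outputs) ↔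
    a ∈ Γ.verts ∧ a ∉ Γ.outputs ∧ ∀ i, M.v i ≠ a := by
  rw [mem_reduced_outputs, reduced_verts, Finset.mem_sdiff]
  have : a ∈ M.R → a ∈ Γ.outputs := fun h => M.R_subset h
  push Not
  constructor
  · rintro ⟨⟨h1, h2⟩, h3, h4⟩
    exact ⟨h1, fun h => h2 (h4 h), h3⟩
  · rintro ⟨h1, h2, h3⟩
    exact ⟨⟨h1, fun h => h2 (this h)⟩, h3, fun h => absurd h h2⟩

theorem reduced_odd {S : Finset V} (hS : ∀ a ∈ S, a ∉ M.R) {a : V} :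
    a ∈ M.reduced.odd S ↔ a ∉ M.R ∧ a ∈ Γ.removeOutputEdges.odd S := by
  simp only [OpenGraph.odd, Finset.mem_filter, reduced_adj, reduced_verts, Finset.mem_sdiff]
  by_cases ha : a ∈ M.R
  · simp [ha]
  · have h1 : S.filter (fun w => Γ.removeOutputEdges.graph.Adj a w ∧ a ∉ M.R ∧ w ∉ M.R)
        = S.filter fun w => Γ.removeOutputEdges.graph.Adj a w :=
      Finset.filter_congr fun w hw => by simp [ha, hS w hw]
    rw [h1]
    simp only [ha, not_false_eq_true, and_true, true_and]
    rfl

/-- Each `g(a)` is cleared of the deleted vertices `R_V` by adding sets `g(v_k)`. This changes its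
odd neighbourhood in `G'` only at vertices of `V_1`, which are outputs of the reduced graph. -/
theorem reduced_isGFlow : ∃ g lt, M.reduced.IsGFlow g lt := by
  have hag := fun T => OpenGraph.exists_agree (fun k => M.g (M.v k)) M.U M.h M.n
    (fun i _ => M.U_lt i) (fun i _ k hk => by
      rw [← matchingG_eq]
      exact M.h_not_mem_gV hk)
    (fun i _ => by
      rw [← matchingG_eq]
      exact M.h_mem i) T
  choose s _ hs using hag
  have hg := M.maximallyDelayed.1
  let g' : V → Finset V := fun a =>
    symmDiff (M.g a) (bigSymmDiff (s (M.g a)) fun k => M.g (M.v k))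
  -- All outputs of the reduced graph are put above all its non-outputs; this absorbs the elements
  -- added to `g(a)` and to its odd neighbourhood.
  let lt' : V → V → Prop := fun a b =>
    a ∉ M.reduced.outputs ∧ (M.lt a b ∨ b ∈ M.reduced.outputs)
  have hR : ∀ a, ∀ b ∈ g' a, b ∉ M.R := by
    intro a b hb hbR
    obtain ⟨k, rfl⟩ := M.mem_R.1 hbR
    have h1 := hs (M.g a) k k.2
    rw [Finset.mem_symmDiff] at hb
    tauto
  have hg' : ∀ a, ∀ b ∈ g' a, b ∈ M.g a ∨ b ∈ Γ.outputs \ Γ.inputs := by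
    intro a b hb
    rw [Finset.mem_symmDiff] at hb
    rcases hb with hb | hb
    · exact Or.inl hb.1
    · obtain ⟨k, -, hk⟩ := mem_of_mem_bigSymmDiff hb.1
      exact Or.inr (M.maximallyDelayed.g_subset_outputs (M.v_mem_layer k) hk)
  have hodd : ∀ a, Γ.removeOutputEdges.odd (g' a)
      = symmDiff (Γ.removeOutputEdges.odd (M.g a)) ((s (M.g a)).image M.v) := by
    intro a
    rw [odd_symmDiff, M.maximallyDelayed.odd_bigSymmDiff_g M.v_injective M.v_mem_layer]
  have hmem : ∀ {a}, a ∈ M.reduced.verts → a ∈ Γ.verts := fun ha => (Finset.mem_sdiff.1 ha).1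
  refine ⟨g', lt', ?_, ?_, ?_, ?_, ?_, ?_⟩
  · rintro a ha ⟨h1, h2⟩
    exact hg.irrefl a (hmem ha) (h2.resolve_right h1)
  · rintro a ha b hb c hc ⟨h1, h2⟩ ⟨h3, h4⟩
    exact ⟨h1, h4.imp (fun h => hg.trans a (hmem ha) b (hmem hb) c (hmem hc)
      (h2.resolve_right h3) h) id⟩
  · intro a ha ha' b hb
    obtain ⟨h1, h2, -⟩ := M.mem_reduced_nonoutput.1 ⟨ha, ha'⟩
    have hbR := hR a b hb
    rw [reduced_inputs, reduced_verts, Finset.mem_sdiff, Finset.mem_sdiff]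
    rcases hg' a b hb with h | h
    · have := Finset.mem_sdiff.1 (hg.g_subset a h1 h2 h)
      exact ⟨⟨this.1, hbR⟩, this.2⟩
    · rw [Finset.mem_sdiff] at h
      exact ⟨⟨Γ.outputs_subset h.1, hbR⟩, h.2⟩
  · intro a ha ha' b hb
    obtain ⟨h1, h2, -⟩ := M.mem_reduced_nonoutput.1 ⟨ha, ha'⟩
    refine ⟨ha', ?_⟩
    rcases hg' a b hb with h | h
    · exact Or.inl (hg.g1 a h1 h2 b h)
    · exact Or.inr (M.mem_reduced_outputs.2 (Or.inr ⟨(Finset.mem_sdiff.1 h).1, hR a b hb⟩))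
  · intro a ha ha'
    obtain ⟨h1, h2, h3⟩ := M.mem_reduced_nonoutput.1 ⟨ha, ha'⟩
    rw [M.reduced_odd (hR a), hodd, Finset.mem_symmDiff]
    refine ⟨(Finset.mem_sdiff.1 ha).2, Or.inl
      ⟨(OpenGraph.mem_odd_removeOutputEdges h2).2 (hg.g2 a h1 h2), ?_⟩⟩
    rw [Finset.mem_image]
    rintro ⟨k, -, hk⟩
    exact h3 k hk
  · intro a ha ha' b hb
    obtain ⟨h1, h2, h3⟩ := M.mem_reduced_nonoutput.1 ⟨ha, ha'⟩
    rw [M.reduced_odd (hR a), hodd, Finset.mem_symmDiff] at hb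
    obtain ⟨hbR, hb⟩ := hb
    by_cases hbO : b ∈ M.reduced.outputs
    · exact Or.inr ⟨ha', Or.inr hbO⟩
    have hbO' : b ∉ Γ.outputs := fun h => hbO (M.mem_reduced_outputs.2 (Or.inr ⟨h, hbR⟩))
    rcases hb with hb | hb
    · rw [OpenGraph.mem_odd_removeOutputEdges hbO'] at hb
      exact (hg.g3 a h1 h2 b hb.1).imp id fun h => ⟨ha', Or.inl h⟩
    · obtain ⟨k, -, hk⟩ := Finset.mem_image.1 hb.1
      exact absurd (M.mem_reduced_outputs.2 (Or.inl ⟨k, hk⟩)) hbO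

/-- The layer `V_1`, nonempty as the set of maximal non-outputs, turns into outputs. This drives the
induction over layers. -/
theorem reduced_card_lt (hne : Γ.verts ≠ Γ.outputs) :
    (M.reduced.verts \ M.reduced.outputs).card < (Γ.verts \ Γ.outputs).card := by
  have hX : (Γ.verts \ Γ.outputs).Nonempty := by
    rw [Finset.nonempty_iff_ne_empty, Ne, Finset.sdiff_eq_empty_iff_subset]
    exact fun h => hne (h.antisymm Γ.outputs_subset)
  have hg := M.maximallyDelayed.1
  have hm : ∀ {a}, a ∈ Γ.verts \ Γ.outputs → a ∈ Γ.verts := fun h => (Finset.mem_sdiff.1 h).1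
  obtain ⟨a, ha⟩ := OpenGraph.maxSet_nonempty (lt := M.lt) _ hX (fun a ha => hg.irrefl a (hm ha))
    fun a ha b hb c hc => hg.trans a (hm ha) b (hm hb) c (hm hc)
  rw [← M.maximallyDelayed.layer_one, M.mem_layer_iff] at ha
  obtain ⟨i, rfl⟩ := ha
  refine Finset.card_lt_card (Finset.ssubset_iff_of_subset ?_ |>.2 ⟨M.v i, ?_, ?_⟩)
  · intro b hb
    have := M.mem_reduced_nonoutput.1 (Finset.mem_sdiff.1 hb)
    exact Finset.mem_sdiff.2 ⟨this.1, this.2.1⟩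
  · exact Finset.mem_sdiff.2 ⟨M.v_mem i, M.v_not_output i⟩
  · intro h
    exact (M.mem_reduced_nonoutput.1 (Finset.mem_sdiff.1 h)).2.2 i rfl

end MatchingGFlow

theorem nonempty_translation {V : Type u} [Fintype V] (N : ℕ) (Γ : OpenGraph V)
    (hN : (Γ.verts \ Γ.outputs).card = N) (h : ∃ g lt, Γ.IsGFlow g lt) :
    Nonempty (Translation Γ) := by
  induction N using Nat.strong_induction_on generalizing Γ with
  | _ N ih =>
  by_cases hΓ : Γ.verts = Γ.outputs
  · exact ⟨.done Γ hΓ⟩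
  · obtain ⟨g, lt, hg⟩ := OpenGraph.exists_maximallyDelayed h
    obtain ⟨M, -, -⟩ := OpenGraph.exists_matchingGFlow hg
    obtain ⟨T⟩ := ih _ (hN ▸ M.reduced_card_lt hΓ) M.reduced rfl M.reduced_isGFlow
    exact ⟨.step M T⟩

/-! ## Stabilizer rewriting of graph states and path sums -/

theorem fin_two_add_mul : ∀ a b c : Fin 2, (a + b) * c = a * c + b * c := by decide

theorem fin_two_add_add_cancel : ∀ a b : Fin 2, a + b + b = a := by decide

/-- The factor `f b` occurs once for every neighbour of `b` in `S`, and since it squares to one only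
the parity counts. -/
theorem prod_odd {V : Type u} [Fintype V] (Γ : OpenGraph V) (S : Finset V) (f : V → ℂ)
    (hf : ∀ b, f b * f b = 1) :
    ∏ a ∈ S, ∏ b ∈ Finset.univ.filter (Γ.graph.Adj a), f b = ∏ b ∈ Γ.odd S, f b := by
  simp only [Finset.prod_filter]
  rw [Finset.prod_comm]
  have h1 : ∀ b, (∏ a ∈ S, if Γ.graph.Adj a b then f b else 1)
      = if b ∈ Γ.odd S then f b else 1 := by
    intro b
    rw [← Finset.prod_filter, Finset.prod_const]
    have h2 : S.filter (fun a => Γ.graph.Adj a b) = S.filter fun w => Γ.graph.Adj b w :=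
      Finset.filter_congr fun w _ => Γ.graph.adj_comm w b
    rw [h2]
    have hsq : ∀ m : ℕ, f b ^ (m + m) = 1 := by
      intro m
      rw [← two_mul, pow_mul, sq, hf, one_pow]
    by_cases hodd : Odd (S.filter fun w => Γ.graph.Adj b w).card
    · have hb : b ∈ Γ.odd S := by
        obtain ⟨c, hc⟩ := Finset.card_pos.1 hodd.pos
        exact Finset.mem_filter.2 ⟨Γ.adj_mem _ _ (Finset.mem_filter.1 hc).2, hodd⟩
      rw [if_pos hb]
      obtain ⟨m, hm⟩ := hodd
      rw [hm, two_mul, pow_succ, hsq, one_mul]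
    · rw [if_neg (show b ∉ Γ.odd S from fun h => hodd (Finset.mem_filter.1 h).2)]
      obtain ⟨m, hm⟩ := Nat.not_odd_iff_even.1 hodd
      rw [hm, hsq]
  simp only [h1]
  rw [← Finset.prod_filter, Finset.filter_univ_mem]

namespace OpenGraph

variable {V : Type u} [Fintype V] {Γ : OpenGraph V}

/-- Sort the vertices by decreasing distance to the outputs along `h`; a successor is strictly
closer. -/
theorem IsPathCover.exists_schedule {h : V → V} (hp : Γ.IsPathCover h) :
    ∃ L, Γ.IsSchedule h L := by
  let d : V → ℕ := fun a => if ha : ∃ k : ℕ, h^[k] a ∈ Γ.outputs then Nat.find ha else 0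
  have hd : ∀ a ∈ Γ.verts, a ∉ Γ.outputs → d (h a) < d a := by
    intro a ha ha'
    have h1 := hp.reaches a ha
    have h2 := hp.reaches (h a) (hp.succ_mem ha ha')
    simp only [d, dif_pos h1, dif_pos h2]
    have h3 := Nat.find_spec h1
    have h4 : Nat.find h1 ≠ 0 := fun h0 => by rw [h0] at h3; exact ha' h3
    obtain ⟨k, hk⟩ := Nat.exists_eq_succ_of_ne_zero h4
    rw [hk] at h3 ⊢
    exact Nat.lt_succ_of_le (Nat.find_min' h2 h3)
  let r : V → V → Prop := fun a b => d b ≤ d a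
  have : Std.Total r := ⟨fun a b => le_total _ _⟩
  have : IsTrans V r := ⟨fun a b c hab hbc => le_trans hbc hab⟩
  have hperm := List.perm_insertionSort r Γ.verts.toList
  refine ⟨Γ.verts.toList.insertionSort r, ⟨hperm.nodup_iff.2 Γ.verts.nodup_toList,
    fun a => by rw [hperm.mem_iff, Finset.mem_toList], ?_⟩⟩
  refine (List.pairwise_insertionSort r _).imp_of_mem fun {a b} ha hb hab => ?_
  rintro ⟨hb', rfl⟩
  rw [hperm.mem_iff, Finset.mem_toList] at hb
  exact absurd (hd b hb hb') (not_lt.2 hab)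

theorem pathSum_congr {W : Type u} {Δ : OpenGraph V} (hv : Γ.verts = Δ.verts)
    (hO : Γ.outputs = Δ.outputs) (hG : Γ.graph = Δ.graph) (I : Finset V) (wire : V → W)
    (α : V → ℝ) (ψ : State I) : Γ.pathSum I wire α ψ = Δ.pathSum I wire α ψ := by
  funext x
  simp only [pathSum, amplitude, hv, hO, hG]

end OpenGraph

namespace MatchingGFlow

variable {V : Type u} [Fintype V] {Γ : OpenGraph V} (M : MatchingGFlow Γ)

/-- Only path edges into a rewired `h(v_j)` are at risk. By injectivity such an edge comes from
`v_j`, and `v_j` is among the new neighbours. -/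
theorem seq_isPathCover {h : V → V} (hp : Γ.IsPathCover h) (hM : ∀ i, h (M.v i) = M.h i) {k : ℕ}
    (hk : k ≤ M.n) : (M.seq k).IsPathCover h := by
  refine ⟨?_, ?_, ?_, ?_⟩
  · rw [seq_verts, seq_outputs]
    intro a ha ha'
    have hadj := hp.adj a ha ha'
    by_cases hO : h a ∈ Γ.outputs
    · by_cases hj : ∃ j : Fin M.n, j.1 < k ∧ M.h j = h a
      · obtain ⟨j, hjk, hj⟩ := hj
        rw [← hM j] at hj
        have := hp.inj _ (M.v_mem j) (M.v_not_output j) a ha ha' hj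
        subst this
        rw [hM, SimpleGraph.adj_comm, M.seq_adj_h hk hjk]
        exact M.mem_oddGV.2 (Or.inl rfl)
      · push Not at hj
        rw [SimpleGraph.adj_comm, M.seq_adj_of_forall_ne hk hO hj]
        exact ⟨hadj.symm, fun h' => ha' h'.2⟩
    · exact (M.seq_adj_of_not_outputs hk ha' hO).2 hadj
  · rw [seq_verts, seq_outputs, seq_inputs]
    exact hp.not_input
  · rw [seq_verts, seq_outputs]
    exact hp.inj
  · rw [seq_verts, seq_outputs]
    exact hp.reaches

theorem seq_isSchedule {h : V → V} {L : List V} (hL : Γ.IsSchedule h L) (k : ℕ) :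
    (M.seq k).IsSchedule h L :=
  ⟨hL.nodup, by rw [seq_verts]; exact hL.mem_iff, by rw [seq_outputs]; exact hL.order⟩

theorem seq_isWiring {W : Type u} {h : V → V} {wire : V → W} {out : W → V}
    (hw : Γ.IsWiring h wire out) (k : ℕ) : (M.seq k).IsWiring h wire out := by
  refine ⟨?_, hw.wire_out, ?_, ?_⟩
  · rw [seq_outputs]; exact hw.out_mem
  · rw [seq_outputs]; exact hw.out_wire
  · rw [seq_verts, seq_outputs]; exact hw.wire_succ

/-- The targets of the gates `CX` with control `h(v_i)`. -/
theorem mem_targets {i : Fin M.n} {a : V} :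
    a ∈ symmDiff (M.gV i) {M.h i} ↔ a ∈ M.gV i ∧ a ≠ M.h i := by
  have := M.h_mem i
  rw [Finset.mem_symmDiff, Finset.mem_singleton]
  constructor
  · rintro (h | ⟨rfl, h⟩)
    · exact h
    · exact absurd this h
  · exact fun h => Or.inl h

/-- The action of the gates `CX_{h(v_i); g_V(v_i) ⊕ h(v_i)}` on basis states. -/
noncomputable def shift (i : Fin M.n) (z : V → Fin 2) : V → Fin 2 := fun a =>
  if a ∈ symmDiff (M.gV i) {M.h i} then z a + z (M.h i) else z a

theorem shift_h (i : Fin M.n) (z : V → Fin 2) : M.shift i z (M.h i) = z (M.h i) := by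
  rw [shift, if_neg]
  rw [mem_targets]
  exact fun h => h.2 rfl

theorem shift_of_not_mem {i : Fin M.n} {z : V → Fin 2} {a : V} (ha : a ∉ M.gV i) :
    M.shift i z a = z a := by
  rw [shift, if_neg]
  rw [mem_targets]
  exact fun h => ha h.1

theorem shift_of_not_output {i : Fin M.n} {z : V → Fin 2} {a : V} (ha : a ∉ Γ.outputs) :
    M.shift i z a = z a :=
  M.shift_of_not_mem fun h => ha (Finset.mem_sdiff.1 (M.gV_subset i h)).1

theorem shift_shift (i : Fin M.n) (z : V → Fin 2) : M.shift i (M.shift i z) = z := by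
  funext a
  conv_lhs => rw [shift]
  rw [shift_h]
  split_ifs with h
  · rw [shift, if_pos h, fin_two_add_add_cancel]
  · rw [shift, if_neg h]

/-- The controlled stabilizer identity for graph states. -/
theorem graphSign_seq (i : Fin M.n) (z : V → Fin 2) :
    graphSign (M.seq i).graph z = graphSign (M.seq (i + 1)).graph (M.shift i z) := by
  have hi : i.1 ≤ M.n := i.2.le
  have hi' : i.1 + 1 ≤ M.n := i.2
  rw [graphSign_split _ Γ.outputs (fun a ha b hb => M.seq_not_adj_outputs hi ha hb),
    graphSign_split _ Γ.outputs (fun a ha b hb => M.seq_not_adj_outputs hi' ha hb)]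
  congr 1
  · refine Finset.prod_congr ?_ ?_
    · ext e
      simp only [Finset.mem_filter, SimpleGraph.mem_edgeFinset]
      refine and_congr_left fun he => ?_
      induction e with
      | _ a b =>
      simp only [Sym2.mem_iff, forall_eq_or_imp, forall_eq] at he
      rw [SimpleGraph.mem_edgeSet, SimpleGraph.mem_edgeSet,
        M.seq_adj_of_not_outputs hi he.1 he.2, M.seq_adj_of_not_outputs hi' he.1 he.2]
    · intro e he
      have he := (Finset.mem_filter.1 he).2
      induction e with
      | _ a b =>
      simp only [Sym2.mem_iff, forall_eq_or_imp, forall_eq] at he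
      rw [edgeSign_mk, edgeSign_mk, M.shift_of_not_output he.1, M.shift_of_not_output he.2]
  · set r := M.h i with hr
    have hrO : r ∈ Γ.outputs := M.h_mem_output i
    set f : V → ℂ := fun b => sgn (z r * z b) with hf
    let H : V → ℂ := fun a => ∏ b ∈ Finset.univ.filter ((M.seq i).graph.Adj a), f b
    have hff : ∀ b, f b * f b = 1 := fun b => sgn_mul_self _
    have hHH : ∀ a, H a * H a = 1 := by
      intro a
      rw [← Finset.prod_mul_distrib]
      exact Finset.prod_eq_one fun b _ => hff b
    -- By the echelon property no vertex of `g_V(v_i)` has been rewired before step `i`, so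
    -- neighbourhoods may be taken in `G'`, where the odd neighbourhood is defined.
    have hodd : ∏ a ∈ M.gV i, H a = ∏ b ∈ M.oddGV i, f b := by
      rw [oddGV, ← prod_odd _ _ _ hff]
      refine Finset.prod_congr rfl fun a ha => Finset.prod_congr ?_ fun _ _ => rfl
      refine Finset.filter_congr fun b _ => ?_
      refine M.seq_adj_of_forall_ne hi (Finset.mem_sdiff.1 (M.gV_subset i ha)).1 fun j hj hja => ?_
      exact M.h_not_mem_gV (i := i) (k := j) hj (hja ▸ ha)
    have hNr : Finset.univ.filter ((M.seq (i + 1)).graph.Adj r) = M.oddGV i := by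
      ext b
      simp [hr, M.seq_succ_adj_h]
    have hN : ∀ a ∈ Γ.outputs, a ≠ r → Finset.univ.filter ((M.seq (i + 1)).graph.Adj a)
        = Finset.univ.filter ((M.seq i).graph.Adj a) := by
      intro a ha hne
      exact Finset.filter_congr fun b _ => M.seq_succ_adj_of_ne i ha hne
    -- Adding the bit of `r` at `a ∈ g_V(v_i)` multiplies the sign of each edge `{a, b}` by `f b`,
    -- since `b` is not an output and does not move.
    have hterm : ∀ a ∈ Γ.outputs.erase r,
        ∏ b ∈ Finset.univ.filter ((M.seq (i + 1)).graph.Adj a),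
          sgn (M.shift i z a * M.shift i z b)
        = (∏ b ∈ Finset.univ.filter ((M.seq i).graph.Adj a), sgn (z a * z b))
          * if a ∈ M.gV i then H a else 1 := by
      intro a ha
      obtain ⟨hne, haO⟩ := Finset.mem_erase.1 ha
      rw [hN a haO hne]
      have hb : ∀ b ∈ Finset.univ.filter ((M.seq i).graph.Adj a),
          M.shift i z b = z b := by
        intro b hb
        exact M.shift_of_not_output fun hbO =>
          M.seq_not_adj_outputs hi haO hbO (Finset.mem_filter.1 hb).2
      split_ifs with hg
      · rw [← Finset.prod_mul_distrib]
        refine Finset.prod_congr rfl fun b hb' => ?_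
        rw [hb b hb', shift, if_pos (M.mem_targets.2 ⟨hg, hne⟩), fin_two_add_mul, sgn_add]
      · rw [mul_one]
        refine Finset.prod_congr rfl fun b hb' => ?_
        rw [hb b hb', M.shift_of_not_mem hg]
    rw [← Finset.mul_prod_erase _ _ hrO, ← Finset.mul_prod_erase _ _ hrO,
      Finset.prod_congr rfl hterm, Finset.prod_mul_distrib, hNr]
    have h1 : ∏ b ∈ M.oddGV i, sgn (M.shift i z r * M.shift i z b) = ∏ b ∈ M.oddGV i, f b := by
      refine Finset.prod_congr rfl fun b hb => ?_
      rw [M.shift_h, M.shift_of_not_output (M.oddGV_not_output hb)]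
    have h2 : ∏ a ∈ Γ.outputs.erase r, (if a ∈ M.gV i then H a else 1)
        = ∏ a ∈ (M.gV i).erase r, H a := by
      rw [← Finset.prod_filter]
      refine Finset.prod_congr ?_ fun _ _ => rfl
      ext a
      simp only [Finset.mem_filter, Finset.mem_erase]
      constructor
      · exact fun h => ⟨h.1.1, h.2⟩
      · exact fun h => ⟨⟨h.1, (Finset.mem_sdiff.1 (M.gV_subset i h.2)).1⟩, h.2⟩
    have h3 : (∏ a ∈ (M.gV i).erase r, H a) * ∏ a ∈ (M.gV i).erase r, H a = 1 := by
      rw [← Finset.prod_mul_distrib]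
      exact Finset.prod_eq_one fun b _ => hHH b
    have hrg : r ∈ M.gV i := M.h_mem i
    rw [h1, h2, ← hodd, ← Finset.mul_prod_erase _ _ hrg]
    change H r * _ = _
    -- Let `B` be the product of `H` over `g_V(v_i)` without `r`. The new edges at `r` give `H r *
    -- B`, the shifted bits give another `B`, and `B * B = 1`.
    linear_combination (-(H r * ∏ a ∈ Γ.outputs.erase r,
      ∏ b ∈ Finset.univ.filter ((M.seq i).graph.Adj a), sgn (z a * z b))) * h3

theorem graphSign_seq' (i : Fin M.n) (z : V → Fin 2) :
    graphSign (M.seq (i + 1)).graph z = graphSign (M.seq i).graph (M.shift i z) := by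
  rw [graphSign_seq, shift_shift]

theorem graphState_apply (G : SimpleGraph V) (I : Finset V) (ψ : State I) (z : V → Fin 2) :
    graphState G I ψ z
      = graphSign G z * (plusAmp ^ freshWires I (id : V → V) * ψ fun i => z i) := by
  rw [graphState, LinearMap.comp_apply, run_czEdges, prepareInput_apply]
  rfl

theorem graphState_seq (i : Fin M.n) : graphState (M.seq i).graph Γ.inputs
    = run (M.cx i) ∘ₗ graphState (M.seq (i + 1)).graph Γ.inputs := by
  refine LinearMap.ext fun ψ => funext fun z => ?_
  rw [LinearMap.comp_apply, cx, run_cxStar _ _ (fun h => (M.mem_targets.1 h).2 rfl)]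
  rw [graphState_apply]
  refine Eq.trans ?_ (graphState_apply _ _ ψ (M.shift i z)).symm
  rw [graphSign_seq]
  congr 3
  funext j
  exact (M.shift_of_not_mem fun h => (Finset.mem_sdiff.1 (M.gV_subset i h)).2 j.2).symm

/-- On the path sum the `CX` gates are the substitution `shift i`. It moves only outputs that are
not inputs, so phases and input amplitude are unaffected. Since it is an involution, the hypothesis
`hkl` is available in both directions between steps `i` and `i + 1`. -/
theorem run_cx_pathSum {W : Type u} {h : V → V} {wire : V → W} {out : W → V}
    (hw : Γ.IsWiring h wire out) {I : Finset V} (hI : I ⊆ Γ.inputs) (α : V → ℝ) (ψ : State I)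
    (i : Fin M.n) {k l : ℕ}
    (hkl : ∀ z, graphSign (M.seq k).graph z = graphSign (M.seq l).graph (M.shift i z)) :
    run ((M.cx i).map (Gate.map wire)) ((M.seq l).pathSum I wire α ψ)
      = (M.seq k).pathSum I wire α ψ := by
  funext x
  have hT : ∀ a ∈ symmDiff (M.gV i) {M.h i}, a ∈ Γ.outputs := fun a ha =>
    (Finset.mem_sdiff.1 (M.gV_subset i (M.mem_targets.1 ha).1)).1
  have hinj : ∀ a ∈ Γ.outputs, ∀ b ∈ Γ.outputs, wire a = wire b → a = b := fun a ha b hb hab => by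
    rw [← hw.out_wire a ha, hab, hw.out_wire b hb]
  rw [cx, run_cxStar_map wire _ _ (fun a ha b hb => hinj a (hT a ha) b (hT b hb))
    (fun a ha hab => (M.mem_targets.1 ha).2 (hinj a (hT a ha) _ (M.h_mem_output i) hab))]
  have hex : ∀ o ∈ Γ.outputs, (∃ a ∈ symmDiff (M.gV i) {M.h i}, wire a = wire o)
      ↔ o ∈ symmDiff (M.gV i) {M.h i} := by
    intro o ho
    constructor
    · rintro ⟨a, ha, hao⟩
      rwa [← hinj a (hT a ha) o ho hao]
    · exact fun h => ⟨o, h, rfl⟩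
  have hr : M.h i ∉ symmDiff (M.gV i) {M.h i} := fun h => (M.mem_targets.1 h).2 rfl
  simp only [OpenGraph.pathSum]
  refine Finset.sum_nbij' (M.shift i) (M.shift i) ?_ ?_ (fun z _ => M.shift_shift i z)
    (fun z _ => M.shift_shift i z) ?_
  · intro z hz
    simp only [mem_assignments, seq_outputs, seq_verts] at hz ⊢
    refine ⟨fun o ho => ?_, fun a ha ha' => ?_⟩
    · have h1 := hz.1 o ho
      have h2 := hz.1 _ (M.h_mem_output i)
      simp only [hex _ ho, hex _ (M.h_mem_output i), hr, if_false] at h1 h2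
      rw [shift, h1, h2]
      split_ifs
      · exact fin_two_add_add_cancel _ _
      · rfl
    · rw [M.shift_of_not_output ha]
      exact hz.2 a ha ha'
  · intro z hz
    simp only [mem_assignments, seq_outputs, seq_verts] at hz ⊢
    refine ⟨fun o ho => ?_, fun a ha ha' => ?_⟩
    · simp only [hex _ ho]
      rw [shift, hz.1 o ho, hz.1 _ (M.h_mem_output i)]
    · rw [M.shift_of_not_output ha]
      exact hz.2 a ha ha'
  · intro z _
    simp only [OpenGraph.amplitude, hkl, shift_shift, seq_outputs, seq_verts]
    have h1 : (fun j : I => z j) = fun j : I => M.shift i z j := funext fun j =>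
      (M.shift_of_not_mem fun h => (Finset.mem_sdiff.1 (M.gV_subset i h)).2 (hI j.2)).symm
    have h2 : ∏ a ∈ Γ.verts \ Γ.outputs, phase (α a) (z a)
        = ∏ a ∈ Γ.verts \ Γ.outputs, phase (α a) (M.shift i z a) :=
      Finset.prod_congr rfl fun a ha => by
        rw [M.shift_of_not_output (Finset.mem_sdiff.1 ha).2]
    rw [h1, h2]

end MatchingGFlow

/-- Telescoping: the block of the last index acts first and lowers the state from `n` to `n - 1`,
each block at the cost of one factor `c`. -/
theorem run_finRange_reverse {W : Type u} (c : ℂ) (n : ℕ) (G : Fin n → List (Gate W))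
    (P : ℕ → State W) (h : ∀ i : Fin n, run (G i) (P (i + 1)) = c • P i) :
    run ((List.finRange n).reverse.flatMap G) (P n) = c ^ n • P 0 := by
  induction n with
  | zero => simp [run_nil]
  | succ n ih =>
    rw [List.finRange_succ_last, List.reverse_append, List.reverse_singleton,
      List.singleton_append, List.flatMap_cons, run_append]
    have h1 := h (Fin.last n)
    rw [Fin.val_last] at h1
    rw [h1, map_smul, ← List.map_reverse, List.flatMap_map]
    rw [ih (fun i => G i.castSucc) fun i => h i.castSucc, smul_smul, pow_succ']

theorem graphSign_outputEdges {V : Type u} [Fintype V] (Γ : OpenGraph V) (z : V → Fin 2) :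
    graphSign Γ.graph z
      = (∏ e ∈ Γ.outputEdges, edgeSign z e) * graphSign Γ.removeOutputEdges.graph z := by
  rw [graphSign, ← Finset.prod_filter_mul_prod_filter_not _ (fun e => ∀ a ∈ e, a ∈ Γ.outputs)]
  congr 1
  refine Finset.prod_congr ?_ fun _ _ => rfl
  ext e
  simp only [Finset.mem_filter, SimpleGraph.mem_edgeFinset]
  induction e with
  | _ a b =>
  simp only [Sym2.mem_iff, forall_eq_or_imp, forall_eq]
  rfl

theorem run_outputEdges_pathSum {V : Type u} [Fintype V] (Γ : OpenGraph V) {W : Type u}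
    (I : Finset V) (wire : V → W) (α : V → ℝ) (ψ : State I) :
    run ((czEdges Γ.outputEdges).map (Gate.map wire)) (Γ.removeOutputEdges.pathSum I wire α ψ)
      = Γ.pathSum I wire α ψ := by
  funext x
  rw [run_czEdges_map, OpenGraph.pathSum, OpenGraph.pathSum, Finset.mul_sum]
  refine Finset.sum_congr rfl fun z hz => ?_
  rw [OpenGraph.amplitude, OpenGraph.amplitude, graphSign_outputEdges Γ]
  have h1 : ∏ e ∈ Γ.outputEdges, edgeSign (x ∘ wire) e = ∏ e ∈ Γ.outputEdges, edgeSign z e := by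
    refine Finset.prod_congr rfl fun e he => ?_
    have he := (Finset.mem_filter.1 he).2
    induction e with
    | _ a b =>
    simp only [Sym2.mem_iff, forall_eq_or_imp, forall_eq] at he
    have hz := ((mem_assignments _ _).1 hz).1
    rw [edgeSign_mk, edgeSign_mk, hz a he.1, hz b he.2]
    rfl
  rw [h1]
  simp only [OpenGraph.removeOutputEdges]
  ring

namespace MatchingGFlow

variable {V : Type u} [Fintype V] {Γ : OpenGraph V} (M : MatchingGFlow Γ)

theorem run_uO_pathSum {W : Type u} {h : V → V} {wire : V → W} {out : W → V}
    (hw : Γ.IsWiring h wire out) {I : Finset V} (hI : I ⊆ Γ.inputs) (α : V → ℝ) (ψ : State I) :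
    run (M.uO.map (Gate.map wire)) ((M.seq M.n).pathSum I wire α ψ) = Γ.pathSum I wire α ψ := by
  have h1 := run_finRange_reverse 1 M.n (fun i => (M.cx i).map (Gate.map wire))
    (fun k => (M.seq k).pathSum I wire α ψ) fun i => by
      rw [one_smul]
      exact M.run_cx_pathSum hw hI α ψ i (M.graphSign_seq i)
  rw [one_pow, one_smul] at h1
  rw [uO, List.map_append, run_append, cxAll, List.map_flatMap, h1, seq_zero,
    run_outputEdges_pathSum]

end MatchingGFlow

/-! ## The ordinary circuit of the last layer -/

namespace OpenGraph

variable {V : Type u} [Fintype V]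

/-- Undoing the measurement of `v` whose successor `r` has the neighbours `D`. -/
theorem run_step_pathSum {W : Type u} {Δ Δ' : OpenGraph V} {r v : V} {D : Finset V}
    {wire : V → W} {I : Finset V} (hverts : ∀ a, a ∈ Δ'.verts ↔ a ∈ Δ.verts ∧ a ≠ r)
    (hr : r ∈ Δ.outputs) (hv : v ∈ Δ.verts) (hvO : v ∉ Δ.outputs)
    (hout : ∀ a, a ∈ Δ'.outputs ↔ a = v ∨ (a ∈ Δ.outputs ∧ a ≠ r))
    (hadj : ∀ a b, Δ'.graph.Adj a b ↔ Δ.graph.Adj a b ∧ a ≠ r ∧ b ≠ r)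
    (hD : ∀ b, Δ.graph.Adj r b ↔ b ∈ D) (hvD : v ∈ D) (hDO : ∀ b ∈ D, b ≠ v → b ∈ Δ.outputs)
    (hwire : wire v = wire r) (hinj : ∀ o ∈ Δ.outputs, wire o = wire r → o = r) (hrI : r ∉ I)
    (α : V → ℝ) (ψ : State I) :
    run (((Gate.J (α v) v) :: czStar v (D.erase v)).map (Gate.map wire))
        (Δ'.pathSum I wire α ψ)
      = plusAmp • Δ.pathSum I wire α ψ := by
  have hvr : v ≠ r := fun h => hvO (h ▸ hr)
  have hrO' : r ∉ Δ'.outputs := fun h => by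
    rcases (hout r).1 h with h | h
    · exact hvr h.symm
    · exact h.2 rfl
  have hrD : r ∉ D := fun h => Δ.graph.irrefl ((hD r).2 h)
  funext x
  rw [List.map_cons, run_cons, run_czStar_map, Gate.map, J_op_apply, Pi.smul_apply, smul_eq_mul]
  simp only [pathSum]
  simp only [Finset.mul_sum]
  rw [Finset.sum_sigma']
  -- The summation bit of the `J` gate is the bit of `v`, an output in `Δ'` but summed over in `Δ`.
  -- The final bit of the shared wire becomes the bit of `r`, which is absent in `Δ'` and so pinned
  -- to `0` there.
  refine Finset.sum_nbij' (fun p => Function.update p.2 r (x (wire r)))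
    (fun z => ⟨z v, Function.update z r 0⟩) ?_ ?_ ?_ ?_ ?_
  · rintro ⟨b, z⟩ hz
    simp only [Finset.mem_sigma, Finset.mem_univ, true_and, mem_assignments] at hz ⊢
    refine ⟨fun o ho => ?_, fun a ha ha' => ?_⟩
    · by_cases hor : o = r
      · rw [hor, Function.update_self]
      · rw [Function.update_of_ne hor, hz.1 o ((hout o).2 (Or.inr ⟨ho, hor⟩)),
          Function.update_of_ne]
        exact fun h => hor (hinj o ho (h.trans hwire))
    · have har : a ≠ r := fun h => ha (h ▸ hr)
      rw [Function.update_of_ne har]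
      refine hz.2 a (fun h => ?_) fun h => ha' ((hverts a).1 h).1
      rcases (hout a).1 h with h | h
      · exact ha' (h ▸ hv)
      · exact ha h.1
  · intro z hz
    simp only [Finset.mem_sigma, Finset.mem_univ, true_and, mem_assignments] at hz ⊢
    refine ⟨fun o ho => ?_, fun a ha ha' => ?_⟩
    · rcases (hout o).1 ho with rfl | ⟨ho', hor⟩
      · rw [Function.update_of_ne hvr, Function.update_self]
      · rw [Function.update_of_ne hor, hz.1 o ho', Function.update_of_ne]
        exact fun h => hor (hinj o ho' (h.trans hwire))
    · by_cases har : a = r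
      · rw [har, Function.update_self]
      · rw [Function.update_of_ne har]
        exact hz.2 a (fun h => ha ((hout a).2 (Or.inr ⟨h, har⟩)))
          fun h => ha' ((hverts a).2 ⟨h, har⟩)
  · rintro ⟨b, z⟩ hz
    simp only [Finset.mem_sigma, Finset.mem_univ, true_and, mem_assignments] at hz
    have h1 : z r = 0 := hz.2 r hrO' fun h => ((hverts r).1 h).2 rfl
    have h2 : z v = b := by
      rw [hz.1 v ((hout v).2 (Or.inl rfl)), Function.update_self]
    simp only [Function.update_of_ne hvr, h2, Function.update_idem]
    rw [← h1, Function.update_eq_self]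
  · intro z hz
    rw [mem_assignments] at hz
    simp only [Function.update_idem]
    rw [← hz.1 r hr, Function.update_eq_self]
  · rintro ⟨b, z⟩ hz
    simp only [Finset.mem_sigma, Finset.mem_univ, true_and, mem_assignments] at hz
    have hzv : z v = b := by
      rw [hz.1 v ((hout v).2 (Or.inl rfl)), Function.update_self]
    simp only [amplitude]
    have e1 : (fun i : I => Function.update z r (x (wire r)) i) = fun i : I => z i := by
      funext i
      rw [Function.update_of_ne]
      rintro h
      exact hrI (h ▸ i.2)
    have e2 : ∏ a ∈ Δ.verts \ Δ.outputs, phase (α a) (Function.update z r (x (wire r)) a)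
        = phase (α v) b * ∏ a ∈ Δ'.verts \ Δ'.outputs, phase (α a) (z a) := by
      have hs : Δ.verts \ Δ.outputs = insert v (Δ'.verts \ Δ'.outputs) := by
        ext a
        simp only [Finset.mem_sdiff, Finset.mem_insert, hverts, hout]
        by_cases hav : a = v
        · subst hav; simp [hv, hvO]
        · by_cases har : a = r
          · subst har; simp [hav, hr]
          · simp [hav, har]
      rw [hs, Finset.prod_insert, Function.update_of_ne hvr, hzv]
      · congr 1
        refine Finset.prod_congr rfl fun a ha => ?_
        rw [Function.update_of_ne]
        exact ((hverts a).1 (Finset.mem_sdiff.1 ha).1).2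
      · intro h
        exact (Finset.mem_sdiff.1 h).2 ((hout v).2 (Or.inl rfl))
    -- The edges at `r` are split off: the one to `v` is the sign of the `J` matrix, the others are
    -- the `CZ` gates (`e4`).
    have e3 : graphSign Δ.graph (Function.update z r (x (wire r)))
        = graphSign Δ'.graph z * ∏ b ∈ D, sgn (x (wire r) * z b) := by
      rw [graphSign_split Δ.graph {r}]
      · congr 1
        · refine Finset.prod_congr ?_ ?_
          · ext e
            simp only [Finset.mem_filter, SimpleGraph.mem_edgeFinset]
            induction e with
            | _ a b =>
            simp [hadj]
          · intro e he
            rw [SimpleGraph.mem_edgeFinset] at he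
            induction e with
            | _ a b =>
            have := (hadj a b).1 he
            rw [edgeSign_mk, edgeSign_mk, Function.update_of_ne this.2.1,
              Function.update_of_ne this.2.2]
        · rw [Finset.prod_singleton, Function.update_self]
          refine Finset.prod_congr ?_ fun b hb => ?_
          · ext b; simp [hD]
          · rw [Function.update_of_ne]
            rintro rfl
            exact hrD hb
      · intro a ha b hb
        rw [Finset.mem_singleton.1 ha, Finset.mem_singleton.1 hb]
        exact Δ.graph.irrefl
    have e4 : ∏ c ∈ D.erase v, sgn (x (wire v) * x (wire c))
        = ∏ c ∈ D.erase v, sgn (x (wire r) * z c) := by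
      refine Finset.prod_congr rfl fun c hc => ?_
      obtain ⟨hcv, hcD⟩ := Finset.mem_erase.1 hc
      have hcr : c ≠ r := fun h => hrD (h ▸ hcD)
      have hcO := hDO c hcD hcv
      rw [hwire, hz.1 c ((hout c).2 (Or.inr ⟨hcO, hcr⟩)), Function.update_of_ne]
      exact fun h => hcr (hinj c hcO (h.trans hwire))
    rw [e1, e2, e3, e4, ← Finset.mul_prod_erase D _ hvD, hzv, hwire]
    ring

end OpenGraph

namespace MatchingGFlow

variable {V : Type u} [Fintype V] {Γ : OpenGraph V} (M : MatchingGFlow Γ)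

/-- The vertices `h(v_i)` with `i < k` (counted from `0`). -/
noncomputable def Rpart (k : ℕ) : Finset V :=
  (Finset.univ.filter fun i : Fin M.n => i.1 < k).image M.h

theorem mem_Rpart {k : ℕ} {a : V} : a ∈ M.Rpart k ↔ ∃ i : Fin M.n, i.1 < k ∧ M.h i = a := by
  simp [Rpart]

theorem h_mem_Rpart {k : ℕ} {i : Fin M.n} : M.h i ∈ M.Rpart k ↔ i.1 < k := by
  rw [mem_Rpart]
  exact ⟨fun ⟨j, hj, hji⟩ => M.h_injective hji ▸ hj, fun h => ⟨i, h, rfl⟩⟩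

theorem Rpart_subset {k : ℕ} : M.Rpart k ⊆ Γ.outputs := by
  intro a ha
  obtain ⟨i, -, rfl⟩ := M.mem_Rpart.1 ha
  exact M.h_mem_output i

/-- The open graphs between `G_n` and the reduced open graph: the vertices `h(v_i)`, `i < k`, are
deleted, and the vertices `v_i`, `i < k`, are outputs. -/
noncomputable def interm (k : ℕ) : OpenGraph V where
  verts := Γ.verts \ M.Rpart k
  graph :=
    { Adj := fun a b => (M.seq M.n).graph.Adj a b ∧ a ∉ M.Rpart k ∧ b ∉ M.Rpart k
      symm := ⟨fun _ _ h => ⟨h.1.symm, h.2.2, h.2.1⟩⟩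
      loopless := ⟨fun a h => (M.seq M.n).graph.loopless.irrefl a h.1⟩ }
  inputs := Γ.inputs \ M.Rpart k
  outputs := ((Finset.univ.filter fun i : Fin M.n => i.1 < k).image M.v)
    ∪ (Γ.outputs \ M.Rpart k)
  adj_mem := fun a b h => Finset.mem_sdiff.mpr
    ⟨M.seq_verts M.n ▸ (M.seq M.n).adj_mem a b h.1, h.2.1⟩
  inputs_subset := Finset.sdiff_subset_sdiff Γ.inputs_subset (Finset.Subset.refl _)
  outputs_subset := by
    refine Finset.union_subset ?_ (Finset.sdiff_subset_sdiff Γ.outputs_subset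
      (Finset.Subset.refl _))
    intro a ha
    obtain ⟨i, -, rfl⟩ := Finset.mem_image.1 ha
    exact Finset.mem_sdiff.2 ⟨M.v_mem i, fun h => M.v_not_output i (M.Rpart_subset h)⟩

theorem mem_interm_outputs {k : ℕ} {a : V} : a ∈ (M.interm k).outputs ↔
    (∃ i : Fin M.n, i.1 < k ∧ M.v i = a) ∨ (a ∈ Γ.outputs ∧ a ∉ M.Rpart k) := by
  simp [interm]

theorem interm_adj {k : ℕ} {a b : V} : (M.interm k).graph.Adj a b ↔
    (M.seq M.n).graph.Adj a b ∧ a ∉ M.Rpart k ∧ b ∉ M.Rpart k := Iff.rfl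

theorem mem_interm_verts {k : ℕ} {a : V} : a ∈ (M.interm k).verts ↔
    a ∈ Γ.verts ∧ a ∉ M.Rpart k := Finset.mem_sdiff

theorem mem_Rpart_succ {i : Fin M.n} {a : V} :
    a ∈ M.Rpart (i + 1) ↔ a ∈ M.Rpart i ∨ a = M.h i := by
  simp only [mem_Rpart]
  constructor
  · rintro ⟨j, hj, rfl⟩
    rcases Nat.lt_succ_iff_lt_or_eq.1 hj with h | h
    · exact Or.inl ⟨j, h, rfl⟩
    · exact Or.inr (by rw [Fin.ext h])
  · rintro (⟨j, hj, rfl⟩ | rfl)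
    · exact ⟨j, by omega, rfl⟩
    · exact ⟨i, by omega, rfl⟩

/-- Telescoping through `interm`. When `v_i` is treated, the other neighbours of `h(v_i)` are `v_k`
with `k < i`, already outputs of `interm i`, so the `CZ` gates act on the current ends of their
wires. This is why the order runs from `v_n` down to `v_1`. -/
theorem run_uspt_pathSum {W : Type u} {h : V → V} {wire : V → W} {out : W → V}
    (hw : Γ.IsWiring h wire out) (hM : ∀ i, h (M.v i) = M.h i) {I : Finset V}
    (hI : I ⊆ Γ.inputs) (α : V → ℝ) (ψ : State I) :
    run ((M.uspt α).map (Gate.map wire)) (M.reduced.pathSum I wire α ψ)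
      = plusAmp ^ M.n • (M.seq M.n).pathSum I wire α ψ := by
  have hinj : ∀ a ∈ Γ.outputs, ∀ b ∈ Γ.outputs, wire a = wire b → a = b := fun a ha b hb hab => by
    rw [← hw.out_wire a ha, hab, hw.out_wire b hb]
  have hwv : ∀ i, wire (M.v i) = wire (M.h i) := fun i => by
    rw [← hM, hw.wire_succ _ (M.v_mem i) (M.v_not_output i)]
  have h1 := run_finRange_reverse plusAmp M.n
    (fun i => (Gate.J (α (M.v i)) (M.v i) ::
      czStar (M.v i) ((M.oddGV i).erase (M.v i))).map (Gate.map wire))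
    (fun k => (M.interm k).pathSum I wire α ψ) fun i => by
      refine OpenGraph.run_step_pathSum (r := M.h i) ?_ ?_ ?_ ?_ ?_ ?_ ?_ ?_ ?_ ?_ ?_ ?_ α ψ
      · intro a
        rw [mem_interm_verts, mem_interm_verts, mem_Rpart_succ]
        tauto
      · rw [mem_interm_outputs, h_mem_Rpart]
        exact Or.inr ⟨M.h_mem_output i, lt_irrefl _⟩
      · rw [mem_interm_verts]
        exact ⟨M.v_mem i, fun h => M.v_not_output i (M.Rpart_subset h)⟩
      · rw [mem_interm_outputs]
        rintro (⟨j, hj, hji⟩ | h)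
        · rw [M.v_injective hji] at hj
          exact lt_irrefl _ hj
        · exact M.v_not_output i h.1
      · intro a
        rw [mem_interm_outputs, mem_interm_outputs, mem_Rpart_succ]
        have e : (∃ j : Fin M.n, j.1 < i.1 + 1 ∧ M.v j = a)
            ↔ (∃ j : Fin M.n, j.1 < i.1 ∧ M.v j = a) ∨ a = M.v i := by
          constructor
          · rintro ⟨j, hj, rfl⟩
            rcases Nat.lt_succ_iff_lt_or_eq.1 hj with h | h
            · exact Or.inl ⟨j, h, rfl⟩
            · exact Or.inr (by rw [Fin.ext h])
          · rintro (⟨j, hj, rfl⟩ | rfl)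
            · exact ⟨j, by omega, rfl⟩
            · exact ⟨i, by omega, rfl⟩
        rw [e]
        have e' : (∃ j : Fin M.n, j.1 < i.1 ∧ M.v j = a) → a ≠ M.h i := by
          rintro ⟨j, -, rfl⟩ h
          exact M.v_not_output j (h ▸ M.h_mem_output i)
        generalize (∃ j : Fin M.n, j.1 < i.1 ∧ M.v j = a) = p at e' ⊢
        tauto
      · intro a b
        rw [interm_adj, interm_adj, mem_Rpart_succ, mem_Rpart_succ]
        tauto
      · intro b
        rw [interm_adj, M.seq_adj_h le_rfl i.2, h_mem_Rpart]
        refine ⟨fun h => h.1, fun h => ⟨h, lt_irrefl _, fun h' => ?_⟩⟩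
        exact M.oddGV_not_output h (M.Rpart_subset h')
      · exact M.mem_oddGV.2 (Or.inl rfl)
      · intro b hb hbv
        rw [mem_interm_outputs]
        obtain ⟨j, hj, rfl⟩ := M.exists_of_mem_oddGV hb
        refine Or.inl ⟨j, ?_, rfl⟩
        exact lt_of_le_of_ne hj fun h => hbv (congrArg M.v (Fin.ext h))
      · exact hwv i
      · intro o ho hoi
        rcases M.mem_interm_outputs.1 ho with ⟨j, hj, rfl⟩ | ho
        · rw [hwv] at hoi
          have := M.h_injective (hinj _ (M.h_mem_output j) _ (M.h_mem_output i) hoi)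
          rw [this] at hj
          exact absurd hj (lt_irrefl _)
        · exact hinj _ ho.1 _ (M.h_mem_output i) hoi
      · exact fun h => M.h_not_input i (hI h)
  rw [uspt, List.map_flatMap]
  have hRn : M.Rpart M.n = M.R := by
    ext a
    rw [mem_Rpart, mem_R]
    exact ⟨fun ⟨i, _, h⟩ => ⟨i, h⟩, fun ⟨i, h⟩ => ⟨i, i.2, h⟩⟩
  have hR0 : M.Rpart 0 = ∅ := by
    ext a
    simp [mem_Rpart]
  have e1 : (M.interm M.n).pathSum I wire α ψ = M.reduced.pathSum I wire α ψ := by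
    refine OpenGraph.pathSum_congr ?_ ?_ ?_ I wire α ψ
    · rw [reduced_verts, ← hRn]; rfl
    · ext a
      rw [mem_interm_outputs, mem_reduced_outputs, hRn]
      exact or_congr_left ⟨fun ⟨i, _, h⟩ => ⟨i, h⟩, fun ⟨i, h⟩ => ⟨i, i.2, h⟩⟩
    · ext a b
      rw [interm_adj, hRn]; rfl
  have e2 : (M.interm 0).pathSum I wire α ψ = (M.seq M.n).pathSum I wire α ψ := by
    refine OpenGraph.pathSum_congr ?_ ?_ ?_ I wire α ψ
    · ext a
      rw [mem_interm_verts, seq_verts, hR0]; simp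
    · ext a
      rw [mem_interm_outputs, seq_outputs, hR0]; simp
    · ext a b
      rw [interm_adj, hR0]; simp
  rw [e1, e2] at h1
  exact h1

theorem reduced_isPathCover {h : V → V} (hp : Γ.IsPathCover h) (hM : ∀ i, h (M.v i) = M.h i) :
    M.reduced.IsPathCover h := by
  have hadj : ∀ a ∈ M.reduced.verts, a ∉ M.reduced.outputs → M.reduced.graph.Adj a (h a) := by
    intro a ha ha'
    obtain ⟨h1, h2, h3⟩ := M.mem_reduced_nonoutput.1 ⟨ha, ha'⟩
    rw [reduced_adj]
    refine ⟨⟨hp.adj a h1 h2, fun h' => h2 h'.1⟩, (Finset.mem_sdiff.1 ha).2, fun h' => ?_⟩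
    obtain ⟨i, hi⟩ := M.mem_R.1 h'
    rw [← hM] at hi
    exact h3 i (hp.inj _ (M.v_mem i) (M.v_not_output i) a h1 h2 hi)
  refine ⟨hadj, ?_, ?_, ?_⟩
  · intro a ha ha'
    obtain ⟨h1, h2, -⟩ := M.mem_reduced_nonoutput.1 ⟨ha, ha'⟩
    rw [reduced_inputs]
    exact hp.not_input a h1 h2
  · intro a ha ha' b hb hb'
    obtain ⟨h1, h2, -⟩ := M.mem_reduced_nonoutput.1 ⟨ha, ha'⟩
    obtain ⟨h3, h4, -⟩ := M.mem_reduced_nonoutput.1 ⟨hb, hb'⟩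
    exact hp.inj a h1 h2 b h3 h4
  -- The path of `Γ` is followed only up to its first output of the reduced graph; until then it
  -- stays in the reduced graph.
  · have key : ∀ k : ℕ, ∀ a ∈ M.reduced.verts, h^[k] a ∈ Γ.outputs →
        ∃ k' : ℕ, h^[k'] a ∈ M.reduced.outputs := by
      intro k
      induction k with
      | zero =>
        intro a ha hk
        exact ⟨0, M.mem_reduced_outputs.2 (Or.inr ⟨hk, (Finset.mem_sdiff.1 ha).2⟩)⟩
      | succ k ih =>
        intro a ha hk
        by_cases ha' : a ∈ M.reduced.outputs
        · exact ⟨0, ha'⟩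
        · obtain ⟨k', hk'⟩ := ih (h a) (M.reduced.adj_mem _ _ (hadj a ha ha').symm) hk
          exact ⟨k' + 1, hk'⟩
    intro a ha
    obtain ⟨k, hk⟩ := hp.reaches a (Finset.mem_sdiff.1 ha).1
    exact key k a ha hk

/-- The output vertices of the wires in the reduced open graph. -/
noncomputable def reducedOut {W : Type u} (wire : V → W) (out : W → V) (w : W) : V :=
  if hi : ∃ i, wire (M.v i) = w then M.v hi.choose else out w

/-- The wires stay the same; one ending in `h(v_i)` now ends in `v_i`. Agreement of `h'` with `h` is
asked only at non-outputs of the reduced graph, because the successor function of the remaining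
translation need not agree on `V_1`. -/
theorem reduced_isWiring {W : Type u} {h h' : V → V} {wire : V → W} {out : W → V}
    (hw : Γ.IsWiring h wire out) (hM : ∀ i, h (M.v i) = M.h i)
    (hh' : ∀ a ∈ M.reduced.verts, a ∉ M.reduced.outputs → h' a = h a) :
    M.reduced.IsWiring h' wire (M.reducedOut wire out) := by
  have hwv : ∀ i, wire (M.v i) = wire (M.h i) := fun i => by
    rw [← hM, hw.wire_succ _ (M.v_mem i) (M.v_not_output i)]
  have hinj : ∀ a ∈ Γ.outputs, ∀ b ∈ Γ.outputs, wire a = wire b → a = b := fun a ha b hb hab => by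
    rw [← hw.out_wire a ha, hab, hw.out_wire b hb]
  refine ⟨fun w => ?_, fun w => ?_, fun o ho => ?_, fun a ha ha' => ?_⟩
  · rw [reducedOut, mem_reduced_outputs]
    split_ifs with hi
    · exact Or.inl ⟨_, rfl⟩
    · refine Or.inr ⟨hw.out_mem w, fun hR => hi ?_⟩
      obtain ⟨i, hi⟩ := M.mem_R.1 hR
      exact ⟨i, by rw [hwv, hi, hw.wire_out]⟩
  · rw [reducedOut]
    split_ifs with hi
    · exact hi.choose_spec
    · exact hw.wire_out w
  · rw [reducedOut]
    rcases M.mem_reduced_outputs.1 ho with ⟨i, rfl⟩ | ⟨hoO, hoR⟩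
    · have hi : ∃ j, wire (M.v j) = wire (M.v i) := ⟨i, rfl⟩
      rw [dif_pos hi]
      have : wire (M.h hi.choose) = wire (M.h i) :=
        (hwv _).symm.trans (hi.choose_spec.trans (hwv i))
      rw [M.h_injective (hinj _ (M.h_mem_output _) _ (M.h_mem_output _) this)]
    · rw [dif_neg, hw.out_wire o hoO]
      rintro ⟨i, hi⟩
      rw [hwv] at hi
      exact hoR (M.mem_R.2 ⟨i, hinj _ (M.h_mem_output _) _ hoO hi⟩)
  · rw [hh' a ha ha']
    obtain ⟨h1, h2, -⟩ := M.mem_reduced_nonoutput.1 ⟨ha, ha'⟩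
    exact hw.wire_succ a h1 h2

end MatchingGFlow

/-! ## Iteration over all layers -/

namespace Translation

variable {V : Type u} [Fintype V]

theorem succ_step_v {Γ : OpenGraph V} (M : MatchingGFlow Γ) (T : Translation M.reduced)
    (i : Fin M.n) : (Translation.step M T).succ (M.v i) = M.h i := by
  have hi : ∃ j, M.v j = M.v i := ⟨i, rfl⟩
  rw [succ]
  dsimp only
  rw [dif_pos hi, M.v_injective hi.choose_spec]

theorem succ_step_of_ne {Γ : OpenGraph V} (M : MatchingGFlow Γ) (T : Translation M.reduced)
    {a : V} (ha : ∀ i, M.v i ≠ a) : (Translation.step M T).succ a = T.succ a := by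
  rw [succ]
  dsimp only
  rw [dif_neg]
  rintro ⟨i, hi⟩
  exact ha i hi

/-- A path cover of the reduced graph is prolonged by the edges from `v_i` to `h(v_i)`. The new
endpoints are distinct and lie in `R_V`, which the reduced paths avoid. -/
theorem isPathCover_succ {Γ : OpenGraph V} (T : Translation Γ) : Γ.IsPathCover T.succ := by
  induction T with
  | done Γ hΓ =>
    exact ⟨fun a ha ha' => absurd (hΓ ▸ ha) ha', fun a ha ha' => absurd (hΓ ▸ ha) ha',
      fun a ha ha' => absurd (hΓ ▸ ha) ha', fun a ha => ⟨0, hΓ ▸ ha⟩⟩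
  | @step Γ M T ih =>
    have hcase : ∀ a ∈ Γ.verts, a ∉ Γ.outputs → (∃ i, M.v i = a) ∨
        (a ∈ M.reduced.verts ∧ a ∉ M.reduced.outputs ∧ (Translation.step M T).succ a = T.succ a) := by
      intro a ha ha'
      by_cases hi : ∃ i, M.v i = a
      · exact Or.inl hi
      · push Not at hi
        have := M.mem_reduced_nonoutput.2 ⟨ha, ha', hi⟩
        exact Or.inr ⟨this.1, this.2, succ_step_of_ne M T hi⟩
    have hR : ∀ a ∈ M.reduced.verts, a ∉ M.reduced.outputs → T.succ a ∉ M.R := fun a h1 h2 =>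
      (M.reduced_adj.1 (ih.adj a h1 h2)).2.2
    refine ⟨?_, ?_, ?_, ?_⟩
    · intro a ha ha'
      rcases hcase a ha ha' with ⟨i, rfl⟩ | ⟨h1, h2, h3⟩
      · rw [succ_step_v]
        exact M.h_adj i
      · rw [h3]
        exact (M.reduced_adj.1 (ih.adj a h1 h2)).1.1
    · intro a ha ha'
      rcases hcase a ha ha' with ⟨i, rfl⟩ | ⟨h1, h2, h3⟩
      · rw [succ_step_v]
        exact M.h_not_input i
      · rw [h3, ← M.reduced_inputs]
        exact ih.not_input a h1 h2
    · intro a ha ha' b hb hb' hab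
      rcases hcase a ha ha' with ⟨i, rfl⟩ | ⟨h1, h2, h3⟩ <;>
        rcases hcase b hb hb' with ⟨j, rfl⟩ | ⟨h4, h5, h6⟩
      · rw [succ_step_v, succ_step_v] at hab
        rw [M.h_injective hab]
      · rw [succ_step_v, h6] at hab
        exact absurd (M.mem_R.2 ⟨i, hab⟩) (hR b h4 h5)
      · rw [succ_step_v, h3] at hab
        exact absurd (M.mem_R.2 ⟨j, hab.symm⟩) (hR a h1 h2)
      · rw [h3, h6] at hab
        exact ih.inj a h1 h2 b h4 h5 hab
    · have hO : ∀ a ∈ M.reduced.outputs, ∃ k : ℕ, (Translation.step M T).succ^[k] a ∈ Γ.outputs := by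
        intro a ha
        rcases M.mem_reduced_outputs.1 ha with ⟨i, rfl⟩ | h
        · refine ⟨1, ?_⟩
          rw [Function.iterate_one, succ_step_v]
          exact M.h_mem_output i
        · exact ⟨0, h.1⟩
      have key : ∀ k : ℕ, ∀ a ∈ M.reduced.verts, T.succ^[k] a ∈ M.reduced.outputs →
          ∃ k' : ℕ, (Translation.step M T).succ^[k'] a ∈ Γ.outputs := by
        intro k
        induction k with
        | zero => exact fun a _ hk => hO a hk
        | succ k ihk =>
          intro a ha hk
          by_cases ha' : a ∈ M.reduced.outputs
          · exact hO a ha'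
          · obtain ⟨k', hk'⟩ := ihk (T.succ a)
              (M.reduced.adj_mem _ _ (ih.adj a ha ha').symm) hk
            refine ⟨k' + 1, ?_⟩
            obtain ⟨-, -, h3⟩ := M.mem_reduced_nonoutput.1 ⟨ha, ha'⟩
            rw [Function.iterate_succ_apply, succ_step_of_ne M T h3]
            exact hk'
      intro a ha
      by_cases haR : a ∈ M.R
      · exact ⟨0, M.R_subset haR⟩
      · have ha' : a ∈ M.reduced.verts := Finset.mem_sdiff.2 ⟨ha, haR⟩
        obtain ⟨k, hk⟩ := ih.reaches a ha'
        exact key k a ha' hk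

/-- The circuit of the layer-by-layer translation implements the post-selected graph state. -/
theorem run_circuit {Γ : OpenGraph V} (T : Translation Γ) {W : Type u} [Fintype W]
    {wire : V → W} {out : W → V} (hw : Γ.IsWiring T.succ wire out) {I : Finset V}
    (hI : I ⊆ Γ.inputs) :
    ∃ c : ℝ, 0 < c ∧ ∀ (α : V → ℝ) (ψ : State I),
      run ((T.circuit α).map (Gate.map wire)) (prepareInput I wire ψ)
        = (c : ℂ) • Γ.pathSum I wire α ψ := by
  induction T generalizing out with
  | done Γ hΓ =>
    refine ⟨(Real.sqrt 2)⁻¹ ^ freshWires I wire, by positivity, fun α ψ => ?_⟩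
    funext x
    -- Without non-outputs the path sum has a single term, the amplitude of the `CZ` circuit itself.
    have h1 : assignments Γ.outputs wire (· ∈ Γ.verts) x
        = {fun a => if a ∈ Γ.outputs then x (wire a) else 0} := by
      ext z
      rw [mem_assignments, Finset.mem_singleton]
      constructor
      · rintro ⟨h1, h2⟩
        funext a
        split_ifs with ha
        · exact h1 a ha
        · exact h2 a ha (hΓ ▸ ha)
      · rintro rfl
        exact ⟨fun o ho => by simp [ho], fun a ha _ => by simp [ha]⟩
    rw [circuit, run_czEdges_map, prepareInput_apply, Pi.smul_apply, OpenGraph.pathSum, h1,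
      Finset.sum_singleton, OpenGraph.amplitude, hΓ, Finset.sdiff_self, Finset.prod_empty,
      mul_one, graphSign, plusAmp_eq, smul_eq_mul]
    have h2 : (fun i : I => if (i : V) ∈ Γ.outputs then x (wire i) else 0)
        = fun i : I => x (wire i) := by
      funext i
      rw [if_pos (hΓ ▸ Γ.inputs_subset (hI i.2))]
    have h3 : Γ.outputEdges = Γ.graph.edgeFinset := by
      refine Finset.filter_true_of_mem fun e he a ha => ?_
      rw [SimpleGraph.mem_edgeFinset] at he
      induction e with
      | _ b c =>
      rcases Sym2.mem_iff.1 ha with rfl | rfl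
      · exact hΓ ▸ Γ.adj_mem _ _ he
      · exact hΓ ▸ Γ.adj_mem _ _ (SimpleGraph.Adj.symm he)
    have h4 : ∏ e ∈ Γ.graph.edgeFinset, edgeSign (x ∘ wire) e = ∏ e ∈ Γ.graph.edgeFinset,
        edgeSign (fun a => if a ∈ Γ.outputs then x (wire a) else 0) e := by
      refine Finset.prod_congr rfl fun e he => ?_
      have hbc := (Finset.mem_filter.1 (h3 ▸ he)).2
      induction e with
      | _ b c =>
      simp only [Sym2.mem_iff, forall_eq_or_imp, forall_eq] at hbc
      simp [edgeSign_mk, hbc.1, hbc.2]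
    rw [h2, h3, h4]
    push_cast
    ring
  | @step Γ M T ih =>
    have hw' := M.reduced_isWiring hw (succ_step_v M T) (h' := T.succ) fun a ha ha' =>
      (succ_step_of_ne M T (M.mem_reduced_nonoutput.1 ⟨ha, ha'⟩).2.2).symm
    obtain ⟨c, hc, hrun⟩ := ih hw' (by rw [M.reduced_inputs]; exact hI)
    -- Each of the `n` gates `J` of the layer contributes `1/√2`; the gates of `U_O` contribute no
    -- factor.
    refine ⟨c * (Real.sqrt 2)⁻¹ ^ M.n, by positivity, fun α ψ => ?_⟩
    rw [circuit, List.map_append, List.map_append, run_append, run_append, hrun, map_smul,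
      M.run_uspt_pathSum hw (succ_step_v M T) hI, map_smul, map_smul, M.run_uO_pathSum hw hI,
      smul_smul, plusAmp_eq]
    push_cast
    rfl

end Translation

/-! ## Preservation of the norm -/

theorem norm_sgn (b : Fin 2) : ‖sgn b‖ = 1 := by
  fin_cases b <;> simp [sgn]

theorem norm_phase (a : ℝ) (b : Fin 2) : ‖phase a b‖ = 1 := by
  rw [phase]
  split_ifs
  · rw [Complex.norm_exp]; simp
  · simp

theorem norm_plusAmp_sq : ‖plusAmp‖ ^ 2 = 1 / 2 := by
  rw [plusAmp_eq, Complex.norm_real, Real.norm_eq_abs, sq_abs, inv_pow, Real.sq_sqrt (by norm_num)]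
  norm_num

/-- The gates `CX` with equal control and target are not unitary and have to be excluded. -/
def Gate.Proper {Q : Type*} : Gate Q → Prop
  | .CX p q => p ≠ q
  | _ => True

/-- The gate mixes only the two amplitudes that differ at `q`, sending `u, v` to `(u ± v)/√2` up to
a phase on `v`; the parallelogram law does the rest. -/
theorem J_op_normSq_pair {Q : Type*} (a : ℝ) (q : Q) (ψ : State Q) (x : Q → Fin 2) :
    ‖(Gate.J a q).op ψ x‖ ^ 2 + ‖(Gate.J a q).op ψ (Function.update x q (x q + 1))‖ ^ 2
      = ‖ψ x‖ ^ 2 + ‖ψ (Function.update x q (x q + 1))‖ ^ 2 := by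
  have key : ∀ u v : ℂ, ‖plusAmp * (u + v)‖ ^ 2 + ‖plusAmp * (u - v)‖ ^ 2 = ‖u‖ ^ 2 + ‖v‖ ^ 2 := by
    intro u v
    have := parallelogram_law_with_norm ℝ u v
    rw [norm_mul, norm_mul, mul_pow, mul_pow, norm_plusAmp_sq]
    nlinarith
  have hJ : ∀ y : Q → Fin 2, (∀ p, p ≠ q → y p = x p) → (Gate.J a q).op ψ y
      = plusAmp * (ψ (Function.update x q 0)
        + sgn (y q) * (phase a 1 * ψ (Function.update x q 1))) := by
    intro y hy
    have hu : ∀ b, Function.update y q b = Function.update x q b := by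
      intro b
      funext p
      by_cases hp : p = q
      · subst hp; simp
      · rw [Function.update_of_ne hp, Function.update_of_ne hp, hy p hp]
    rw [J_op_apply, Fin.sum_univ_two, hu, hu]
    simp only [mul_zero, sgn_zero, mul_one, phase]
    simp
    ring
  rw [hJ x fun _ _ => rfl, hJ _ fun p hp => Function.update_of_ne hp _ _, Function.update_self]
  have h1 := key (ψ (Function.update x q 0)) (phase a 1 * ψ (Function.update x q 1))
  rw [norm_mul (phase a 1), norm_phase, one_mul] at h1
  have hx : x q = 0 ∨ x q = 1 := by
    generalize x q = b
    fin_cases b <;> simp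
  rcases hx with hx | hx
  · have e : Function.update x q 0 = x := by rw [← hx, Function.update_eq_self]
    rw [e] at h1 ⊢
    rw [hx]
    simpa [sgn, sub_eq_add_neg] using h1
  · have e : Function.update x q 1 = x := by rw [← hx, Function.update_eq_self]
    rw [e] at h1 ⊢
    rw [hx]
    have e2 : (1 : Fin 2) + 1 = 0 := rfl
    rw [e2, add_comm (‖ψ x‖ ^ 2), ← h1]
    have e3 : sgn 1 = -1 := by simp [sgn]
    simp only [sgn_zero, e3, one_mul, neg_mul, ← sub_eq_add_neg]
    ring

theorem Gate.normSq_op {Q : Type*} [Fintype Q] (g : Gate Q) (hg : g.Proper) (ψ : State Q) :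
    ∑ x, ‖g.op ψ x‖ ^ 2 = ∑ x, ‖ψ x‖ ^ 2 := by
  cases g with
  | J a q =>
    have hinv : Function.Involutive fun x : Q → Fin 2 => Function.update x q (x q + 1) := by
      intro x
      simp only [Function.update_self, Function.update_idem, fin_two_add_add_cancel,
        Function.update_eq_self]
    have hsum : ∀ F : (Q → Fin 2) → ℝ,
        ∑ x, F x = ∑ x, F (Function.update x q (x q + 1)) := fun F =>
      (Equiv.sum_comp (hinv.toPerm _) F).symm
    have h2 : ∀ F : (Q → Fin 2) → ℝ,
        2 * ∑ x, F x = ∑ x, (F x + F (Function.update x q (x q + 1))) := by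
      intro F
      rw [Finset.sum_add_distrib, ← hsum F, two_mul]
    have h3 := h2 fun x => ‖(Gate.J a q).op ψ x‖ ^ 2
    have h4 := h2 fun x => ‖ψ x‖ ^ 2
    simp only [J_op_normSq_pair] at h3
    linarith
  | CZ p q =>
    refine Finset.sum_congr rfl fun x _ => ?_
    rw [CZ_op_apply, norm_mul, norm_sgn, one_mul]
  | CX p q =>
    have hpq : p ≠ q := hg
    have hinv : Function.Involutive fun x : Q → Fin 2 => Function.update x q (x q + x p) := by
      intro x
      simp only [Function.update_self, Function.update_idem, Function.update_of_ne hpq,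
        fin_two_add_add_cancel, Function.update_eq_self]
    exact Equiv.sum_comp (hinv.toPerm _) fun x => ‖ψ x‖ ^ 2

theorem normSq_run {Q : Type*} [Fintype Q] (l : List (Gate Q)) (hl : ∀ g ∈ l, g.Proper)
    (ψ : State Q) : ∑ x, ‖run l ψ x‖ ^ 2 = ∑ x, ‖ψ x‖ ^ 2 := by
  induction l generalizing ψ with
  | nil => rfl
  | cons g l ih =>
    rw [run_cons, ih fun g' hg' => hl g' (List.mem_cons_of_mem _ hg')]
    exact g.normSq_op (hl g List.mem_cons_self) ψ

/-- As inputs lie on distinct wires, the wires are the inputs together with the fresh ones. With `f`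
fresh wires, each input basis state occurs `2^f` times with weight `2^{-f}`. -/
theorem normSq_prepareInput {V W : Type*} [Fintype W] (I : Finset V) (wire : V → W)
    (hinj : ∀ i ∈ I, ∀ j ∈ I, wire i = wire j → i = j) (ψ : State I) :
    ∑ x, ‖prepareInput I wire ψ x‖ ^ 2 = ∑ y, ‖ψ y‖ ^ 2 := by
  let F := {w : W // ∀ i ∈ I, wire i ≠ w}
  let f : I ⊕ F → W := Sum.elim (fun i => wire i) Subtype.val
  have hf : Function.Bijective f := by
    constructor
    · rintro (i | w) (j | w') h
      · exact congrArg Sum.inl (Subtype.ext (hinj _ i.2 _ j.2 h))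
      · exact absurd h (w'.2 i i.2)
      · exact absurd h.symm (w.2 j j.2)
      · exact congrArg Sum.inr (Subtype.ext h)
    · intro w
      by_cases hw : ∃ i ∈ I, wire i = w
      · obtain ⟨i, hi, rfl⟩ := hw
        exact ⟨Sum.inl ⟨i, hi⟩, rfl⟩
      · push Not at hw
        exact ⟨Sum.inr ⟨w, hw⟩, rfl⟩
  let e : (I → Fin 2) × (F → Fin 2) ≃ (W → Fin 2) :=
    (Equiv.sumArrowEquivProdArrow I F (Fin 2)).symm.trans
      ((Equiv.ofBijective f hf).arrowCongr (Equiv.refl _))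
  have he : ∀ p (i : I), e p (wire i) = p.1 i := by
    intro p i
    have : (Equiv.ofBijective f hf).symm (wire i) = Sum.inl i :=
      (Equiv.ofBijective f hf).symm_apply_apply (Sum.inl i)
    simp only [e, Equiv.arrowCongr, Equiv.trans_apply, Equiv.coe_fn_mk, Function.comp_apply,
      this, Equiv.refl_apply]
    rfl
  have hcard : freshWires I wire = Fintype.card F := by
    rw [freshWires, Fintype.card_subtype]
  rw [← e.sum_comp, Fintype.sum_prod_type]
  refine Finset.sum_congr rfl fun y _ => ?_
  have hterm : ∀ z : F → Fin 2, ‖prepareInput I wire ψ (e (y, z))‖ ^ 2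
      = (1 / 2) ^ Fintype.card F * ‖ψ y‖ ^ 2 := by
    intro z
    rw [prepareInput_apply, norm_mul, mul_pow, norm_pow, hcard, ← pow_mul, mul_comm _ 2, pow_mul,
      norm_plusAmp_sq]
    simp only [he]
  simp only [hterm, Finset.sum_const, Finset.card_univ, Fintype.card_pi, Fintype.card_fin,
    Finset.prod_const, nsmul_eq_mul]
  push_cast
  rw [← mul_assoc, ← mul_pow]
  norm_num

/-- For any schedule, the initial front of a wire through an input is that input, so a wire
determines its input. -/
theorem OpenGraph.wire_inputs_injective {V W : Type u} [Fintype V] {Γ : OpenGraph V} {h : V → V}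
    (hp : Γ.IsPathCover h) {wire : V → W} {out : W → V} (hw : Γ.IsWiring h wire out) :
    ∀ i ∈ Γ.inputs, ∀ j ∈ Γ.inputs, wire i = wire j → i = j := by
  obtain ⟨L, hL⟩ := hp.exists_schedule
  have h1 := (OpenGraph.front_of_schedule hp hw hL).2
  intro i hi j hj hij
  rw [← h1 i hi, hij, h1 j hj]

/-- Control and target of each `CX` are distinct outputs of the open graph at that stage, hence on
distinct wires. -/
theorem Translation.proper_circuit {V : Type u} [Fintype V] {Γ : OpenGraph V}
    (T : Translation Γ) {W : Type u} {wire : V → W} {out : W → V}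
    (hw : Γ.IsWiring T.succ wire out) (α : V → ℝ) :
    ∀ g ∈ (T.circuit α).map (Gate.map wire), g.Proper := by
  induction T generalizing out with
  | done Γ hΓ =>
    intro g hg
    simp only [circuit, czEdges, List.map_map, List.mem_map] at hg
    obtain ⟨e, -, rfl⟩ := hg
    trivial
  | @step Γ M T ih =>
    have hw' := M.reduced_isWiring hw (succ_step_v M T) (h' := T.succ) fun a ha ha' =>
      (succ_step_of_ne M T (M.mem_reduced_nonoutput.1 ⟨ha, ha'⟩).2.2).symm
    intro g hg
    rw [circuit, List.map_append, List.map_append, List.mem_append, List.mem_append] at hg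
    rcases hg with (hg | hg) | hg
    · exact ih hw' g hg
    · simp only [MatchingGFlow.uspt, czStar, List.mem_map, List.mem_flatMap, List.mem_cons] at hg
      obtain ⟨g, ⟨i, -, rfl | ⟨a, -, rfl⟩⟩, rfl⟩ := hg <;> trivial
    · rw [MatchingGFlow.uO, List.map_append, List.mem_append] at hg
      rcases hg with hg | hg
      · simp only [MatchingGFlow.cxAll, MatchingGFlow.cx, cxStar, List.mem_map, List.mem_flatMap,
          Finset.mem_toList] at hg
        obtain ⟨g, ⟨i, -, a, ha, rfl⟩, rfl⟩ := hg
        rw [M.mem_targets] at ha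
        intro hia
        have haO := (Finset.mem_sdiff.1 (M.gV_subset i ha.1)).1
        refine ha.2 ?_
        rw [← hw.out_wire a haO, ← hia, hw.out_wire _ (M.h_mem_output i)]
      · simp only [czEdges, List.map_map, List.mem_map] at hg
        obtain ⟨e, -, rfl⟩ := hg
        trivial

/-! ## The wires of a path cover -/

/-- The first output reached by iterating `h` is constant along paths, so it descends to the
quotient. `Wire` is a quotient of all of `V`, which is why every element has to be a vertex. -/
theorem OpenGraph.IsPathCover.exists_wiring {V : Type u} [Fintype V] {Γ : OpenGraph V}
    (hΓ : Γ.verts = Finset.univ) {h : V → V} (hp : Γ.IsPathCover h) :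
    ∃ out, Γ.IsWiring h (Wire.of Γ.outputs h) out := by
  have hr : ∀ a, ∃ k : ℕ, h^[k] a ∈ Γ.outputs := fun a => hp.reaches a (by simp [hΓ])
  let last : V → V := fun a => h^[Nat.find (hr a)] a
  have hlast : ∀ a, last a ∈ Γ.outputs := fun a => Nat.find_spec (hr a)
  have hstep : ∀ a b, (a ∉ Γ.outputs ∧ h a = b) → last a = last b := by
    rintro a b ⟨ha, rfl⟩
    have h1 : Nat.find (hr a) = Nat.find (hr (h a)) + 1 :=
      Nat.find_comp_succ (hr a) (hr (h a)) ha
    change h^[Nat.find (hr a)] a = _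
    rw [h1, Function.iterate_succ_apply]
  have hout : ∀ o ∈ Γ.outputs, last o = o := by
    intro o ho
    have h1 : Nat.find (hr o) = 0 := (Nat.find_eq_zero _).2 ho
    change h^[Nat.find (hr o)] o = _
    rw [h1, Function.iterate_zero_apply]
  have hof : ∀ a, a ∉ Γ.outputs → Wire.of Γ.outputs h (h a) = Wire.of Γ.outputs h a :=
    fun a ha => (Quot.sound ⟨ha, rfl⟩).symm
  have hwl : ∀ k : ℕ, ∀ a, (∀ j < k, h^[j] a ∉ Γ.outputs) →
      Wire.of Γ.outputs h (h^[k] a) = Wire.of Γ.outputs h a := by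
    intro k
    induction k with
    | zero => exact fun a _ => rfl
    | succ k ih =>
      intro a ha
      rw [Function.iterate_succ_apply', hof _ (ha k (Nat.lt_succ_self k)),
        ih a fun j hj => ha j (by omega)]
  refine ⟨Quot.lift last hstep, ?_, ?_, hout, fun a _ ha => hof a ha⟩
  · rintro ⟨a⟩
    exact hlast a
  · rintro ⟨a⟩
    exact hwl _ a fun j hj => Nat.find_min (hr a) hj

theorem eq_div_smul {E : Type*} [AddCommGroup E] [Module ℂ E] {A B P : E} {c d : ℝ}
    (hA : A = (c : ℂ) • P) (hd : 0 < d) (hB : B = (d : ℂ) • P) : A = ((c / d : ℝ) : ℂ) • B := by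
  rw [hA, hB, smul_smul, ← Complex.ofReal_mul, div_mul_cancel₀ _ hd.ne']

end MBQC

/-! ### Assembly: comparison of the circuits through the common path sum -/

open MBQC in
theorem mainTheorem7 {V : Type*} [Fintype V] (Γ : OpenGraph V) (hΓ : Γ.verts = Finset.univ) :
    -- an open graph with gflow admits a layer-by-layer translation
    ((∃ g lt, Γ.IsGFlow g lt) → Nonempty (Translation Γ)) ∧
    -- the rewriting of the last two layers
    (∀ (M : MatchingGFlow Γ) (h : V → V), Γ.IsPathCover h → (∀ i, h (M.v i) = M.h i) →
      (∃ L, Γ.IsSchedule h L) ∧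
      (∀ k ≤ M.n, (M.seq k).IsPathCover h) ∧
      (∀ i : Fin M.n, graphState (M.seq i).graph Γ.inputs
        = run (M.cx i) ∘ₗ graphState (M.seq (i + 1)).graph Γ.inputs) ∧
      (∀ i : Fin M.n, ∃ c : ℝ, 0 < c ∧ ∀ (α : V → ℝ) (L L' : List V),
        Γ.IsSchedule h L → Γ.IsSchedule h L' →
        run ((M.cx i).map (Gate.map (Wire.of Γ.outputs h)))
            ∘ₗ ((M.seq i).spt h (Wire.of Γ.outputs h) α L).op
            ∘ₗ prepareInput Γ.inputs (Wire.of Γ.outputs h)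
          = (c : ℂ) • (((M.seq (i + 1)).spt h (Wire.of Γ.outputs h) α L').op
            ∘ₗ prepareInput Γ.inputs (Wire.of Γ.outputs h))) ∧
      (∃ c : ℝ, 0 < c ∧ ∀ (α : V → ℝ) (L L' : List V),
        Γ.IsSchedule h L → Γ.IsSchedule h L' →
        (Γ.spt h (Wire.of Γ.outputs h) α L).op ∘ₗ prepareInput Γ.inputs (Wire.of Γ.outputs h)
          = (c : ℂ) • (run (M.uO.map (Gate.map (Wire.of Γ.outputs h)))
            ∘ₗ ((M.seq M.n).spt h (Wire.of Γ.outputs h) α L').op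
            ∘ₗ prepareInput Γ.inputs (Wire.of Γ.outputs h))) ∧
      (∃ c : ℝ, 0 < c ∧ ∀ (α : V → ℝ) (L L' : List V),
        Γ.IsSchedule h L → M.reduced.IsSchedule h L' →
        ((M.seq M.n).spt h (Wire.of Γ.outputs h) α L).op
            ∘ₗ prepareInput Γ.inputs (Wire.of Γ.outputs h)
          = (c : ℂ) • (run ((M.uspt α).map (Gate.map (Wire.of Γ.outputs h)))
            ∘ₗ (M.reduced.spt h (Wire.of Γ.outputs h) α L').op
            ∘ₗ prepareInput Γ.inputs (Wire.of Γ.outputs h)))) ∧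
    -- the result of the iteration over all layers
    (∀ T : Translation Γ, Γ.IsPathCover T.succ ∧
      (∃ c : ℝ, 0 < c ∧ ∀ (α : V → ℝ) (L : List V), Γ.IsSchedule T.succ L →
        (Γ.spt T.succ (Wire.of Γ.outputs T.succ) α L).op
            ∘ₗ prepareInput Γ.inputs (Wire.of Γ.outputs T.succ)
          = (c : ℂ) • (run ((T.circuit α).map (Gate.map (Wire.of Γ.outputs T.succ)))
            ∘ₗ prepareInput Γ.inputs (Wire.of Γ.outputs T.succ))) ∧
      (∀ (α : V → ℝ) (ψ : State Γ.inputs),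
        ∑ x, ‖run ((T.circuit α).map (Gate.map (Wire.of Γ.outputs T.succ)))
            (prepareInput Γ.inputs (Wire.of Γ.outputs T.succ) ψ) x‖ ^ 2
          = ∑ x, ‖ψ x‖ ^ 2)) := by
  refine ⟨fun h => nonempty_translation _ Γ rfl h, fun M h hp hM => ?_, fun T => ?_⟩
  · obtain ⟨out, hw⟩ := hp.exists_wiring hΓ
    have hS := fun (k : ℕ) (hk : k ≤ M.n) => OpenGraph.spt_eq_pathSum
      (M.seq_isPathCover hp hM hk) (M.seq_isWiring hw k) Γ.inputs (M.seq_inputs k).ge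
    refine ⟨hp.exists_schedule, fun k hk => M.seq_isPathCover hp hM hk, M.graphState_seq,
      fun i => ?_, ?_, ?_⟩
    · obtain ⟨c, hc, h1⟩ := hS i i.2.le
      obtain ⟨d, hd, h2⟩ := hS (i + 1) i.2
      refine ⟨c / d, div_pos hc hd, fun α L L' hL hL' => LinearMap.ext fun ψ => ?_⟩
      simp only [LinearMap.comp_apply, LinearMap.smul_apply]
      refine eq_div_smul ?_ hd (h2 α L' (M.seq_isSchedule hL' _) ψ)
      rw [h1 α L (M.seq_isSchedule hL _) ψ, map_smul,
        M.run_cx_pathSum hw (Finset.Subset.refl _) α ψ i (M.graphSign_seq' i)]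
    · obtain ⟨c, hc, h1⟩ := OpenGraph.spt_eq_pathSum hp hw Γ.inputs (Finset.Subset.refl _)
      obtain ⟨d, hd, h2⟩ := hS M.n le_rfl
      refine ⟨c / d, div_pos hc hd, fun α L L' hL hL' => LinearMap.ext fun ψ => ?_⟩
      simp only [LinearMap.comp_apply, LinearMap.smul_apply]
      refine eq_div_smul (h1 α L hL ψ) hd ?_
      rw [h2 α L' (M.seq_isSchedule hL' _) ψ, map_smul,
        M.run_uO_pathSum hw (Finset.Subset.refl _)]
    · obtain ⟨c, hc, h1⟩ := hS M.n le_rfl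
      obtain ⟨d, hd, h2⟩ := OpenGraph.spt_eq_pathSum (M.reduced_isPathCover hp hM)
        (M.reduced_isWiring hw hM fun _ _ _ => rfl) Γ.inputs M.reduced_inputs.ge
      -- The constant of the reduced circuit times one factor `1/√2` for each `J` gate in `U_spt`.
      have hd' : 0 < d * (Real.sqrt 2)⁻¹ ^ M.n := by positivity
      refine ⟨c / (d * (Real.sqrt 2)⁻¹ ^ M.n), div_pos hc hd',
        fun α L L' hL hL' => LinearMap.ext fun ψ => ?_⟩
      simp only [LinearMap.comp_apply, LinearMap.smul_apply]
      refine eq_div_smul (h1 α L (M.seq_isSchedule hL _) ψ) hd' ?_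
      rw [h2 α L' hL' ψ, map_smul, M.run_uspt_pathSum hw hM (Finset.Subset.refl _), smul_smul,
        plusAmp_eq]
      push_cast
      rfl
  · have hp := T.isPathCover_succ
    obtain ⟨out, hw⟩ := hp.exists_wiring hΓ
    refine ⟨hp, ?_, fun α ψ => ?_⟩
    · obtain ⟨c, hc, h1⟩ := OpenGraph.spt_eq_pathSum hp hw Γ.inputs (Finset.Subset.refl _)
      obtain ⟨d, hd, h2⟩ := T.run_circuit hw (Finset.Subset.refl _)
      refine ⟨c / d, div_pos hc hd, fun α L hL => LinearMap.ext fun ψ => ?_⟩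
      simp only [LinearMap.comp_apply, LinearMap.smul_apply]
      exact eq_div_smul (h1 α L hL ψ) hd (h2 α ψ)
    · rw [normSq_run _ (T.proper_circuit hw α),
        normSq_prepareInput _ _ (OpenGraph.wire_inputs_injective hp hw)]
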